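/- Let $\pi(x,y)=ax^3+bx^2y+cxy^2+dy^3$ be a homogeneous cubic polynomial with real coefficients, let $\operatorname{disc}\pi=b^2c^2-4ac^3-4b^3d+18abcd-27a^2d^2$, and let $\alpha>0$. Put $\Lambda_\pi=\{z\in\mathbb R^2:|\pi(z)|\le 1\}$. "Ellipse" means a set $E_H=\{z:\langle Hz,z\rangle\le 1\}$ with $H$ a symmetric positive definite $2\times2$ matrix; $|E|$ is its area, and $E$ is inscribed if $E\subset\Lambda_\pi$. **Notation.** - $\mu_\pi^{-1/2}=\min\{\|z\|:|\pi(z)|=1\}$ (with $\mu_0=0$); $D_\pi$ is the closed disc of radius $\mu_\pi^{-1/2}$ centred at $0$. A point $z_\pi$ is any point with $|\pi(z_\pi)|=1$ and $\|z_\pi\|=\mu_\pi^{-1/2}$, and $U_\pi$ is the rotation which maps $z_\pi$ to $(\|z_\pi\|,0)$. - $2\alpha_\pi^{-1/2}=\max\{\operatorname{diam}E: E\text{ an ellipse},\ D_\pi\subset E\subset\Lambda_\pi\}$, with $\alpha_\pi=0$ if these diameters are unbounded (which happens exactly when $\pi$ is the cube of a linear form). - If $\operatorname{disc}\pi\ne0$,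 $\phi_\pi$ is any invertible matrix such that $\pi\circ\phi_\pi=x(x^2-3y^2)$ (if $\operatorname{disc}\pi>0$) or $\pi\circ\phi_\pi=x(x^2+3y^2)$ (if $\operatorname{disc}\pi<0$); $h_\pi=(\phi_\pi^{-1})^{T}\phi_\pi^{-1}$ if $\operatorname{disc}\pi>0$ and $h_\pi=2^{1/3}(\phi_\pi^{-1})^{T}\phi_\pi^{-1}$ if $\operatorname{disc}\pi<0$; $E_\pi=E_{h_\pi}$, and $2\beta_\pi^{-1/2}=\operatorname{diam}E_\pi$. If $\operatorname{disc}\pi=0$, then $\beta_\pi=0$. - An ellipse $E$ is quadri-tangent to $\Lambda_\pi$ if $\partial E$ and $\partial\Lambda_\pi=\{|\pi|=1\}$ are tangent at four points at least, a tangency point being counted twice if the radii of curvature of the two curves coincide there. Let $\mathcal Q_{\pi,\alpha}$ be the set of inscribed quadri-tangent ellipses of diameter $2\alpha^{-1/2}$. **Statement.** The problem $\sup\{|E|: E\text{ an ellipse},\ E\subset\Lambda_\pi,\ \operatorname{diam}E\le2\alpha^{-1/2}\}$ has a solution, and every solution $E_{\pi,\alpha}$, with matrix $h_{\pi,\alpha}$,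 is described as follows. 1. If $\alpha\ge\mu_\pi$, then $h_{\pi,\alpha}=\alpha\,\mathrm{Id}$ and $E_{\pi,\alpha}$ is the disc of radius $\alpha^{-1/2}$. 2. If $\alpha_\pi\le\alpha\le\mu_\pi$, then a point $z_\pi$ exists, and for every such point $h_{\pi,\alpha}=U_\pi^{T}\operatorname{diag}(\mu_\pi,\alpha)\,U_\pi$. Moreover $E_{\pi,\alpha}$ is the unique ellipse of diameter $2\alpha^{-1/2}$ which is inscribed in $\Lambda_\pi$ and contains $D_\pi$, and it is tangent to $\partial\Lambda_\pi$ at $z_\pi$ and $-z_\pi$. 3. If $\beta_\pi\le\alpha\le\alpha_\pi$, then $E_{\pi,\alpha}\in\mathcal Q_{\pi,\alpha}$, and $E_{\pi,\alpha}$ has a strictly larger area than every other element of $\mathcal Q_{\pi,\alpha}$. The set $\mathcal Q_{\pi,\alpha}$ has at most three elements if $\operatorname{disc}\pi\le0$, and at most four if $\operatorname{disc}\pi>0$. Moreover: - (i) If $\operatorname{disc}\pi<0$, then $\phi_\pi$ exists and, for each choice of it, there is $\lambda\in(0,2]$ with $$h_{\pi,\alpha}=(\phi_\pi^{-1})^{T}\operatorname{diag}\Big(\tfrac{4+\lambda^3}{3\lambda^2},\lambda\Big)\phi_\pi^{-1},\qquad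 \det(h_{\pi,\alpha}-\alpha\,\mathrm{Id})=0 .$$ - (ii) If $\operatorname{disc}\pi>0$, then $\phi_\pi$ exists and, for each choice of it, there are a rotation $V$ by $0$, $60$ or $120$ degrees and $\lambda\in(0,1]$ with $$h_{\pi,\alpha}=(\phi_\pi^{-1})^{T}V^{T}\operatorname{diag}\Big(\tfrac{4-\lambda^3}{3\lambda^2},\lambda\Big)V\phi_\pi^{-1},\qquad \det(h_{\pi,\alpha}-\alpha\,\mathrm{Id})=0 .$$ - (iii) If $\operatorname{disc}\pi=0$ (so that $\alpha_\pi>0$), then there is a linear change of coordinates $\phi$ with $\pi\circ\phi=x^2y$ and, for each such $\phi$, there is $\lambda>0$ with $$h_{\pi,\alpha}=(\phi^{-1})^{T}\operatorname{diag}\Big(\lambda,\tfrac{4}{27\lambda^2}\Big)\phi^{-1},\qquad \det(h_{\pi,\alpha}-\alpha\,\mathrm{Id})=0 .$$ In each case the parameters are those of largest area: any other ellipse of diameter $2\alpha^{-1/2}$ in the displayed family ($\lambda$, and in (ii) also $V$, varying in the stated range) has a strictly smaller area. 4. If $\alpha\le\beta_\pi$, then $h_{\pi,\alpha}=h_\pi$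 for every choice of $\phi_\pi$, and $E_{\pi,\alpha}=E_\pi$ is the unique solution of the unconstrained problem $\sup\{|E|: E\text{ an ellipse},\ E\subset\Lambda_\pi\}$. -/

import Mathlib

open MeasureTheory

noncomputable section

/-- The Euclidean plane. -/
abbrev Plane : Type := EuclideanSpace ℝ (Fin 2)

/-- Real `2 × 2` matrices. -/
abbrev Mat2 : Type := Matrix (Fin 2) (Fin 2) ℝ

/-- The homogeneous cubic polynomial `a x³ + b x² y + c x y² + d y³` with real coefficients. -/
structure BinaryCubic where
  a : ℝ
  b : ℝ
  c : ℝ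
  d : ℝ

namespace BinaryCubic

/-- The value at `(x, y)`. -/
def eval (P : BinaryCubic) (x y : ℝ) : ℝ :=
  P.a * x ^ 3 + P.b * x ^ 2 * y + P.c * x * y ^ 2 + P.d * y ^ 3

/-- The discriminant. -/
def disc (P : BinaryCubic) : ℝ :=
  P.b ^ 2 * P.c ^ 2 - 4 * P.a * P.c ^ 3 - 4 * P.b ^ 3 * P.d + 18 * P.a * P.b * P.c * P.d
    - 27 * P.a ^ 2 * P.d ^ 2

/-- The partial derivative in `x`; the next definitions are the other partial derivatives of first
and second order. -/
def dx (P : BinaryCubic) (x y : ℝ) : ℝ := 3 * P.a * x ^ 2 + 2 * P.b * x * y + P.c * y ^ 2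

def dy (P : BinaryCubic) (x y : ℝ) : ℝ := P.b * x ^ 2 + 2 * P.c * x * y + 3 * P.d * y ^ 2

def dxx (P : BinaryCubic) (x y : ℝ) : ℝ := 6 * P.a * x + 2 * P.b * y

def dxy (P : BinaryCubic) (x y : ℝ) : ℝ := 2 * P.b * x + 2 * P.c * y

def dyy (P : BinaryCubic) (x y : ℝ) : ℝ := 2 * P.c * x + 6 * P.d * y

/-- The set `Λ = {|P| ≤ 1}`. -/
def levelSet (P : BinaryCubic) : Set Plane := {z | |P.eval (z 0) (z 1)| ≤ 1}

end BinaryCubic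

/-- The quadratic form `⟨H z, z⟩`. -/
def quadForm (H : Mat2) (z : Plane) : ℝ := dotProduct z.ofLp (H.mulVec z.ofLp)

/-- The set `{⟨H z, z⟩ ≤ 1}`. The ellipses centred at the origin are exactly these sets for
positive definite `H`, and `H` is determined by its ellipse. -/
def ellipse (H : Mat2) : Set Plane := {z | quadForm H z ≤ 1}

/-- `H` is positive definite and its ellipse is inscribed in `Λ`. -/
def IsInscribed (P : BinaryCubic) (H : Mat2) : Prop :=
  H.PosDef ∧ ellipse H ⊆ P.levelSet

/-- The ellipse of `H` solves `sup {|E| : E ⊆ Λ}`. -/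
def IsUnconstrainedSolution (P : BinaryCubic) (H : Mat2) : Prop :=
  IsInscribed P H ∧ ∀ H' : Mat2, IsInscribed P H' → volume (ellipse H') ≤ volume (ellipse H)

/-- The ellipse of `H` solves `sup {|E| : E ⊆ Λ, diam E ≤ 2 α^{-1/2}}`. -/
def IsConstrainedSolution (P : BinaryCubic) (α : ℝ) (H : Mat2) : Prop :=
  (IsInscribed P H ∧ Metric.diam (ellipse H) ≤ 2 / √α) ∧
    ∀ H' : Mat2, IsInscribed P H' → Metric.diam (ellipse H') ≤ 2 / √α →
      volume (ellipse H') ≤ volume (ellipse H)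

/-- `μ`, given by `μ^{-1/2} = min {‖z‖ : |P z| = 1}`. For `P = 0` the set is empty, `Λ` is the
whole plane, and the value is `0`. -/
def muOf (P : BinaryCubic) : ℝ :=
  1 / (sInf {r : ℝ | ∃ z : Plane, |P.eval (z 0) (z 1)| = 1 ∧ ‖z‖ = r}) ^ 2

/-- The largest disc `D` centred at the origin and inscribed in `Λ` (for `P ≠ 0`). -/
def discOf (P : BinaryCubic) : Set Plane := Metric.closedBall 0 (1 / √(muOf P))

/-- `z` is a point of `{|P| = 1}` at minimal distance `μ^{-1/2}` from the origin. -/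
def IsNearestPoint (P : BinaryCubic) (z : Plane) : Prop :=
  |P.eval (z 0) (z 1)| = 1 ∧ ‖z‖ = 1 / √(muOf P)

/-- `U` is the rotation that maps `z` to `(‖z‖, 0)`. -/
def IsAligningRotation (U : Mat2) (z : Plane) : Prop :=
  U ∈ Matrix.specialOrthogonalGroup (Fin 2) ℝ ∧ U.mulVec z.ofLp = ![‖z‖, 0]

/-- The diameters of the ellipses `E` with `D ⊆ E ⊆ Λ`. -/
def diametersAroundDisc (P : BinaryCubic) : Set ℝ :=
  {δ | ∃ H : Mat2, IsInscribed P H ∧ discOf P ⊆ ellipse H ∧ Metric.diam (ellipse H) = δ}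

open Classical in
/-- `α_P`, given by `2 α_P^{-1/2} = max {diam E : D ⊆ E ⊆ Λ}`, and `0` when these diameters are
unbounded, which happens for `P = (a x + b y)³` only. -/
def alphaOf (P : BinaryCubic) : ℝ :=
  if BddAbove (diametersAroundDisc P) then 4 / (sSup (diametersAroundDisc P)) ^ 2 else 0

/-- `φ` is a linear change of coordinates such that `P ∘ φ` is the polynomial function `q`. -/
def IsChange (P : BinaryCubic) (φ : Mat2) (q : ℝ → ℝ → ℝ) : Prop :=
  φ.det ≠ 0 ∧ ∀ x y : ℝ, P.eval (φ 0 0 * x + φ 0 1 * y) (φ 1 0 * x + φ 1 1 * y) = q x y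

/-- `P ∘ φ = x (x² - 3 y²)` if `disc P > 0`, and `P ∘ φ = x (x² + 3 y²)` if `disc P < 0`. -/
def IsReduction (P : BinaryCubic) (φ : Mat2) : Prop :=
  (0 < P.disc ∧ IsChange P φ fun x y => x * (x ^ 2 - 3 * y ^ 2)) ∨
    (P.disc < 0 ∧ IsChange P φ fun x y => x * (x ^ 2 + 3 * y ^ 2))

/-- The matrix `(φ⁻¹)ᵀ D φ⁻¹`, which defines the image under `φ` of the ellipse of `D`. -/
def transport (φ D : Mat2) : Mat2 := (φ⁻¹).transpose * D * φ⁻¹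

/-- The matrix `(φ⁻¹)ᵀ φ⁻¹` if `disc P > 0`, and `2^{1/3} (φ⁻¹)ᵀ φ⁻¹` if `disc P < 0`. -/
def optimalMatrix (P : BinaryCubic) (φ : Mat2) : Mat2 :=
  if 0 < P.disc then transport φ 1 else (2 : ℝ) ^ (1 / 3 : ℝ) • transport φ 1

open Classical in
/-- `h_P`, obtained from any reduction `φ` of `P` (all of them give the same matrix). It is only
used when `disc P ≠ 0`, in which case a reduction exists. -/
def hOf (P : BinaryCubic) : Mat2 :=
  if h : ∃ φ, IsReduction P φ then optimalMatrix P h.choose else 0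

/-- `β_P`, given by `2 β_P^{-1/2} = diam E_P` with `E_P` the ellipse of `h_P` if `disc P ≠ 0`,
and `0` if `disc P = 0`. -/
def betaOf (P : BinaryCubic) : ℝ :=
  if P.disc = 0 then 0 else 4 / (Metric.diam (ellipse (hOf P))) ^ 2

/-- The points at which `∂E = {⟨H z, z⟩ = 1}` and `∂Λ = {|P| = 1}` are tangent. Both gradients
are nonzero there by Euler's identity. -/
def tangencyPoints (P : BinaryCubic) (H : Mat2) : Set Plane :=
  {z | quadForm H z = 1 ∧ |P.eval (z 0) (z 1)| = 1 ∧
    P.dx (z 0) (z 1) * (H 1 0 * z 0 + H 1 1 * z 1)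
      = P.dy (z 0) (z 1) * (H 0 0 * z 0 + H 0 1 * z 1)}

/-- The curvature of a level curve of `F`, counted positive where the sublevel set is convex, in
terms of the partial derivatives of `F` at the point. -/
def levelCurvature (Fx Fy Fxx Fxy Fyy : ℝ) : ℝ :=
  (Fxx * Fy ^ 2 - 2 * Fxy * Fx * Fy + Fyy * Fx ^ 2) / √(Fx ^ 2 + Fy ^ 2) ^ 3

/-- The curvature of `∂Λ` at a boundary point `(x, y)`: near that point `Λ` is `{s P ≤ 1}` with
`s = P (x, y) ∈ {1, -1}`. -/
def levelSetCurvature (P : BinaryCubic) (x y : ℝ) : ℝ :=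
  levelCurvature (P.eval x y * P.dx x y) (P.eval x y * P.dy x y) (P.eval x y * P.dxx x y)
    (P.eval x y * P.dxy x y) (P.eval x y * P.dyy x y)

/-- The curvature of the boundary of the ellipse of the symmetric matrix `H` at `(x, y)`. -/
def ellipseCurvature (H : Mat2) (x y : ℝ) : ℝ :=
  levelCurvature (2 * (H 0 0 * x + H 0 1 * y)) (2 * (H 1 0 * x + H 1 1 * y))
    (2 * H 0 0) (2 * H 0 1) (2 * H 1 1)

/-- The tangency points at which the two boundaries have the same radius of curvature. -/
def osculationPoints (P : BinaryCubic) (H : Mat2) : Set Plane :=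
  {z | z ∈ tangencyPoints P H ∧
    levelSetCurvature P (z 0) (z 1) = ellipseCurvature H (z 0) (z 1)}

/-- `∂E` is tangent to `∂Λ` at four points at least, a tangency point being counted twice if the
radii of curvature coincide there. -/
def IsQuadriTangent (P : BinaryCubic) (H : Mat2) : Prop :=
  4 ≤ (tangencyPoints P H).encard + (osculationPoints P H).encard

/-- The inscribed quadri-tangent ellipses of diameter `2 α^{-1/2}` (through their matrices). -/
def quadriTangentFamily (P : BinaryCubic) (α : ℝ) : Set Mat2 :=
  {H | IsInscribed P H ∧ IsQuadriTangent P H ∧ Metric.diam (ellipse H) = 2 / √α}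

/-- The rotation by the angle `θ`. -/
def planeRotation (θ : ℝ) : Mat2 := !![Real.cos θ, -Real.sin θ; Real.sin θ, Real.cos θ]

/-- The rotations by `0`, `60` and `120` degrees. -/
def threeRotations : Set Mat2 :=
  {planeRotation 0, planeRotation (Real.pi / 3), planeRotation (2 * Real.pi / 3)}

/-- The family for `disc P < 0`. -/
def familyNeg (φ : Mat2) (l : ℝ) : Mat2 :=
  transport φ (Matrix.diagonal ![(4 + l ^ 3) / (3 * l ^ 2), l])

/-- The family for `disc P > 0`. -/
def familyPos (φ V : Mat2) (l : ℝ) : Mat2 :=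
  transport φ (V.transpose * Matrix.diagonal ![(4 - l ^ 3) / (3 * l ^ 2), l] * V)

/-- The family for `disc P = 0`. -/
def familyZero (φ : Mat2) (l : ℝ) : Mat2 :=
  transport φ (Matrix.diagonal ![l, 4 / (27 * l ^ 2)])

end

open Matrix

/-! Write `q` for the quadratic form of `H`. By homogeneity, inscription means `P ^ 2 ≤ q ^ 3` on
the whole plane, the diameter bound means `q ≥ α ‖z‖ ^ 2`, and a larger area means a smaller
determinant (`isConstrainedSolution_iff`). Compactness gives a minimizer (`exists_isOptimal`). In
the first regime both eigenvalues are at least `α`, and the disc attains this.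

An inscribed ellipse has `q ≥ 1` at a nearest point. If it also contains the largest inscribed disc,
equality holds there, so the nearest point is an eigenvector and one free eigenvalue remains; `α_P`
is its least admissible value. This settles the second regime (`IsOptimal.eq_alignedMatrix`).

The other regimes rest on `IsOptimal.exists_contact`: in coordinates where the optimal ellipse is
the unit disc, no traceless perturbation is positive at all contacts, whether with the cubic or with
the diameter constraint. Two contacts with the cubic, or a single osculating one, reduce `P` to
`canonicalCubic t`. The sign of `1 - 3 t ^ 2` is that of the discriminant, and rescaling the axes
gives the three families.

If the diameter constraint is inactive, first-order optimality leaves `t ^ 2 = 1 / 2` or `t = 1 /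
2`, which is `E_P` (`IsOptimal.eq_optimalMatrix`). That `E_P` is a global optimum follows from a
sharp bound for the discriminant of a cubic that is at most one in absolute value on the unit circle
(`disc_bounds`).

For `β_P ≤ α < α_P` the constraint is active. A single contact direction could be perturbed away
unless it were conjugate to the major axis; then the ellipse would contain the disc, and `α_P ≤ α`.
So there are two contact directions (`IsOptimal.canonical_of_lt`). At `α = α_P` the solution is the
largest ellipse around the disc, which could be enlarged if it were not quadri-tangent
(`isQuadriTangent_alignedMatrix`).

For uniqueness, two optimal ellipses have equal determinants. For zero discriminant this fixes the
parameter. For negative discriminant two parameters can tie, and a second perturbation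
(`IsOptimal.sector`) rules out the larger one. For positive discriminant the parameter is fixed but
not the rotation; two rotations with the same parameter force either a branch without solutions
(`pos_quartic_pos`) or the case excluded by `alphaOf_le_betaOf`. The cardinalities come from
counting positive roots of the equation `det (H - α) = 0` along each family. -/

/-! ### Quadratic forms, positive definiteness and orthonormal frames. -/

/-- The value at `(x, y)` of the quadratic form of `H`. -/
def quadAt (H : Mat2) (x y : ℝ) : ℝ := H 0 0 * x ^ 2 + (H 0 1 + H 1 0) * x * y + H 1 1 * y ^ 2

theorem quadForm_eq_quadAt (H : Mat2) (z : Plane) : quadForm H z = quadAt H (z 0) (z 1) := by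
  simp [quadForm, quadAt, dotProduct, Matrix.mulVec, Fin.sum_univ_two]
  ring

theorem norm_sq_eq (z : Plane) : ‖z‖ ^ 2 = z 0 ^ 2 + z 1 ^ 2 := by
  simp [EuclideanSpace.norm_sq_eq, Fin.sum_univ_two]

theorem quadAt_congr (H ψ : Mat2) (x y : ℝ) :
    quadAt (ψᵀ * H * ψ) x y
      = quadAt H (ψ 0 0 * x + ψ 0 1 * y) (ψ 1 0 * x + ψ 1 1 * y) := by
  simp [quadAt, Matrix.mul_apply, Fin.sum_univ_two]
  ring

theorem quadAt_one (x y : ℝ) : quadAt 1 x y = x ^ 2 + y ^ 2 := by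
  simp [quadAt]

theorem quadAt_smul (c : ℝ) (H : Mat2) (x y : ℝ) : quadAt (c • H) x y = c * quadAt H x y := by
  simp [quadAt]; ring

theorem quadAt_smul_arg (H : Mat2) (c x y : ℝ) :
    quadAt H (c * x) (c * y) = c ^ 2 * quadAt H x y := by
  simp only [quadAt]; ring

theorem posDef_iff_quadAt (H : Mat2) :
    H.PosDef ↔ H 1 0 = H 0 1 ∧ ∀ x y, (x ≠ 0 ∨ y ≠ 0) → 0 < quadAt H x y := by
  rw [Matrix.posDef_iff_dotProduct_mulVec]
  constructor
  · rintro ⟨h1, h2⟩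
    refine ⟨by simpa using h1.apply 0 1, fun x y hxy => ?_⟩
    have := @h2 ![x, y] (by
      intro h
      have h0 := congrFun h 0
      have h1 := congrFun h 1
      simp at h0 h1
      tauto)
    simp [dotProduct, Matrix.mulVec, Fin.sum_univ_two] at this
    unfold quadAt
    linarith
  · rintro ⟨h1, h2⟩
    refine ⟨?_, fun v hv => ?_⟩
    · ext i j
      fin_cases i <;> fin_cases j <;> simp [h1]
    · have := h2 (v 0) (v 1) (by
        by_contra! h
        apply hv
        ext i
        fin_cases i <;> simp [h.1, h.2])
      simp [dotProduct, Matrix.mulVec, Fin.sum_univ_two]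
      unfold quadAt at this
      linarith

theorem Matrix.PosDef.symm_apply {H : Mat2} (h : H.PosDef) : H 1 0 = H 0 1 :=
  ((posDef_iff_quadAt H).1 h).1

theorem Matrix.PosDef.quadAt_pos {H : Mat2} (h : H.PosDef) {x y : ℝ} (hxy : x ≠ 0 ∨ y ≠ 0) :
    0 < quadAt H x y :=
  ((posDef_iff_quadAt H).1 h).2 x y hxy

theorem Matrix.PosDef.quadAt_nonneg {H : Mat2} (h : H.PosDef) (x y : ℝ) : 0 ≤ quadAt H x y := by
  by_cases hxy : x ≠ 0 ∨ y ≠ 0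
  · exact (h.quadAt_pos hxy).le
  · push Not at hxy
    simp [quadAt, hxy.1, hxy.2]

theorem Matrix.PosDef.apply_zero_pos {H : Mat2} (h : H.PosDef) : 0 < H 0 0 := by
  have := h.quadAt_pos (x := 1) (y := 0) (by simp)
  simpa [quadAt] using this

theorem Matrix.PosDef.apply_one_pos {H : Mat2} (h : H.PosDef) : 0 < H 1 1 := by
  have := h.quadAt_pos (x := 0) (y := 1) (by simp)
  simpa [quadAt] using this

/-- An ellipse frame: the columns of `ψ` are orthonormal for `H`. -/
def IsFrame (H ψ : Mat2) : Prop := ψᵀ * H * ψ = 1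

theorem IsFrame.det {H ψ : Mat2} (h : IsFrame H ψ) : ψ.det ^ 2 * H.det = 1 := by
  have := congrArg Matrix.det h
  rw [det_mul, det_mul, det_transpose, det_one] at this
  linarith

theorem IsFrame.det_ne_zero {H ψ : Mat2} (h : IsFrame H ψ) : ψ.det ≠ 0 := by
  intro h0
  have := h.det
  rw [h0] at this
  norm_num at this

theorem IsFrame.quadAt {H ψ : Mat2} (h : IsFrame H ψ) (x y : ℝ) :
    quadAt H (ψ 0 0 * x + ψ 0 1 * y) (ψ 1 0 * x + ψ 1 1 * y) = x ^ 2 + y ^ 2 := by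
  rw [← quadAt_congr, h, quadAt_one]

/-- Every boundary point of an ellipse is the first vector of a frame. -/
theorem exists_isFrame_of_quadAt_eq_one {H : Mat2} (hH : H.PosDef) {x y : ℝ}
    (hxy : quadAt H x y = 1) : ∃ ψ : Mat2, IsFrame H ψ ∧ ψ 0 0 = x ∧ ψ 1 0 = y ∧
      ψ 0 1 = -(H 0 1 * x + H 1 1 * y) / √H.det ∧ ψ 1 1 = (H 0 0 * x + H 0 1 * y) / √H.det := by
  have hd := hH.det_pos
  have hs := hH.symm_apply
  have hsq : 0 < √H.det := Real.sqrt_pos.2 hd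
  have hsq2 : √H.det ^ 2 = H.det := Real.sq_sqrt hd.le
  refine ⟨!![x, -(H 0 1 * x + H 1 1 * y) / √H.det; y, (H 0 0 * x + H 0 1 * y) / √H.det],
    ?_, by simp, by simp, by simp, by simp⟩
  rw [det_fin_two, hs] at hsq2
  rw [det_fin_two, hs] at hsq ⊢
  set s := √(H 0 0 * H 1 1 - H 0 1 * H 0 1)
  unfold IsFrame
  unfold _root_.quadAt at hxy
  rw [hs] at hxy
  ext i j
  fin_cases i <;> fin_cases j <;>
    simp [Matrix.mul_apply, Fin.sum_univ_two, hs]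
  · linarith
  · field_simp
    ring
  · field_simp
    ring
  · field_simp
    rw [hsq2]
    linear_combination (H 0 0 * H 1 1 - H 0 1 * H 0 1) * hxy

theorem exists_isFrame {H : Mat2} (hH : H.PosDef) : ∃ ψ : Mat2, IsFrame H ψ := by
  have h0 := hH.apply_zero_pos
  obtain ⟨ψ, h, -⟩ := exists_isFrame_of_quadAt_eq_one hH (x := 1 / √(H 0 0)) (y := 0) (by
    simp [quadAt, Real.sq_sqrt h0.le]
    field_simp)
  exact ⟨ψ, h⟩

/-- A symmetric `2 × 2` matrix is determined by its quadratic form. -/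
theorem eq_of_quadAt_eq {H K : Mat2} (hH : H 1 0 = H 0 1) (hK : K 1 0 = K 0 1)
    (h : ∀ x y, quadAt H x y = quadAt K x y) : H = K := by
  have h1 := h 1 0
  have h2 := h 0 1
  have h3 := h 1 1
  simp [quadAt] at h1 h2 h3
  ext i j
  fin_cases i <;> fin_cases j <;> simp <;> linarith

theorem exists_coords {ψ : Mat2} (hd : ψ.det ≠ 0) (x y : ℝ) :
    ∃ X Y, x = ψ 0 0 * X + ψ 0 1 * Y ∧ y = ψ 1 0 * X + ψ 1 1 * Y := by
  refine ⟨(ψ 1 1 * x - ψ 0 1 * y) / ψ.det, (-ψ 1 0 * x + ψ 0 0 * y) / ψ.det, ?_, ?_⟩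
  · field_simp; rw [det_fin_two]; ring
  · field_simp; rw [det_fin_two]; ring

theorem quadAt_toLp (H : Mat2) (x y : ℝ) : quadForm H !₂[x, y] = quadAt H x y := by
  rw [quadForm_eq_quadAt]; simp

theorem norm_sq_toLp (x y : ℝ) : ‖(!₂[x, y] : Plane)‖ ^ 2 = x ^ 2 + y ^ 2 := by
  rw [norm_sq_eq]; simp

/-! ### Inscription, area and diameter in homogeneous form. -/

theorem eval_smul_arg (P : BinaryCubic) (c x y : ℝ) :
    P.eval (c * x) (c * y) = c ^ 3 * P.eval x y := by
  simp only [BinaryCubic.eval]; ring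

/-- The ellipse of `H` is inscribed in `{|P| ≤ 1}`, in homogeneous form. -/
def CubicLe (P : BinaryCubic) (H : Mat2) : Prop :=
  ∀ x y, (P.eval x y) ^ 2 ≤ (quadAt H x y) ^ 3

/-- Every direction can be scaled to `q = 1`. A cubic and a quadratic form are then compared through
`P ^ 2` and `q ^ 3`, both of degree six, which also removes the absolute value. -/
theorem isInscribed_iff (P : BinaryCubic) (H : Mat2) :
    IsInscribed P H ↔ H.PosDef ∧ CubicLe P H := by
  unfold IsInscribed
  refine and_congr_right fun hH => ?_
  constructor
  · intro h x y
    by_cases hxy : x ≠ 0 ∨ y ≠ 0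
    · have hq := hH.quadAt_pos hxy
      set c := 1 / √(quadAt H x y) with hc
      have hs : 0 < √(quadAt H x y) := Real.sqrt_pos.2 hq
      have hs2 : √(quadAt H x y) ^ 2 = quadAt H x y := Real.sq_sqrt hq.le
      have hmem : (!₂[c * x, c * y] : Plane) ∈ ellipse H := by
        simp only [ellipse, Set.mem_ofPred_eq, quadAt_toLp, quadAt_smul_arg, hc]
        rw [div_pow, hs2]
        field_simp
        norm_num
      have := h hmem
      simp only [BinaryCubic.levelSet, Set.mem_ofPred_eq] at this
      simp only [Matrix.cons_val_zero, Matrix.cons_val_one, eval_smul_arg] at this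
      rw [← sq_le_one_iff_abs_le_one, mul_pow, hc, ← pow_mul, div_pow] at this
      have e : √(quadAt H x y) ^ (3 * 2) = quadAt H x y ^ 3 := by
        rw [mul_comm, pow_mul, hs2]
      rw [e] at this
      rwa [one_pow, div_mul_eq_mul_div, one_mul, div_le_one (by positivity)] at this
    · push Not at hxy
      simp [quadAt, BinaryCubic.eval, hxy.1, hxy.2]
  · intro h z hz
    simp only [ellipse, Set.mem_ofPred_eq, quadForm_eq_quadAt] at hz
    simp only [BinaryCubic.levelSet, Set.mem_ofPred_eq]
    rw [← sq_le_one_iff_abs_le_one]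
    exact (h _ _).trans (pow_le_one₀ (hH.quadAt_nonneg _ _) hz)

theorem ellipse_eq_image {H ψ : Mat2} (h : IsFrame H ψ) :
    ellipse H = Matrix.toEuclideanLin ψ '' Metric.closedBall 0 1 := by
  have hd := h.det_ne_zero
  ext z
  simp only [ellipse, Set.mem_ofPred_eq, quadForm_eq_quadAt, Set.mem_image, Metric.mem_closedBall,
    dist_zero_right]
  have key : ∀ w : Plane, ‖w‖ ≤ 1 ↔ w 0 ^ 2 + w 1 ^ 2 ≤ 1 := by
    intro w
    rw [← norm_sq_eq, sq_le_one_iff₀ (norm_nonneg _)]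
  constructor
  · intro hz
    obtain ⟨X, Y, hX, hY⟩ := exists_coords hd (z 0) (z 1)
    refine ⟨!₂[X, Y], ?_, ?_⟩
    · rw [hX, hY, h.quadAt] at hz
      rw [key]
      simpa using hz
    · ext i
      fin_cases i <;> simp [hX, hY]
  · rintro ⟨w, hw, rfl⟩
    rw [key] at hw
    simp only [Matrix.toLpLin_apply, Matrix.mulVec, dotProduct, Fin.sum_univ_two]
    rw [h.quadAt]
    exact hw

/-- A frame maps the unit disc onto the ellipse, and its determinant is `± 1 / √H.det`. -/
theorem volume_ellipse {H : Mat2} (hH : H.PosDef) :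
    volume (ellipse H) = ENNReal.ofReal (1 / √H.det) * volume (Metric.closedBall (0 : Plane) 1) := by
  obtain ⟨ψ, h⟩ := exists_isFrame hH
  rw [ellipse_eq_image h, Measure.addHaar_image_linearMap]
  congr 2
  have e : LinearMap.det (Matrix.toEuclideanLin ψ) = ψ.det := by
    rw [Matrix.toEuclideanLin]
    exact LinearMap.det_toLpLin _ _
  rw [e]
  have h1 := h.det
  have hd := hH.det_pos
  have : ψ.det ^ 2 = (1 / √H.det) ^ 2 := by
    rw [div_pow, Real.sq_sqrt hd.le]
    field_simp
    linarith
  rw [← abs_of_nonneg (show (0 : ℝ) ≤ 1 / √H.det by positivity)]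
  exact (sq_eq_sq_iff_abs_eq_abs _ _).1 this

theorem volume_ellipse_le_iff {H K : Mat2} (hH : H.PosDef) (hK : K.PosDef) :
    volume (ellipse K) ≤ volume (ellipse H) ↔ H.det ≤ K.det := by
  rw [volume_ellipse hH, volume_ellipse hK]
  have h0 : volume (Metric.closedBall (0 : Plane) 1) ≠ 0 :=
    (Metric.measure_closedBall_pos _ _ one_pos).ne'
  have h1 : volume (Metric.closedBall (0 : Plane) 1) ≠ ⊤ := measure_closedBall_lt_top.ne
  have hp := Real.sqrt_pos.2 hH.det_pos
  have hq := Real.sqrt_pos.2 hK.det_pos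
  rw [ENNReal.mul_le_mul_iff_left h0 h1, ENNReal.ofReal_le_ofReal_iff (by positivity),
    one_div_le_one_div hq hp, Real.sqrt_le_sqrt_iff hK.det_pos.le]

theorem volume_ellipse_lt_iff {H K : Mat2} (hH : H.PosDef) (hK : K.PosDef) :
    volume (ellipse K) < volume (ellipse H) ↔ H.det < K.det := by
  rw [← not_le, ← not_le, volume_ellipse_le_iff hK hH]

theorem Matrix.PosDef.exists_le_quadAt {H : Mat2} (hH : H.PosDef) :
    ∃ c : ℝ, 0 < c ∧ ∀ x y, c * (x ^ 2 + y ^ 2) ≤ quadAt H x y := by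
  have h0 := hH.apply_zero_pos
  have h1 := hH.apply_one_pos
  have hd := hH.det_pos
  have hs := hH.symm_apply
  rw [det_fin_two, hs] at hd
  refine ⟨(H 0 0 * H 1 1 - H 0 1 * H 0 1) / (H 0 0 + H 1 1), by positivity, fun x y => ?_⟩
  rw [div_mul_eq_mul_div, div_le_iff₀ (by positivity)]
  simp only [quadAt, hs]
  nlinarith [sq_nonneg (H 0 0 * x + H 0 1 * y), sq_nonneg (H 0 1 * x + H 1 1 * y)]

theorem isBounded_ellipse {H : Mat2} (hH : H.PosDef) : Bornology.IsBounded (ellipse H) := by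
  obtain ⟨ψ, h⟩ := exists_isFrame hH
  rw [ellipse_eq_image h]
  have : Continuous (Matrix.toEuclideanLin ψ) := LinearMap.continuous_of_finiteDimensional _
  exact ((isCompact_closedBall (0 : Plane) 1).image this).isBounded

/-- By central symmetry the diameter is twice the largest radius: antipodal boundary points give one
direction, the triangle inequality the other. -/
theorem diam_ellipse_le_iff {H : Mat2} (hH : H.PosDef) {α : ℝ} (hα : 0 < α) :
    Metric.diam (ellipse H) ≤ 2 / √α ↔ ∀ x y, α * (x ^ 2 + y ^ 2) ≤ quadAt H x y := by
  have hsα : 0 < √α := Real.sqrt_pos.2 hα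
  have hsα2 : √α ^ 2 = α := Real.sq_sqrt hα.le
  constructor
  · intro h x y
    by_cases hxy : x ≠ 0 ∨ y ≠ 0
    · have hq := hH.quadAt_pos hxy
      have hs : 0 < √(quadAt H x y) := Real.sqrt_pos.2 hq
      have hs2 : √(quadAt H x y) ^ 2 = quadAt H x y := Real.sq_sqrt hq.le
      set c := 1 / √(quadAt H x y) with hc
      have hm : ∀ e : ℝ, e ^ 2 = 1 → (e • !₂[c * x, c * y] : Plane) ∈ ellipse H := by
        intro e he
        simp only [ellipse, Set.mem_ofPred_eq, quadForm_eq_quadAt, PiLp.smul_apply, smul_eq_mul,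
          Matrix.cons_val_zero, Matrix.cons_val_one, quadAt_smul_arg, he, hc]
        rw [div_pow, hs2]
        field_simp
        norm_num
      have h1 := (Metric.dist_le_diam_of_mem (isBounded_ellipse hH) (hm 1 (by norm_num))
        (hm (-1) (by norm_num))).trans h
      have e : (1 : ℝ) • (!₂[c * x, c * y] : Plane) - (-1 : ℝ) • !₂[c * x, c * y]
          = (2 : ℝ) • !₂[c * x, c * y] := by
        module
      rw [dist_eq_norm, e, norm_smul, Real.norm_of_nonneg (by norm_num : (0 : ℝ) ≤ 2)] at h1
      have h2 : ‖(!₂[c * x, c * y] : Plane)‖ ≤ 1 / √α := by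
        have : 2 / √α = 2 * (1 / √α) := by ring
        linarith
      have h3 := pow_le_pow_left₀ (norm_nonneg _) h2 2
      rw [norm_sq_toLp, div_pow, hsα2, mul_pow, mul_pow, ← mul_add, hc, div_pow, hs2] at h3
      field_simp at h3
      linarith
    · push Not at hxy
      simp [quadAt, hxy.1, hxy.2]
  · intro h
    refine Metric.diam_le_of_forall_dist_le (by positivity) ?_
    have key : ∀ z ∈ ellipse H, ‖z‖ ≤ 1 / √α := by
      intro z hz
      simp only [ellipse, Set.mem_ofPred_eq, quadForm_eq_quadAt] at hz
      have := (h (z 0) (z 1)).trans hz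
      rw [← norm_sq_eq] at this
      apply le_of_sq_le_sq _ (by positivity)
      rw [div_pow, hsα2, one_pow, le_div_iff₀ hα]
      linarith
    intro z hz w hw
    have : 2 / √α = 1 / √α + 1 / √α := by ring
    rw [this, dist_eq_norm]
    exact (norm_sub_le _ _).trans (add_le_add (key z hz) (key w hw))

theorem diam_ellipse_pos {H : Mat2} (hH : H.PosDef) : 0 < Metric.diam (ellipse H) := by
  by_contra! h
  have h0 := hH.apply_zero_pos
  have key := (diam_ellipse_le_iff hH (α := H 0 0 + 1) (by linarith)).1
    (h.trans (by positivity)) 1 0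
  simp [quadAt] at key
  linarith

theorem det_sub_smul (H : Mat2) (α : ℝ) (hs : H 1 0 = H 0 1) :
    (H - α • (1 : Mat2)).det = (H 0 0 - α) * (H 1 1 - α) - H 0 1 ^ 2 := by
  rw [det_fin_two]
  simp [hs]
  ring

/-- If `H - α` is positive semidefinite and nonsingular, then it is positive definite. -/
theorem exists_lt_quadAt {H : Mat2} (hs : H 1 0 = H 0 1) {α : ℝ}
    (h : ∀ x y, α * (x ^ 2 + y ^ 2) ≤ quadAt H x y) (hd : (H - α • (1 : Mat2)).det ≠ 0) :
    ∃ α', α < α' ∧ ∀ x y, α' * (x ^ 2 + y ^ 2) ≤ quadAt H x y := by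
  have hK : ∀ x y, quadAt (H - α • (1 : Mat2)) x y = quadAt H x y - α * (x ^ 2 + y ^ 2) := by
    intro x y
    simp [quadAt]
    ring
  have hdet := det_sub_smul H α hs
  have hpos : (H - α • (1 : Mat2)).PosDef := by
    rw [posDef_iff_quadAt]
    refine ⟨by simp [hs], fun x y hxy => ?_⟩
    by_contra! hle
    have h0 : quadAt H x y = α * (x ^ 2 + y ^ 2) := le_antisymm (by linarith [hK x y]) (h x y)
    have hl : ∀ t a b, 0 ≤ t ^ 2 * (quadAt H a b - α * (a ^ 2 + b ^ 2))
        + 2 * t * (((H 0 0 - α) * x + H 0 1 * y) * a + (H 0 1 * x + (H 1 1 - α) * y) * b) := by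
      intro t a b
      have := h (x + t * a) (y + t * b)
      simp only [quadAt, hs] at this h0 ⊢
      nlinarith
    have lin : ∀ A B : ℝ, (∀ t : ℝ, 0 ≤ t ^ 2 * A + 2 * t * B) → B = 0 := by
      intro A B hAB
      by_contra hB
      have hA := hAB 1
      have hA2 := hAB (-1)
      have hA0 : 0 ≤ A := by linarith
      -- A small step against the linear term makes the expression negative; `A + 1` instead of `A`
      -- allows `A = 0`.
      have := hAB (-B / (A + 1))
      have e : (-B / (A + 1)) ^ 2 * A + 2 * (-B / (A + 1)) * B
          = -(B ^ 2 * (A + 2)) / (A + 1) ^ 2 := by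
        field_simp
        ring
      rw [e, le_div_iff₀ (by positivity)] at this
      have : 0 < B ^ 2 * (A + 2) := by positivity
      linarith
    have l1 := lin _ _ (fun t => hl t 1 0)
    have l2 := lin _ _ (fun t => hl t 0 1)
    simp at l1 l2
    apply hd
    rw [hdet]
    rcases hxy with hx | hy
    · apply mul_left_cancel₀ hx
      linear_combination (H 1 1 - α) * l1 - H 0 1 * l2
    · apply mul_left_cancel₀ hy
      linear_combination (H 0 0 - α) * l2 - H 0 1 * l1
  obtain ⟨c, hc, hc2⟩ := hpos.exists_le_quadAt
  refine ⟨α + c, by linarith, fun x y => ?_⟩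
  have := hc2 x y
  rw [hK] at this
  linarith

/-- Equality says that `α` is the smallest eigenvalue: if `H - α` were nonsingular, a larger `α'`
would still be a lower bound for `q`, and the diameter would be smaller. -/
theorem diam_ellipse_eq_iff {H : Mat2} (hH : H.PosDef) {α : ℝ} (hα : 0 < α) :
    Metric.diam (ellipse H) = 2 / √α ↔
      (∀ x y, α * (x ^ 2 + y ^ 2) ≤ quadAt H x y) ∧ (H - α • (1 : Mat2)).det = 0 := by
  have hs := hH.symm_apply
  have mono : ∀ {β γ : ℝ}, 0 < β → β < γ → 2 / √γ < 2 / √β := by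
    intro β γ hβ hγ
    exact div_lt_div_of_pos_left (by norm_num) (Real.sqrt_pos.2 hβ) (Real.sqrt_lt_sqrt hβ.le hγ)
  constructor
  · intro h
    have h1 := (diam_ellipse_le_iff hH hα).1 h.le
    refine ⟨h1, ?_⟩
    by_contra hd
    obtain ⟨α', h2, h3⟩ := exists_lt_quadAt hs h1 hd
    have := (diam_ellipse_le_iff hH (hα.trans h2)).2 h3
    linarith [mono hα h2]
  · rintro ⟨h1, h2⟩
    refine le_antisymm ((diam_ellipse_le_iff hH hα).2 h1) ?_
    by_contra! hlt
    have hp := diam_ellipse_pos hH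
    set δ := Metric.diam (ellipse H) with hδ
    have e : 2 / √(4 / δ ^ 2) = δ := by
      rw [Real.sqrt_div (by norm_num), Real.sqrt_sq hp.le,
        show (4 : ℝ) = 2 ^ 2 by norm_num, Real.sqrt_sq (by norm_num)]
      field_simp
    have hα' : α < 4 / δ ^ 2 := by
      by_contra! hle
      rcases hle.lt_or_eq with h | h
      · have := mono (by positivity) h
        linarith
      · rw [h] at e
        linarith
    have h3 := (diam_ellipse_le_iff hH (α := 4 / δ ^ 2) (by positivity)).1 e.symm.le
    have hK : (H - α • (1 : Mat2)).PosDef := by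
      rw [posDef_iff_quadAt]
      refine ⟨by simp [hs], fun x y hxy => ?_⟩
      have hxy' : 0 < x ^ 2 + y ^ 2 := by
        rcases hxy with h | h
        · positivity
        · positivity
      have := h3 x y
      have h5 : quadAt (H - α • (1 : Mat2)) x y = quadAt H x y - α * (x ^ 2 + y ^ 2) := by
        simp [quadAt]
        ring
      rw [h5]
      nlinarith
    exact hK.det_pos.ne' h2

/-! ### The constrained problem as minimization of the determinant. -/

/-- `H` is an admissible competitor of the constrained problem, in homogeneous form. -/
structure Feasible (P : BinaryCubic) (α : ℝ) (H : Mat2) : Prop where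
  symm : H 1 0 = H 0 1
  disk : ∀ x y, α * (x ^ 2 + y ^ 2) ≤ quadAt H x y
  cubic : CubicLe P H

theorem Feasible.posDef {P : BinaryCubic} {α : ℝ} {H : Mat2} (hα : 0 < α) (h : Feasible P α H) :
    H.PosDef := by
  rw [posDef_iff_quadAt]
  refine ⟨h.symm, fun x y hxy => lt_of_lt_of_le ?_ (h.disk x y)⟩
  rcases hxy with h | h <;> positivity

theorem feasible_iff {P : BinaryCubic} {α : ℝ} (hα : 0 < α) (H : Mat2) :
    Feasible P α H ↔ IsInscribed P H ∧ Metric.diam (ellipse H) ≤ 2 / √α := by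
  constructor
  · intro h
    have hp := h.posDef hα
    exact ⟨(isInscribed_iff P H).2 ⟨hp, h.cubic⟩, (diam_ellipse_le_iff hp hα).2 h.disk⟩
  · rintro ⟨h1, h2⟩
    obtain ⟨hp, hc⟩ := (isInscribed_iff P H).1 h1
    exact ⟨hp.symm_apply, (diam_ellipse_le_iff hp hα).1 h2, hc⟩

/-- `H` minimizes the determinant among the admissible competitors. -/
def IsOptimal (P : BinaryCubic) (α : ℝ) (H : Mat2) : Prop :=
  Feasible P α H ∧ ∀ K, Feasible P α K → H.det ≤ K.det

theorem isConstrainedSolution_iff {P : BinaryCubic} {α : ℝ} (hα : 0 < α) (H : Mat2) :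
    IsConstrainedSolution P α H ↔ IsOptimal P α H := by
  unfold IsConstrainedSolution IsOptimal
  rw [← feasible_iff hα]
  refine and_congr_right fun hH => ?_
  constructor
  · intro h K hK
    have := (feasible_iff hα K).1 hK
    exact (volume_ellipse_le_iff (hH.posDef hα) (hK.posDef hα)).1 (h K this.1 this.2)
  · intro h K h1 h2
    have hK := (feasible_iff hα K).2 ⟨h1, h2⟩
    exact (volume_ellipse_le_iff (hH.posDef hα) (hK.posDef hα)).2 (h K hK)

/-! ### The number `muOf P`, nearest points and the inscribed disc. -/

theorem continuous_eval (P : BinaryCubic) : Continuous fun z : Plane => P.eval (z 0) (z 1) := by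
  unfold BinaryCubic.eval
  fun_prop

theorem exists_mu (P : BinaryCubic) : ∃ k : ℝ, 0 ≤ k ∧
    (∀ z : Plane, |P.eval (z 0) (z 1)| ≤ k ^ 3 * ‖z‖ ^ 3) ∧
    ∃ w : Plane, ‖w‖ = 1 ∧ |P.eval (w 0) (w 1)| = k ^ 3 := by
  have hne : (Metric.sphere (0 : Plane) 1).Nonempty := ⟨!₂[1, 0], by
    rw [mem_sphere_zero_iff_norm, ← sq_eq_sq₀ (norm_nonneg _) zero_le_one, norm_sq_toLp]; norm_num⟩
  obtain ⟨w, hw, hmax⟩ := (isCompact_sphere (0 : Plane) 1).exists_isMaxOn hne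
    (continuous_eval P).abs.continuousOn
  rw [mem_sphere_zero_iff_norm] at hw
  set m := |P.eval (w 0) (w 1)| with hm
  have hm0 : 0 ≤ m := abs_nonneg _
  have hk3 : (m ^ (1 / 3 : ℝ)) ^ 3 = m := by
    rw [← Real.rpow_natCast, ← Real.rpow_mul hm0]
    norm_num
  refine ⟨m ^ (1 / 3 : ℝ), by positivity, fun z => ?_, w, hw, hk3.symm⟩
  rw [hk3]
  by_cases hz : z = 0
  · simp [hz, BinaryCubic.eval]
  · have hz' : 0 < ‖z‖ := norm_pos_iff.2 hz
    have := hmax (show ‖z‖⁻¹ • z ∈ Metric.sphere (0 : Plane) 1 by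
      rw [mem_sphere_zero_iff_norm, norm_smul, norm_inv, norm_norm, inv_mul_cancel₀ hz'.ne'])
    simp only [Set.mem_ofPred_eq, PiLp.smul_apply, smul_eq_mul, eval_smul_arg, abs_mul, abs_pow,
      abs_inv, abs_norm] at this
    rw [← hm] at this
    rw [inv_pow, inv_mul_le_iff₀ (by positivity)] at this
    linarith

/-- With `k ^ 3` the maximum of `|P|` on the unit circle, `k⁻¹` is the least distance to `{|P| =
1}`. For `k = 0` that set is empty, and the conventions `sInf ∅ = 0` and `1 / 0 = 0` give the value
zero. -/
theorem exists_muOf (P : BinaryCubic) : ∃ k : ℝ, 0 ≤ k ∧ muOf P = k ^ 2 ∧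
    (∀ z : Plane, |P.eval (z 0) (z 1)| ≤ k ^ 3 * ‖z‖ ^ 3) ∧
    (0 < k → ∃ z : Plane, IsNearestPoint P z) := by
  obtain ⟨k, hk, h1, w, hw, h2⟩ := exists_mu P
  rcases hk.eq_or_lt with rfl | hk
  · refine ⟨0, le_rfl, ?_, h1, fun h => absurd h (lt_irrefl _)⟩
    have : {r : ℝ | ∃ z : Plane, |P.eval (z 0) (z 1)| = 1 ∧ ‖z‖ = r} = ∅ := by
      ext r
      simp only [Set.mem_ofPred_eq, Set.mem_empty_iff_false, iff_false]
      rintro ⟨z, hz, -⟩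
      have := h1 z
      rw [hz] at this
      norm_num at this
    simp [muOf, this]
  · have hz1 : |P.eval ((k⁻¹ • w) 0) ((k⁻¹ • w) 1)| = 1 := by
      simp only [PiLp.smul_apply, smul_eq_mul, eval_smul_arg, abs_mul, abs_pow, abs_inv,
        abs_of_pos hk, h2]
      field_simp
    have hz2 : ‖k⁻¹ • w‖ = k⁻¹ := by
      rw [norm_smul, hw, mul_one, Real.norm_of_nonneg (by positivity)]
    have hleast : IsLeast {r : ℝ | ∃ z : Plane, |P.eval (z 0) (z 1)| = 1 ∧ ‖z‖ = r} k⁻¹ := by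
      refine ⟨⟨k⁻¹ • w, hz1, hz2⟩, ?_⟩
      rintro r ⟨z, hz, rfl⟩
      have := h1 z
      rw [hz, ← mul_pow] at this
      have h3 : 1 ≤ k * ‖z‖ := by
        by_contra! hlt
        have := pow_lt_one₀ (by positivity) hlt (n := 3) (by norm_num)
        linarith
      rw [inv_le_iff_one_le_mul₀ hk]
      linarith
    have hmu : muOf P = k ^ 2 := by
      rw [muOf, hleast.csInf_eq]
      field_simp
    refine ⟨k, hk.le, hmu, h1, fun _ => ⟨k⁻¹ • w, hz1, ?_⟩⟩
    rw [hz2, hmu, Real.sqrt_sq hk.le, one_div]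

theorem muOf_nonneg (P : BinaryCubic) : 0 ≤ muOf P := by
  obtain ⟨k, hk, h, -⟩ := exists_muOf P
  rw [h]; positivity

theorem exists_isNearestPoint {P : BinaryCubic} (h : 0 < muOf P) : ∃ z, IsNearestPoint P z := by
  obtain ⟨k, hk, h1, -, h2⟩ := exists_muOf P
  refine h2 (hk.lt_of_ne ?_)
  rintro rfl
  norm_num [h1] at h

theorem eval_sq_le_muOf (P : BinaryCubic) (x y : ℝ) :
    (P.eval x y) ^ 2 ≤ (muOf P * (x ^ 2 + y ^ 2)) ^ 3 := by
  obtain ⟨k, hk, h1, h2, -⟩ := exists_muOf P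
  have := h2 !₂[x, y]
  simp only [Matrix.cons_val_zero, Matrix.cons_val_one] at this
  rw [h1, ← norm_sq_toLp, ← sq_abs]
  calc _ ≤ (k ^ 3 * ‖(!₂[x, y] : Plane)‖ ^ 3) ^ 2 := pow_le_pow_left₀ (abs_nonneg _) this 2
    _ = _ := by ring

theorem one_le_muOf_mul {P : BinaryCubic} {x y : ℝ} (h : |P.eval x y| = 1) :
    1 ≤ muOf P * (x ^ 2 + y ^ 2) := by
  have := eval_sq_le_muOf P x y
  rw [← sq_abs, h] at this
  by_contra! hlt
  have h0 : 0 ≤ muOf P * (x ^ 2 + y ^ 2) := mul_nonneg (muOf_nonneg P) (by positivity)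
  have := pow_lt_one₀ h0 hlt (n := 3) (by norm_num)
  linarith

theorem IsNearestPoint.muOf_mul {P : BinaryCubic} (h : 0 < muOf P) {z : Plane}
    (hz : IsNearestPoint P z) : muOf P * (z 0 ^ 2 + z 1 ^ 2) = 1 := by
  rw [← norm_sq_eq, hz.2, div_pow, Real.sq_sqrt h.le]
  field_simp

theorem discOf_subset_iff {P : BinaryCubic} (h : 0 < muOf P) {H : Mat2} :
    discOf P ⊆ ellipse H ↔ ∀ x y, quadAt H x y ≤ muOf P * (x ^ 2 + y ^ 2) := by
  have hs : 0 < √(muOf P) := Real.sqrt_pos.2 h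
  have hs2 : √(muOf P) ^ 2 = muOf P := Real.sq_sqrt h.le
  constructor
  · intro hsub x y
    by_cases hxy : x ^ 2 + y ^ 2 = 0
    · have h1 : x = 0 := by nlinarith [sq_nonneg x, sq_nonneg y]
      have h2 : y = 0 := by nlinarith [sq_nonneg x, sq_nonneg y]
      simp [quadAt, h1, h2]
    · have hpos : 0 < x ^ 2 + y ^ 2 := lt_of_le_of_ne (by positivity) (Ne.symm hxy)
      set c := 1 / (√(muOf P) * √(x ^ 2 + y ^ 2)) with hc
      have hc2 : c ^ 2 = 1 / (muOf P * (x ^ 2 + y ^ 2)) := by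
        rw [hc, div_pow, mul_pow, hs2, Real.sq_sqrt hpos.le, one_pow]
      have hmem : (!₂[c * x, c * y] : Plane) ∈ discOf P := by
        rw [discOf, mem_closedBall_zero_iff, ← sq_le_sq₀ (norm_nonneg _) (by positivity),
          norm_sq_toLp, mul_pow, mul_pow, ← mul_add, hc2, div_pow, hs2]
        field_simp
        norm_num
      have := hsub hmem
      simp only [ellipse, Set.mem_ofPred_eq, quadAt_toLp, quadAt_smul_arg, hc2] at this
      rwa [div_mul_eq_mul_div, one_mul, div_le_one (by positivity)] at this
  · intro hq z hz
    rw [discOf, mem_closedBall_zero_iff, ← sq_le_sq₀ (norm_nonneg _) (by positivity),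
      norm_sq_eq, div_pow, hs2, one_pow, le_div_iff₀ h] at hz
    simp only [ellipse, Set.mem_ofPred_eq, quadForm_eq_quadAt]
    linarith [hq (z 0) (z 1)]

theorem posDef_smul_one {c : ℝ} (hc : 0 < c) : (c • (1 : Mat2)).PosDef := by
  rw [posDef_iff_quadAt]
  refine ⟨by simp, fun x y hxy => ?_⟩
  rw [quadAt_smul, quadAt_one]
  rcases hxy with h | h <;> positivity

theorem det_smul_one (c : ℝ) : (c • (1 : Mat2)).det = c ^ 2 := by
  rw [det_fin_two]; simp; ring

theorem feasible_smul_one {P : BinaryCubic} {α c : ℝ} (h1 : α ≤ c) (h2 : muOf P ≤ c) :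
    Feasible P α (c • (1 : Mat2)) := by
  refine ⟨by simp, fun x y => ?_, fun x y => ?_⟩
  · rw [quadAt_smul, quadAt_one]
    gcongr
  · rw [quadAt_smul, quadAt_one]
    refine (eval_sq_le_muOf P x y).trans (pow_le_pow_left₀ ?_ ?_ 3)
    · exact mul_nonneg (muOf_nonneg P) (by positivity)
    · gcongr

/-! ### Existence of solutions and the first regime. -/

/-- These are the minors of the positive semidefinite matrix `H - α`. The determinant needs a
separate argument when the upper left entry vanishes, since the usual test vector then gives
nothing. -/
theorem disk_det {H : Mat2} (hs : H 1 0 = H 0 1) {α : ℝ}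
    (h : ∀ x y, α * (x ^ 2 + y ^ 2) ≤ quadAt H x y) :
    α ≤ H 0 0 ∧ α ≤ H 1 1 ∧ H 0 1 ^ 2 ≤ (H 0 0 - α) * (H 1 1 - α) := by
  have h1 := h 1 0
  have h2 := h 0 1
  simp [quadAt] at h1 h2
  refine ⟨h1, h2, ?_⟩
  rcases h1.eq_or_lt with he | hlt
  · have key : ∀ t, 0 ≤ 2 * t * H 0 1 + (H 1 1 - α) := by
      intro t
      have := h t 1
      simp [quadAt, hs] at this
      nlinarith
    have : H 0 1 = 0 := by
      by_contra hne
      have := key (-(H 1 1 - α + 1) / (2 * H 0 1))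
      field_simp at this
      linarith
    rw [this, ← he]
    simp
  · have := h (-H 0 1) (H 0 0 - α)
    simp only [quadAt, hs] at this
    have h3 : 0 ≤ (H 0 0 - α) * ((H 0 0 - α) * (H 1 1 - α) - H 0 1 ^ 2) := by nlinarith
    have := nonneg_of_mul_nonneg_right h3 (by linarith)
    linarith

/-- It suffices to consider competitors whose determinant does not exceed that of an admissible
disc. They satisfy closed conditions and, because `H ≥ α`, form a bounded set. -/
theorem exists_isOptimal (P : BinaryCubic) {α : ℝ} (hα : 0 < α) : ∃ H, IsOptimal P α H := by
  set c := max α (muOf P) with hc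
  set S : Set (ℝ × ℝ × ℝ) := {t | Feasible P α !![t.1, t.2.1; t.2.1, t.2.2] ∧
    t.1 * t.2.2 - t.2.1 * t.2.1 ≤ c ^ 2} with hS
  have hclosed : IsClosed S := by
    have e : S = (⋂ x : ℝ, ⋂ y : ℝ, {t : ℝ × ℝ × ℝ | α * (x ^ 2 + y ^ 2) ≤
          t.1 * x ^ 2 + (t.2.1 + t.2.1) * x * y + t.2.2 * y ^ 2}) ∩
        (⋂ x : ℝ, ⋂ y : ℝ, {t : ℝ × ℝ × ℝ | (P.eval x y) ^ 2 ≤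
          (t.1 * x ^ 2 + (t.2.1 + t.2.1) * x * y + t.2.2 * y ^ 2) ^ 3}) ∩
        {t | t.1 * t.2.2 - t.2.1 * t.2.1 ≤ c ^ 2} := by
      ext t
      simp only [hS, Set.mem_ofPred_eq, Set.mem_inter_iff, Set.mem_iInter]
      refine and_congr_left fun _ => ?_
      constructor
      · intro h
        exact ⟨fun x y => by simpa [quadAt] using h.disk x y,
          fun x y => by simpa [quadAt] using h.cubic x y⟩
      · rintro ⟨h1, h2⟩
        exact ⟨by simp, fun x y => by simpa [quadAt] using h1 x y,
          fun x y => by simpa [quadAt] using h2 x y⟩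
    rw [e]
    refine ((isClosed_iInter fun x => isClosed_iInter fun y => isClosed_le ?_ ?_).inter
      (isClosed_iInter fun x => isClosed_iInter fun y => isClosed_le ?_ ?_)).inter
      (isClosed_le ?_ ?_) <;> fun_prop
  have hbdd : Bornology.IsBounded S := by
    -- Nonnegativity of `det (H - α)` reads `α * trace ≤ det + α ^ 2`, so `R` bounds the trace.
    set R := (c ^ 2 + α ^ 2) / α with hR
    have hsub : S ⊆ Set.Icc (0 : ℝ) R ×ˢ Set.Icc (-R) R ×ˢ Set.Icc (0 : ℝ) R := by
      rintro ⟨p, q, r⟩ ⟨h, hd⟩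
      obtain ⟨h1, h2, h3⟩ := disk_det h.symm h.disk
      simp at h1 h2 h3 hd
      have hpr : p + r ≤ R := by
        rw [hR, le_div_iff₀ hα]
        nlinarith
      have hq : q ^ 2 ≤ R ^ 2 := by nlinarith
      have hR0 : 0 ≤ R := by positivity
      have hq2 := abs_le.1 (abs_le_of_sq_le_sq hq hR0)
      refine ⟨⟨by linarith, by linarith⟩, ⟨?_, ?_⟩, ⟨by linarith, by linarith⟩⟩
      · exact hq2.1
      · exact hq2.2
    exact ((Metric.isBounded_Icc _ _).prod ((Metric.isBounded_Icc _ _).prod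
      (Metric.isBounded_Icc _ _))).subset hsub
  have hcpt : IsCompact S := Metric.isCompact_of_isClosed_isBounded hclosed hbdd
  have hne : S.Nonempty := by
    refine ⟨(c, 0, c), ?_, ?_⟩
    · have := feasible_smul_one (P := P) (α := α) (c := c) (le_max_left _ _) (le_max_right _ _)
      have e : (!![c, 0; 0, c] : Mat2) = c • (1 : Mat2) := by
        ext i j
        fin_cases i <;> fin_cases j <;> simp
      simpa [e] using this
    · simp
      nlinarith
  obtain ⟨⟨p, q, r⟩, ht, hmin⟩ := hcpt.exists_isMinOn hne
    (f := fun t : ℝ × ℝ × ℝ => t.1 * t.2.2 - t.2.1 * t.2.1) (by fun_prop)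
  refine ⟨!![p, q; q, r], ht.1, fun K hK => ?_⟩
  have eK : K = !![K 0 0, K 0 1; K 0 1, K 1 1] := by
    ext i j
    fin_cases i <;> fin_cases j <;> simp [hK.symm]
  rw [det_fin_two, det_fin_two, hK.symm]
  simp only [Matrix.of_apply, Matrix.cons_val', Matrix.cons_val_zero, Matrix.cons_val_one,
    Matrix.cons_val_fin_one]
  by_cases hd : K 0 0 * K 1 1 - K 0 1 * K 0 1 ≤ c ^ 2
  · exact hmin (show (K 0 0, K 0 1, K 1 1) ∈ S from ⟨by rw [eK] at hK; exact hK, hd⟩)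
  · exact ht.2.trans (not_le.1 hd).le

/-- Both eigenvalues are at least `α`, so a determinant of at most `α ^ 2` makes both equal to `α`.
-/
theorem IsOptimal.eq_smul_one {P : BinaryCubic} {α : ℝ} (hα : 0 < α) (h : muOf P ≤ α) {H : Mat2}
    (hH : IsOptimal P α H) : H = α • (1 : Mat2) := by
  have h1 := hH.2 _ (feasible_smul_one le_rfl h)
  rw [det_smul_one, det_fin_two, hH.1.symm] at h1
  obtain ⟨h2, h3, h4⟩ := disk_det hH.1.symm hH.1.disk
  have e1 : H 0 0 = α := by nlinarith
  have e2 : H 1 1 = α := by nlinarith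
  have e3 : H 0 1 = 0 := by
    rw [e1] at h4
    simpa using le_antisymm (by linarith) (sq_nonneg (H 0 1))
  ext i j
  fin_cases i <;> fin_cases j <;> simp [e1, e2, e3, hH.1.symm]

theorem ellipse_smul_one {α : ℝ} (hα : 0 < α) :
    ellipse (α • (1 : Mat2)) = Metric.closedBall 0 (1 / √α) := by
  ext z
  have hs : 0 < √α := Real.sqrt_pos.2 hα
  rw [mem_closedBall_zero_iff, ← sq_le_sq₀ (norm_nonneg _) (by positivity), norm_sq_eq, div_pow,
    Real.sq_sqrt hα.le, one_pow, le_div_iff₀ hα]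
  simp only [ellipse, Set.mem_ofPred_eq, quadForm_eq_quadAt, quadAt_smul, quadAt_one]
  rw [mul_comm]

/-! ### The ellipses around the largest inscribed disc -/

theorem mem_diametersAroundDisc_iff {P : BinaryCubic} (h : 0 < muOf P) {δ : ℝ} :
    δ ∈ diametersAroundDisc P ↔ ∃ H : Mat2, H.PosDef ∧ CubicLe P H ∧
      (∀ x y, quadAt H x y ≤ muOf P * (x ^ 2 + y ^ 2)) ∧ Metric.diam (ellipse H) = δ := by
  simp only [diametersAroundDisc, Set.mem_ofPred_eq, isInscribed_iff, discOf_subset_iff h]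
  simp only [and_assoc]

theorem muOf_disc_mem {P : BinaryCubic} (h : 0 < muOf P) :
    2 / √(muOf P) ∈ diametersAroundDisc P := by
  rw [mem_diametersAroundDisc_iff h]
  have hf := feasible_smul_one (P := P) (α := muOf P) le_rfl le_rfl
  refine ⟨muOf P • 1, posDef_smul_one h, hf.cubic, fun x y => ?_, ?_⟩
  · rw [quadAt_smul, quadAt_one]
  · rw [diam_ellipse_eq_iff (posDef_smul_one h) h]
    exact ⟨hf.disk, by simp⟩

theorem div_sqrt_four_div_sq {δ : ℝ} (h : 0 < δ) : 2 / √(4 / δ ^ 2) = δ := by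
  rw [Real.sqrt_div (by norm_num), Real.sqrt_sq h.le, show (4 : ℝ) = 2 ^ 2 by norm_num,
    Real.sqrt_sq (by norm_num)]
  field_simp

theorem four_div_sq_two_div_sqrt {α : ℝ} (h : 0 < α) : 4 / (2 / √α) ^ 2 = α := by
  rw [div_pow, Real.sq_sqrt h.le]
  field_simp
  norm_num

/-- The ellipses around the disc have all their diameters at most `2 α_P^{-1/2}`. -/
theorem alphaOf_le_quadAt {P : BinaryCubic} (hα : 0 < alphaOf P) (hμ : 0 < muOf P) {H : Mat2}
    (hp : H.PosDef) (hc : CubicLe P H) (hd : ∀ x y, quadAt H x y ≤ muOf P * (x ^ 2 + y ^ 2))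
    (x y : ℝ) : alphaOf P * (x ^ 2 + y ^ 2) ≤ quadAt H x y := by
  have hm := (mem_diametersAroundDisc_iff hμ (δ := Metric.diam (ellipse H))).2 ⟨H, hp, hc, hd, rfl⟩
  revert x y
  rw [← diam_ellipse_le_iff hp hα]
  by_cases hb : BddAbove (diametersAroundDisc P)
  · have hle := le_csSup hb hm
    have hpos : 0 < sSup (diametersAroundDisc P) := (diam_ellipse_pos hp).trans_le hle
    rw [alphaOf, if_pos hb, div_sqrt_four_div_sq hpos]
    exact hle
  · rw [alphaOf, if_neg hb] at hα
    exact absurd hα (lt_irrefl _)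

/-- The supremum is approximated, not attained; this also covers unbounded diameters, where `alphaOf
P = 0`. -/
theorem exists_around_disc_of_alphaOf_lt {P : BinaryCubic} (hμ : 0 < muOf P) {κ : ℝ}
    (hκ : alphaOf P < κ) : ∃ H : Mat2, H.PosDef ∧ CubicLe P H ∧
      (∀ x y, quadAt H x y ≤ muOf P * (x ^ 2 + y ^ 2)) ∧ 2 / √κ < Metric.diam (ellipse H) := by
  have key : ∃ δ ∈ diametersAroundDisc P, 2 / √κ < δ := by
    by_cases hb : BddAbove (diametersAroundDisc P)
    · refine exists_lt_of_lt_csSup ⟨_, muOf_disc_mem hμ⟩ ?_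
      have hle := le_csSup hb (muOf_disc_mem hμ)
      have hpos : 0 < sSup (diametersAroundDisc P) :=
        lt_of_lt_of_le (div_pos two_pos (Real.sqrt_pos.2 hμ)) hle
      rw [alphaOf, if_pos hb] at hκ
      rw [← div_sqrt_four_div_sq hpos]
      exact div_lt_div_of_pos_left (by norm_num) (Real.sqrt_pos.2 (by positivity))
        (Real.sqrt_lt_sqrt (by positivity) hκ)
    · by_contra! hle
      exact hb ⟨_, hle⟩
  obtain ⟨δ, h1, h2⟩ := key
  obtain ⟨H, hp, hc, hd, rfl⟩ := (mem_diametersAroundDisc_iff hμ).1 h1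
  exact ⟨H, hp, hc, hd, h2⟩

theorem alphaOf_le_muOf {P : BinaryCubic} (hμ : 0 < muOf P) : alphaOf P ≤ muOf P := by
  by_contra! h
  have hα := hμ.trans h
  have hf := feasible_smul_one (P := P) (α := muOf P) le_rfl le_rfl
  have := alphaOf_le_quadAt hα hμ (posDef_smul_one hμ) hf.cubic (fun x y => by
    rw [quadAt_smul, quadAt_one]) 1 0
  rw [quadAt_smul, quadAt_one] at this
  linarith

/-! ### Alignment with a nearest point -/

/-- A rotation is determined by the direction that it sends to the first axis. -/
theorem isAligningRotation_iff {U : Mat2} {z : Plane} (hz : 0 < ‖z‖) :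
    IsAligningRotation U z ↔ U = !![z 0 / ‖z‖, z 1 / ‖z‖; -z 1 / ‖z‖, z 0 / ‖z‖] := by
  have hn := norm_sq_eq z
  unfold IsAligningRotation
  rw [Matrix.mem_specialOrthogonalGroup_iff, Matrix.mem_orthogonalGroup_iff]
  constructor
  · rintro ⟨⟨h1, h2⟩, h3⟩
    have e := fun i j => congrFun (congrFun h1 i) j
    have a1 := e 0 0
    have a2 := e 0 1
    have a3 := e 1 1
    simp [Matrix.mul_apply, Fin.sum_univ_two] at a1 a2 a3
    rw [det_fin_two] at h2
    have b1 := congrFun h3 0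
    have b2 := congrFun h3 1
    simp [Matrix.mulVec, dotProduct, Fin.sum_univ_two] at b1 b2
    have c1 : U 1 1 = U 0 0 := by
      linear_combination U 0 0 * h2 + U 0 1 * a2 - U 1 1 * a1
    have c2 : U 1 0 = - U 0 1 := by
      linear_combination -U 1 0 * a1 - U 0 1 * h2 + U 0 0 * a2
    rw [c1, c2] at b2
    have d1 : U 0 0 = z 0 / ‖z‖ := by
      rw [eq_div_iff hz.ne']
      apply mul_right_cancel₀ hz.ne'
      linear_combination U 0 0 * hn + z 1 * b2 + z 0 * b1
    have d2 : U 0 1 = z 1 / ‖z‖ := by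
      rw [eq_div_iff hz.ne']
      apply mul_right_cancel₀ hz.ne'
      linear_combination U 0 1 * hn - z 0 * b2 + z 1 * b1
    ext i j
    fin_cases i <;> fin_cases j <;> simp [c1, c2, d1, d2, neg_div]
  · rintro rfl
    refine ⟨⟨?_, ?_⟩, ?_⟩
    · ext i j
      fin_cases i <;> fin_cases j <;>
        simp [Matrix.mul_apply, Fin.sum_univ_two] <;> field_simp <;> linarith
    · rw [det_fin_two]
      simp
      field_simp
      linarith
    · ext i
      fin_cases i <;> simp [dotProduct, Fin.sum_univ_two] <;> field_simp <;> linarith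

theorem aligned_quadAt (m κ c s x y : ℝ) :
    quadAt ((!![c, s; -s, c] : Mat2)ᵀ * Matrix.diagonal ![m, κ] * !![c, s; -s, c]) x y
      = m * (c * x + s * y) ^ 2 + κ * (-s * x + c * y) ^ 2 := by
  rw [quadAt_congr]
  simp [quadAt]

theorem aligned_symm (m κ : ℝ) (U : Mat2) :
    (Uᵀ * Matrix.diagonal ![m, κ] * U) 1 0 = (Uᵀ * Matrix.diagonal ![m, κ] * U) 0 1 := by
  simp [Matrix.mul_apply, Fin.sum_univ_two]
  ring

/-- The symmetric matrix with eigenvector `z` for the eigenvalue `m`, and second eigenvalue `κ`. -/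
noncomputable def alignedMatrix (z : Plane) (m κ : ℝ) : Mat2 :=
  !![z 0 / ‖z‖, z 1 / ‖z‖; -z 1 / ‖z‖, z 0 / ‖z‖]ᵀ * Matrix.diagonal ![m, κ] *
    !![z 0 / ‖z‖, z 1 / ‖z‖; -z 1 / ‖z‖, z 0 / ‖z‖]

theorem alignedMatrix_symm (z : Plane) (m κ : ℝ) :
    alignedMatrix z m κ 1 0 = alignedMatrix z m κ 0 1 := aligned_symm _ _ _

theorem quadAt_alignedMatrix {z : Plane} (hz : 0 < ‖z‖) (m κ x y : ℝ) :
    ‖z‖ ^ 2 * quadAt (alignedMatrix z m κ) x y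
      = m * (z 0 * x + z 1 * y) ^ 2 + κ * (-z 1 * x + z 0 * y) ^ 2 := by
  rw [alignedMatrix, neg_div, aligned_quadAt]
  field_simp

theorem aligned_sq {z : Plane} (x y : ℝ) :
    ‖z‖ ^ 2 * (x ^ 2 + y ^ 2) = (z 0 * x + z 1 * y) ^ 2 + (-z 1 * x + z 0 * y) ^ 2 := by
  rw [norm_sq_eq]; ring

theorem alignedMatrix_le {z : Plane} (hz : 0 < ‖z‖) {m κ : ℝ} (h : κ ≤ m) (x y : ℝ) :
    quadAt (alignedMatrix z m κ) x y ≤ m * (x ^ 2 + y ^ 2) := by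
  have h1 := quadAt_alignedMatrix hz m κ x y
  have h2 := aligned_sq (z := z) x y
  have hp : 0 < ‖z‖ ^ 2 := by positivity
  refine le_of_mul_le_mul_left ?_ hp
  rw [h1, mul_left_comm, h2]
  nlinarith [sq_nonneg (-z 1 * x + z 0 * y)]

theorem le_alignedMatrix {z : Plane} (hz : 0 < ‖z‖) {m κ : ℝ} (h : κ ≤ m) (x y : ℝ) :
    κ * (x ^ 2 + y ^ 2) ≤ quadAt (alignedMatrix z m κ) x y := by
  have h1 := quadAt_alignedMatrix hz m κ x y
  have h2 := aligned_sq (z := z) x y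
  have hp : 0 < ‖z‖ ^ 2 := by positivity
  refine le_of_mul_le_mul_left ?_ hp
  rw [h1, mul_left_comm, h2]
  nlinarith [sq_nonneg (z 0 * x + z 1 * y)]

theorem alignedMatrix_det {z : Plane} (hz : 0 < ‖z‖) (m κ : ℝ) :
    (alignedMatrix z m κ).det = m * κ := by
  have hn := norm_sq_eq z
  rw [alignedMatrix, det_mul, det_mul, det_transpose, det_diagonal, det_fin_two]
  simp [Fin.prod_univ_two]
  field_simp
  rw [show z 0 ^ 2 - -z 1 ^ 2 = ‖z‖ ^ 2 by rw [hn]; ring]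
  ring

theorem alignedMatrix_posDef {z : Plane} (hz : 0 < ‖z‖) {m κ : ℝ} (hκ : 0 < κ) (h : κ ≤ m) :
    (alignedMatrix z m κ).PosDef := by
  rw [posDef_iff_quadAt]
  refine ⟨alignedMatrix_symm _ _ _, fun x y hxy => lt_of_lt_of_le ?_ (le_alignedMatrix hz h x y)⟩
  rcases hxy with h | h <;> positivity

/-- A matrix whose largest eigenvector is `z` is aligned with `z`. -/
theorem eq_alignedMatrix {z : Plane} (hz : 0 < ‖z‖) {H : Mat2} (hs : H 1 0 = H 0 1) {m : ℝ}
    (h1 : quadAt H (z 0) (z 1) = m * ‖z‖ ^ 2)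
    (h2 : H 0 0 * z 0 + H 0 1 * z 1 = m * z 0) (h3 : H 0 1 * z 0 + H 1 1 * z 1 = m * z 1) :
    H = alignedMatrix z m (quadAt H (-z 1) (z 0) / ‖z‖ ^ 2) := by
  refine eq_of_quadAt_eq hs (alignedMatrix_symm _ _ _) fun x y => ?_
  have hp : ‖z‖ ^ 2 ≠ 0 := by positivity
  apply mul_left_cancel₀ hp
  rw [quadAt_alignedMatrix hz]
  apply mul_left_cancel₀ hp
  rw [mul_add, ← mul_assoc (‖z‖ ^ 2) (_ / _), mul_div_cancel₀ _ hp]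
  have hn := norm_sq_eq z
  rw [hn] at h1 ⊢
  simp only [quadAt, hs] at h1 ⊢
  set a := z 0
  set b := z 1
  have key : (a ^ 2 + b ^ 2) * ((a ^ 2 + b ^ 2) * (H 0 0 * x ^ 2 + (H 0 1 + H 0 1) * x * y + H 1 1 * y ^ 2))
      = (H 0 0 * a ^ 2 + (H 0 1 + H 0 1) * a * b + H 1 1 * b ^ 2) * (a * x + b * y) ^ 2
        + (H 0 0 * (-b) ^ 2 + (H 0 1 + H 0 1) * (-b) * a + H 1 1 * a ^ 2) * (-b * x + a * y) ^ 2
        + 2 * ((H 0 0 * a + H 0 1 * b) * (-b) + (H 0 1 * a + H 1 1 * b) * a)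
          * (a * x + b * y) * (-b * x + a * y) := by ring
  rw [key, h1, h2, h3]
  ring

/-- If `K ≥ 0` as a quadratic form and `K(z) = 0`, then `z` is in the kernel of `K`. -/
theorem kernel_of_quadAt_eq_zero {p q r a b : ℝ}
    (h : ∀ x y : ℝ, 0 ≤ p * x ^ 2 + 2 * q * x * y + r * y ^ 2)
    (h0 : p * a ^ 2 + 2 * q * a * b + r * b ^ 2 = 0) :
    p * a + q * b = 0 ∧ q * a + r * b = 0 := by
  have hl : ∀ u v t : ℝ, 0 ≤ t ^ 2 * (p * u ^ 2 + 2 * q * u * v + r * v ^ 2)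
      + 2 * t * ((p * a + q * b) * u + (q * a + r * b) * v) := by
    intro u v t
    have := h (a + t * u) (b + t * v)
    nlinarith
  have lin : ∀ A B : ℝ, (∀ t : ℝ, 0 ≤ t ^ 2 * A + 2 * t * B) → B = 0 := by
    intro A B hAB
    by_contra hB
    have hA := hAB 1
    have hA2 := hAB (-1)
    have hA0 : 0 ≤ A := by linarith
    have := hAB (-B / (A + 1))
    have e : (-B / (A + 1)) ^ 2 * A + 2 * (-B / (A + 1)) * B
        = -(B ^ 2 * (A + 2)) / (A + 1) ^ 2 := by
      field_simp
      ring
    rw [e, le_div_iff₀ (by positivity)] at this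
    have : 0 < B ^ 2 * (A + 2) := by positivity
    linarith
  have l1 := lin _ _ (hl 1 0)
  have l2 := lin _ _ (hl 0 1)
  constructor <;> linarith

theorem one_le_quadAt_of_eval {P : BinaryCubic} {H : Mat2} (hp : H.PosDef) (hc : CubicLe P H)
    {x y : ℝ} (h : |P.eval x y| = 1) : 1 ≤ quadAt H x y := by
  have := hc x y
  rw [← sq_abs, h] at this
  by_contra! hlt
  have := pow_lt_one₀ (hp.quadAt_nonneg x y) hlt (n := 3) (by norm_num)
  linarith

theorem IsNearestPoint.norm_pos {P : BinaryCubic} (hμ : 0 < muOf P) {z : Plane}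
    (hz : IsNearestPoint P z) : 0 < ‖z‖ := by
  rw [hz.2]
  have := Real.sqrt_pos.2 hμ
  positivity

theorem IsNearestPoint.muOf_mul_norm_sq {P : BinaryCubic} (h : 0 < muOf P) {z : Plane}
    (hz : IsNearestPoint P z) : muOf P * ‖z‖ ^ 2 = 1 := by
  rw [norm_sq_eq, hz.muOf_mul h]

/-- An inscribed ellipse that contains the disc is aligned with the nearest point. -/
theorem eq_alignedMatrix_of_around {P : BinaryCubic} (hμ : 0 < muOf P) {z : Plane}
    (hz : IsNearestPoint P z) {H : Mat2} (hp : H.PosDef) (hc : CubicLe P H)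
    (hd : ∀ x y, quadAt H x y ≤ muOf P * (x ^ 2 + y ^ 2)) :
    H = alignedMatrix z (muOf P) (quadAt H (-z 1) (z 0) / ‖z‖ ^ 2) := by
  have hs := hp.symm_apply
  have h1 := one_le_quadAt_of_eval hp hc hz.1
  have h2 := hd (z 0) (z 1)
  rw [hz.muOf_mul hμ] at h2
  have h3 : quadAt H (z 0) (z 1) = 1 := le_antisymm h2 h1
  have h4 := kernel_of_quadAt_eq_zero (p := muOf P - H 0 0) (q := -H 0 1) (r := muOf P - H 1 1)
    (a := z 0) (b := z 1) (fun x y => by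
      have := hd x y
      simp only [quadAt, hs] at this
      nlinarith) (by
      have h5 := hz.muOf_mul hμ
      simp only [quadAt, hs] at h3
      linarith)
  refine eq_alignedMatrix (hz.norm_pos hμ) hs ?_ ?_ ?_
  · rw [h3, hz.muOf_mul_norm_sq hμ]
  · linarith [h4.1]
  · linarith [h4.2]

theorem cubicLe_mono {P : BinaryCubic} {H K : Mat2} (hH : ∀ x y, 0 ≤ quadAt H x y)
    (h : CubicLe P H) (hle : ∀ x y, quadAt H x y ≤ quadAt K x y) : CubicLe P K :=
  fun x y => (h x y).trans (pow_le_pow_left₀ (hH x y) (hle x y) 3)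

theorem alignedMatrix_mono {z : Plane} (hz : 0 < ‖z‖) (m : ℝ) {κ κ' : ℝ} (h : κ ≤ κ') (x y : ℝ) :
    quadAt (alignedMatrix z m κ) x y ≤ quadAt (alignedMatrix z m κ') x y := by
  refine le_of_mul_le_mul_left ?_ (show 0 < ‖z‖ ^ 2 by positivity)
  rw [quadAt_alignedMatrix hz, quadAt_alignedMatrix hz]
  gcongr

/-- For `κ > α` some inscribed ellipse around the disc has diameter above `2 / √κ`. It is aligned
with `z` and its second eigenvalue is at most `κ`, so raising that eigenvalue to `κ` only shrinks
the ellipse. Letting `κ` decrease to `α` gives the claim even if the supremum is not attained. -/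
theorem feasible_alignedMatrix {P : BinaryCubic} {α : ℝ} (hα : 0 < α) (h1 : alphaOf P ≤ α)
    (h2 : α ≤ muOf P) {z : Plane} (hz : IsNearestPoint P z) :
    Feasible P α (alignedMatrix z (muOf P) α) := by
  have hμ := hα.trans_le h2
  have hn := hz.norm_pos hμ
  refine ⟨alignedMatrix_symm _ _ _, le_alignedMatrix hn h2, ?_⟩
  have key : ∀ κ, α < κ → CubicLe P (alignedMatrix z (muOf P) κ) := by
    intro κ hκ
    have hκ0 := hα.trans hκ
    obtain ⟨H, hp, hc, hd, hdiam⟩ := exists_around_disc_of_alphaOf_lt hμ (h1.trans_lt hκ)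
    have e := eq_alignedMatrix_of_around hμ hz hp hc hd
    set κ' := quadAt H (-z 1) (z 0) / ‖z‖ ^ 2
    by_cases hle : κ' ≤ κ
    · rw [e] at hc hp
      exact cubicLe_mono (fun x y => hp.quadAt_nonneg x y) hc (alignedMatrix_mono hn _ hle)
    · exfalso
      have h3 : κ' ≤ muOf P := by
        have := hd (-z 1) (z 0)
        rw [div_le_iff₀ (by positivity), norm_sq_eq]
        linarith
      have := (diam_ellipse_le_iff hp hκ0).2 (by
        intro x y
        rw [e]
        have := le_alignedMatrix hn h3 x y
        have : κ * (x ^ 2 + y ^ 2) ≤ κ' * (x ^ 2 + y ^ 2) := by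
          have := (not_le.1 hle).le
          gcongr
        linarith)
      linarith
  intro x y
  have hcont : ContinuousWithinAt (fun κ => (quadAt (alignedMatrix z (muOf P) κ) x y) ^ 3)
      (Set.Ioi α) α := by
    have e : (fun κ => (quadAt (alignedMatrix z (muOf P) κ) x y) ^ 3) = fun κ =>
      ((muOf P * (z 0 * x + z 1 * y) ^ 2 + κ * (-z 1 * x + z 0 * y) ^ 2) / ‖z‖ ^ 2) ^ 3 := by
      funext κ
      rw [← quadAt_alignedMatrix hn]
      field_simp
    rw [e]
    apply Continuous.continuousWithinAt
    fun_prop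
  refine ge_of_tendsto hcont ?_
  filter_upwards [self_mem_nhdsWithin] with κ hκ
  exact key κ hκ x y

/-- `A`, `B`, `C` are the values of the form on the nearest point and its quarter turn, of squared
length `n`. Inserting `d3` in the determinant bound gives `A + C ≤ 1 + α * n`, so the lower bounds
for `A` and `C` are equalities. -/
theorem eq_of_det_le {A B C D α m n : ℝ} (hα : 0 < α) (hn0 : 0 < n) (hmn : m * n = 1) (h2 : α ≤ m)
    (hle : D ≤ m * α) (hdet : A * C - B ^ 2 = n ^ 2 * D) (hA : 1 ≤ A)
    (d2 : α * n ≤ C) (d3 : B ^ 2 ≤ (A - α * n) * (C - α * n)) :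
    A = 1 ∧ B = 0 ∧ C = α * n := by
  have hle2 : A * C - B ^ 2 ≤ α * n := by
    rw [hdet]
    calc n ^ 2 * D ≤ n ^ 2 * (m * α) := by gcongr
      _ = α * n * (m * n) := by ring
      _ = _ := by rw [hmn, mul_one]
  have hαn : 0 < α * n := by positivity
  have hA1 : A = 1 := by nlinarith
  have hC1 : C = α * n := by
    have : α * n ≤ 1 := by rw [← hmn]; gcongr
    nlinarith
  have hB0 : B = 0 := by
    have : B ^ 2 ≤ 0 := by
      rw [hC1] at d3
      linarith
    nlinarith
  exact ⟨hA1, hB0, hC1⟩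

/-- In the second regime the ellipse aligned with a nearest point is the only solution. -/
theorem IsOptimal.eq_alignedMatrix {P : BinaryCubic} {α : ℝ} (hα : 0 < α) (h1 : alphaOf P ≤ α)
    (h2 : α ≤ muOf P) {z : Plane} (hz : IsNearestPoint P z) {H : Mat2} (hH : IsOptimal P α H) :
    H = alignedMatrix z (muOf P) α := by
  have hμ := hα.trans_le h2
  have hn := hz.norm_pos hμ
  have hle := hH.2 _ (feasible_alignedMatrix hα h1 h2 hz)
  rw [alignedMatrix_det hn] at hle
  have hp := hH.1.posDef hα
  have hs := hH.1.symm
  have h3 := one_le_quadAt_of_eval hp hH.1.cubic hz.1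
  have h4 := hz.muOf_mul hμ
  have hz2 := norm_sq_eq z
  set n := ‖z‖ ^ 2 with hnn
  have hn0 : 0 < n := by positivity
  set m := muOf P
  set A := quadAt H (z 0) (z 1) with hA
  set B := (H 0 0 * z 0 + H 0 1 * z 1) * (-z 1) + (H 0 1 * z 0 + H 1 1 * z 1) * z 0 with hB
  set C := quadAt H (-z 1) (z 0) with hC
  have hmn : m * n = 1 := by rw [hz2]; exact h4
  have hdet : A * C - B ^ 2 = n ^ 2 * H.det := by
    rw [det_fin_two, hA, hB, hC, hz2]
    simp only [quadAt, hs]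
    ring
  have hconj : ∀ x y : ℝ, 0 ≤ (A - α * n) * x ^ 2 + 2 * B * x * y + (C - α * n) * y ^ 2 := by
    intro x y
    have := hH.1.disk (x * z 0 - y * z 1) (x * z 1 + y * z 0)
    rw [hz2, hA, hB, hC]
    simp only [quadAt, hs] at this ⊢
    nlinarith
  have hD := disk_det (H := !![A, B; B, C]) (α := α * n) (by simp) (by
    intro x y
    have := hconj x y
    simp only [quadAt]
    simp
    linarith)
  simp at hD
  obtain ⟨-, d2, d3⟩ := hD
  have hA1' : 1 ≤ A := h3
  clear_value A B C n m
  obtain ⟨hA1, hB0, hC1⟩ := eq_of_det_le hα hn0 hmn h2 hle hdet hA1' d2 d3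
  have e := _root_.eq_alignedMatrix hn hs (m := m) (by rw [← hnn, hmn, ← hA, hA1]) ?_ ?_
  · rw [← hC, ← hnn, hC1, mul_div_assoc, div_self hn0.ne', mul_one] at e
    exact e
  · apply mul_left_cancel₀ hn0.ne'
    have : n * (m * z 0) = z 0 := by rw [← mul_assoc, mul_comm n, hmn, one_mul]
    rw [this, hz2]
    have hA' : quadAt H (z 0) (z 1) = 1 := hA ▸ hA1
    simp only [quadAt, hs] at hA'
    rw [hB] at hB0
    linear_combination z 0 * hA' - z 1 * hB0
  · apply mul_left_cancel₀ hn0.ne'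
    have : n * (m * z 1) = z 1 := by rw [← mul_assoc, mul_comm n, hmn, one_mul]
    rw [this, hz2]
    have hA' : quadAt H (z 0) (z 1) = 1 := hA ▸ hA1
    simp only [quadAt, hs] at hA'
    rw [hB] at hB0
    linear_combination z 1 * hA' + z 0 * hB0

theorem det_alignedMatrix_sub {z : Plane} (hz : 0 < ‖z‖) (m κ : ℝ) :
    (alignedMatrix z m κ - κ • (1 : Mat2)).det = 0 := by
  have e : alignedMatrix z m κ - κ • (1 : Mat2) = alignedMatrix z (m - κ) 0 := by
    refine eq_of_quadAt_eq (by simp [alignedMatrix_symm]) (alignedMatrix_symm _ _ _) fun x y => ?_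
    have h1 : quadAt (alignedMatrix z m κ - κ • (1 : Mat2)) x y
        = quadAt (alignedMatrix z m κ) x y - κ * (x ^ 2 + y ^ 2) := by
      simp [quadAt]; ring
    rw [h1]
    apply mul_left_cancel₀ (show ‖z‖ ^ 2 ≠ 0 by positivity)
    rw [mul_sub, quadAt_alignedMatrix hz, quadAt_alignedMatrix hz, mul_left_comm, aligned_sq]
    ring
  rw [e, alignedMatrix_det hz, mul_zero]

theorem diam_alignedMatrix {z : Plane} (hz : 0 < ‖z‖) {m κ : ℝ} (hκ : 0 < κ) (h : κ ≤ m) :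
    Metric.diam (ellipse (alignedMatrix z m κ)) = 2 / √κ :=
  (diam_ellipse_eq_iff (alignedMatrix_posDef hz hκ h) hκ).2
    ⟨le_alignedMatrix hz h, det_alignedMatrix_sub hz m κ⟩

theorem eq_alignedMatrix_of_around_of_diam {P : BinaryCubic} {α : ℝ} (hα : 0 < α)
    (h2 : α ≤ muOf P) {z : Plane} (hz : IsNearestPoint P z) {H : Mat2} (hp : H.PosDef)
    (hc : CubicLe P H) (hd : ∀ x y, quadAt H x y ≤ muOf P * (x ^ 2 + y ^ 2))
    (hdiam : Metric.diam (ellipse H) = 2 / √α) : H = alignedMatrix z (muOf P) α := by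
  have hμ := hα.trans_le h2
  have hn := hz.norm_pos hμ
  have e := eq_alignedMatrix_of_around hμ hz hp hc hd
  set κ := quadAt H (-z 1) (z 0) / ‖z‖ ^ 2
  have hκm : κ ≤ muOf P := by
    have := hd (-z 1) (z 0)
    rw [div_le_iff₀ (by positivity), norm_sq_eq]
    linarith
  have hκ : 0 < κ := by
    refine div_pos (hp.quadAt_pos ?_) (by positivity)
    by_contra! h
    have := norm_sq_eq z
    rw [h.2, neg_eq_zero.1 h.1] at this
    norm_num at this
    exact hn.ne' (by rw [this, norm_zero])
  have h3 := diam_alignedMatrix hn hκ hκm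
  rw [← e, hdiam] at h3
  have : κ = α := by rw [← four_div_sq_two_div_sqrt hκ, ← h3, four_div_sq_two_div_sqrt hα]
  rw [this] at e
  exact e

/-! ### Contact points and linear substitutions. -/

/-- Boundary points of an inscribed ellipse on the level curve are points of tangency. -/
theorem cubic_gradient {P : BinaryCubic} {H : Mat2} (hp : H.PosDef) (hc : CubicLe P H) {x y : ℝ}
    (hq : quadAt H x y = 1) (he : (P.eval x y) ^ 2 = 1) :
    P.eval x y * P.dx x y = 3 * (H 0 0 * x + H 0 1 * y) ∧
    P.eval x y * P.dy x y = 3 * (H 0 1 * x + H 1 1 * y) := by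
  have hs := hp.symm_apply
  have key : ∀ u v : ℝ, P.eval x y * (P.dx x y * u + P.dy x y * v)
      = 3 * ((H 0 0 * x + H 0 1 * y) * u + (H 0 1 * x + H 1 1 * y) * v) := by
    intro u v
    -- Inscription makes this function nonnegative, and the contact makes it vanish at `0`; its
    -- derivative there is the wanted relation.
    set f : ℝ → ℝ := fun t => (quadAt H (x + t * u) (y + t * v)) ^ 3
      - (P.eval (x + t * u) (y + t * v)) ^ 2 with hf
    have hmin : IsLocalMin f 0 := by
      refine Filter.Eventually.of_forall fun t => ?_
      have h0 : f 0 = 0 := by simp [hf, hq, he]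
      rw [h0]
      exact sub_nonneg.2 (hc _ _)
    have hx : HasDerivAt (fun t : ℝ => x + t * u) u 0 := by
      simpa using ((hasDerivAt_id (0 : ℝ)).mul_const u).const_add x
    have hy : HasDerivAt (fun t : ℝ => y + t * v) v 0 := by
      simpa using ((hasDerivAt_id (0 : ℝ)).mul_const v).const_add y
    have hQ : HasDerivAt (fun t : ℝ => quadAt H (x + t * u) (y + t * v))
        (2 * ((H 0 0 * x + H 0 1 * y) * u + (H 0 1 * x + H 1 1 * y) * v)) 0 := by
      unfold quadAt
      have := (((hx.pow 2).const_mul (H 0 0)).add ((hx.const_mul (H 0 1 + H 1 0)).mul hy)).add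
        ((hy.pow 2).const_mul (H 1 1))
      refine this.congr_deriv ?_
      simp [hs]
      ring
    have hP : HasDerivAt (fun t : ℝ => P.eval (x + t * u) (y + t * v))
        (P.dx x y * u + P.dy x y * v) 0 := by
      unfold BinaryCubic.eval BinaryCubic.dx BinaryCubic.dy
      have := ((((hx.pow 3).const_mul P.a).add (((hx.pow 2).const_mul P.b).mul hy)).add
        ((hx.const_mul P.c).mul (hy.pow 2))).add ((hy.pow 3).const_mul P.d)
      refine this.congr_deriv ?_
      simp
      ring
    have hF := (hQ.pow 3).sub (hP.pow 2)
    have := hmin.hasDerivAt_eq_zero hF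
    simp [hq] at this
    linarith
  have k1 := key 1 0
  have k2 := key 0 1
  constructor <;> linarith

/-- By `cubic_gradient` the gradients are parallel at every common boundary point, so for an
inscribed ellipse tangency is automatic. -/
theorem mem_tangencyPoints_iff {P : BinaryCubic} {H : Mat2} (hp : H.PosDef) (hc : CubicLe P H)
    (z : Plane) : z ∈ tangencyPoints P H ↔
      quadAt H (z 0) (z 1) = 1 ∧ |P.eval (z 0) (z 1)| = 1 := by
  simp only [tangencyPoints, Set.mem_ofPred_eq, quadForm_eq_quadAt]
  refine ⟨fun h => ⟨h.1, h.2.1⟩, fun h => ⟨h.1, h.2, ?_⟩⟩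
  have he : (P.eval (z 0) (z 1)) ^ 2 = 1 := by rw [← sq_abs, h.2]; norm_num
  obtain ⟨g1, g2⟩ := cubic_gradient hp hc h.1 he
  have hne : P.eval (z 0) (z 1) ≠ 0 := by
    intro h0
    rw [h0] at he
    norm_num at he
  rw [hp.symm_apply]
  apply mul_left_cancel₀ hne
  linear_combination (H 0 1 * z 0 + H 1 1 * z 1) * g1 - (H 0 0 * z 0 + H 0 1 * z 1) * g2

theorem eval_neg (P : BinaryCubic) (x y : ℝ) : P.eval (-x) (-y) = -P.eval x y := by
  simp only [BinaryCubic.eval]; ring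

theorem quadAt_neg (H : Mat2) (x y : ℝ) : quadAt H (-x) (-y) = quadAt H x y := by
  simp only [quadAt]; ring

/-- The composition of `P` with the linear map `ψ`. -/
def BinaryCubic.comp (P : BinaryCubic) (ψ : Mat2) : BinaryCubic where
  a := P.eval (ψ 0 0) (ψ 1 0)
  b := P.dx (ψ 0 0) (ψ 1 0) * ψ 0 1 + P.dy (ψ 0 0) (ψ 1 0) * ψ 1 1
  c := P.dx (ψ 0 1) (ψ 1 1) * ψ 0 0 + P.dy (ψ 0 1) (ψ 1 1) * ψ 1 0
  d := P.eval (ψ 0 1) (ψ 1 1)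

theorem eval_comp (P : BinaryCubic) (ψ : Mat2) (x y : ℝ) :
    (P.comp ψ).eval x y = P.eval (ψ 0 0 * x + ψ 0 1 * y) (ψ 1 0 * x + ψ 1 1 * y) := by
  simp only [BinaryCubic.eval, BinaryCubic.comp, BinaryCubic.dx, BinaryCubic.dy]
  ring

theorem disc_comp (P : BinaryCubic) (ψ : Mat2) : (P.comp ψ).disc = ψ.det ^ 6 * P.disc := by
  rw [det_fin_two]
  simp only [BinaryCubic.eval, BinaryCubic.comp, BinaryCubic.dx, BinaryCubic.dy, BinaryCubic.disc]
  ring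

/-- The coefficients of a cubic are determined by its values. -/
theorem coeff_of_eval_eq {P : BinaryCubic} {a b c d : ℝ}
    (h : ∀ x y, P.eval x y = a * x ^ 3 + b * x ^ 2 * y + c * x * y ^ 2 + d * y ^ 3) :
    P.a = a ∧ P.b = b ∧ P.c = c ∧ P.d = d := by
  have h1 := h 1 0
  have h2 := h 0 1
  have h3 := h 1 1
  have h4 := h 1 (-1)
  simp [BinaryCubic.eval] at h1 h2 h3 h4
  refine ⟨h1, ?_, ?_, h2⟩ <;> linarith

theorem isChange_iff (P : BinaryCubic) (φ : Mat2) (q : ℝ → ℝ → ℝ) :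
    IsChange P φ q ↔ φ.det ≠ 0 ∧ ∀ x y, (P.comp φ).eval x y = q x y := by
  simp only [IsChange, eval_comp]

theorem eval_comp_mul (P : BinaryCubic) (ψ σ : Mat2) (x y : ℝ) :
    (P.comp (ψ * σ)).eval x y
      = (P.comp ψ).eval (σ 0 0 * x + σ 0 1 * y) (σ 1 0 * x + σ 1 1 * y) := by
  simp only [eval_comp, Matrix.mul_apply, Fin.sum_univ_two]
  ring_nf

/-! ### Transport of matrices -/

theorem transport_eq_iff {φ D H : Mat2} (hd : φ.det ≠ 0) :
    H = transport φ D ↔ φᵀ * H * φ = D := by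
  have hu : IsUnit φ.det := isUnit_iff_ne_zero.2 hd
  have h1 : φ * φ⁻¹ = 1 := Matrix.mul_nonsing_inv φ hu
  have h2 : φ⁻¹ * φ = 1 := Matrix.nonsing_inv_mul φ hu
  have h3 : (φ⁻¹)ᵀ * φᵀ = 1 := by rw [← transpose_mul, h1, transpose_one]
  have h4 : φᵀ * (φ⁻¹)ᵀ = 1 := by rw [← transpose_mul, h2, transpose_one]
  unfold transport
  constructor
  · rintro rfl
    calc φᵀ * ((φ⁻¹)ᵀ * D * φ⁻¹) * φ = (φᵀ * (φ⁻¹)ᵀ) * D * (φ⁻¹ * φ) := by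
          simp only [Matrix.mul_assoc]
      _ = D := by rw [h4, h2, Matrix.one_mul, Matrix.mul_one]
  · rintro rfl
    calc H = ((φ⁻¹)ᵀ * φᵀ) * H * (φ * φ⁻¹) := by rw [h3, h1, Matrix.one_mul, Matrix.mul_one]
      _ = _ := by simp only [Matrix.mul_assoc]

theorem congr_transport {φ : Mat2} (hd : φ.det ≠ 0) (D : Mat2) : φᵀ * transport φ D * φ = D :=
  (transport_eq_iff hd).1 rfl

theorem quadAt_transport {φ : Mat2} (hd : φ.det ≠ 0) (D : Mat2) (X Y : ℝ) :
    quadAt (transport φ D) (φ 0 0 * X + φ 0 1 * Y) (φ 1 0 * X + φ 1 1 * Y) = quadAt D X Y := by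
  rw [← quadAt_congr, congr_transport hd]

theorem transport_symm {φ D : Mat2} (h : D 1 0 = D 0 1) :
    transport φ D 1 0 = transport φ D 0 1 := by
  simp only [transport, Matrix.mul_apply, Fin.sum_univ_two, Matrix.transpose_apply, h]
  ring

theorem det_transport {φ : Mat2} (hd : φ.det ≠ 0) (D : Mat2) :
    φ.det ^ 2 * (transport φ D).det = D.det := by
  have := congrArg Matrix.det (congr_transport hd D)
  rw [det_mul, det_mul, det_transpose] at this
  linarith

theorem transport_mul (φ σ D : Mat2) : transport (φ * σ) D = transport φ (transport σ D) := by
  simp only [transport, Matrix.mul_inv_rev, transpose_mul, Matrix.mul_assoc]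

theorem cubicLe_transport {P : BinaryCubic} {φ D : Mat2} (hd : φ.det ≠ 0)
    (h : CubicLe (P.comp φ) D) : CubicLe P (transport φ D) := by
  intro x y
  obtain ⟨X, Y, rfl, rfl⟩ := exists_coords hd x y
  rw [← eval_comp, quadAt_transport hd]
  exact h X Y

theorem transport_posDef {φ D : Mat2} (hd : φ.det ≠ 0) (h : D.PosDef) :
    (transport φ D).PosDef := by
  rw [posDef_iff_quadAt]
  refine ⟨transport_symm h.symm_apply, fun x y hxy => ?_⟩
  obtain ⟨X, Y, rfl, rfl⟩ := exists_coords hd x y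
  rw [quadAt_transport hd]
  refine h.quadAt_pos ?_
  by_contra! h0
  rw [h0.1, h0.2] at hxy
  simp at hxy

theorem IsFrame.comp_le {P : BinaryCubic} {H ψ : Mat2} (h : IsFrame H ψ) (hc : CubicLe P H)
    (x y : ℝ) : ((P.comp ψ).eval x y) ^ 2 ≤ (x ^ 2 + y ^ 2) ^ 3 := by
  rw [eval_comp, ← h.quadAt]
  exact hc _ _

/-! ### First-order optimality -/

theorem unit_scaling (x y : ℝ) : ∃ n X Y : ℝ, 0 ≤ n ∧ X ^ 2 + Y ^ 2 = 1 ∧ x = n * X ∧ y = n * Y := by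
  by_cases h : x ^ 2 + y ^ 2 = 0
  · have h1 : x = 0 := by nlinarith [sq_nonneg x, sq_nonneg y]
    have h2 : y = 0 := by nlinarith [sq_nonneg x, sq_nonneg y]
    exact ⟨0, 1, 0, le_rfl, by norm_num, by simp [h1], by simp [h2]⟩
  · have hpos : 0 < x ^ 2 + y ^ 2 := lt_of_le_of_ne (by positivity) (Ne.symm h)
    have hs := Real.sqrt_pos.2 hpos
    have hs2 := Real.sq_sqrt hpos.le
    refine ⟨√(x ^ 2 + y ^ 2), x / √(x ^ 2 + y ^ 2), y / √(x ^ 2 + y ^ 2), hs.le, ?_, ?_, ?_⟩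
    · rw [div_pow, div_pow, hs2]
      field_simp
    · field_simp
    · field_simp

theorem cubicLe_of_unit {P : BinaryCubic} {K : Mat2}
    (h : ∀ X Y, X ^ 2 + Y ^ 2 = 1 → (P.eval X Y) ^ 2 ≤ (quadAt K X Y) ^ 3) : CubicLe P K := by
  intro x y
  obtain ⟨n, X, Y, hn, hXY, rfl, rfl⟩ := unit_scaling x y
  rw [eval_smul_arg, quadAt_smul_arg]
  calc _ = n ^ 6 * (P.eval X Y) ^ 2 := by ring
    _ ≤ n ^ 6 * (quadAt K X Y) ^ 3 := by gcongr; exact h X Y hXY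
    _ = _ := by ring

theorem isCompact_unit_circle : IsCompact {p : ℝ × ℝ | p.1 ^ 2 + p.2 ^ 2 = 1} := by
  refine Metric.isCompact_of_isClosed_isBounded (isClosed_eq (by fun_prop) (by fun_prop)) ?_
  refine ((Metric.isBounded_Icc (-1 : ℝ) 1).prod (Metric.isBounded_Icc (-1 : ℝ) 1)).subset ?_
  rintro ⟨x, y⟩ h
  simp only [Set.mem_ofPred_eq] at h
  exact ⟨⟨by nlinarith, by nlinarith⟩, ⟨by nlinarith, by nlinarith⟩⟩

/-- A traceless perturbation that is positive at all points of contact improves the ellipse. -/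
theorem IsOptimal.exists_contact {P : BinaryCubic} {α : ℝ} {H ψ : Mat2}
    (hH : IsOptimal P α H) (hψ : IsFrame H ψ) {k l : ℝ} (hkl : k ≠ 0 ∨ l ≠ 0) :
    ∃ X Y : ℝ, X ^ 2 + Y ^ 2 = 1 ∧ (((P.comp ψ).eval X Y) ^ 2 = 1 ∨
      α * ((ψ 0 0 * X + ψ 0 1 * Y) ^ 2 + (ψ 1 0 * X + ψ 1 1 * Y) ^ 2) = 1) ∧
      k * (X ^ 2 - Y ^ 2) + 2 * l * X * Y ≤ 0 := by
  by_contra! hcon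
  have hd := hψ.det_ne_zero
  set f : ℝ × ℝ → ℝ := fun p => max (((P.comp ψ).eval p.1 p.2) ^ 2)
    (α * ((ψ 0 0 * p.1 + ψ 0 1 * p.2) ^ 2 + (ψ 1 0 * p.1 + ψ 1 1 * p.2) ^ 2)) with hf
  set T : Set (ℝ × ℝ) := {p : ℝ × ℝ | p.1 ^ 2 + p.2 ^ 2 = 1} ∩
    {p | k * (p.1 ^ 2 - p.2 ^ 2) + 2 * l * p.1 * p.2 ≤ 0} with hT
  have hTc : IsCompact T :=
    isCompact_unit_circle.inter_right (isClosed_le (by fun_prop) (by fun_prop))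
  have hfc : Continuous f := by
    simp only [hf, BinaryCubic.eval]
    fun_prop
  have hc1 : ∀ X Y, X ^ 2 + Y ^ 2 = 1 → ((P.comp ψ).eval X Y) ^ 2 ≤ 1 := by
    intro X Y hXY
    have := hψ.comp_le hH.1.cubic X Y
    rwa [hXY, one_pow] at this
  have hc2 : ∀ X Y, X ^ 2 + Y ^ 2 = 1 →
      α * ((ψ 0 0 * X + ψ 0 1 * Y) ^ 2 + (ψ 1 0 * X + ψ 1 1 * Y) ^ 2) ≤ 1 := by
    intro X Y hXY
    have := hH.1.disk (ψ 0 0 * X + ψ 0 1 * Y) (ψ 1 0 * X + ψ 1 1 * Y)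
    rwa [hψ.quadAt, hXY] at this
  have hm : ∃ m : ℝ, 0 ≤ m ∧ m < 1 ∧ ∀ p ∈ T, f p ≤ m := by
    rcases T.eq_empty_or_nonempty with he | hne
    · exact ⟨0, le_rfl, one_pos, by simp [he]⟩
    · obtain ⟨p, hp, hmax⟩ := hTc.exists_isMaxOn hne hfc.continuousOn
      refine ⟨f p, le_max_of_le_left (sq_nonneg _), max_lt ?_ ?_, hmax⟩
      · refine lt_of_le_of_ne (hc1 _ _ hp.1) fun h => ?_
        exact absurd (hcon p.1 p.2 hp.1 (Or.inl h)) (not_lt.2 hp.2)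
      · refine lt_of_le_of_ne (hc2 _ _ hp.1) fun h => ?_
        exact absurd (hcon p.1 p.2 hp.1 (Or.inr h)) (not_lt.2 hp.2)
  obtain ⟨m, hm0, hm1, hmT⟩ := hm
  have hM : 0 < |k| + |l| := by
    rcases hkl with h | h
    · have := abs_pos.2 h; positivity
    · have := abs_pos.2 h; positivity
  -- The perturbation lowers the form by at most `(1 - m) / 3`; the factor `3` is there because `(1
  -- - (1 - m) / 3) ^ 3 ≥ m`.
  set ε := (1 - m) / (3 * (|k| + |l|)) with hε
  have hε0 : 0 < ε := div_pos (by linarith) (by positivity)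
  have hεM : ε * (|k| + |l|) = (1 - m) / 3 := by
    rw [hε]; field_simp
  have hbound : ∀ X Y : ℝ, X ^ 2 + Y ^ 2 = 1 →
      -(|k| + |l|) ≤ k * (X ^ 2 - Y ^ 2) + 2 * l * X * Y := by
    intro X Y hXY
    have h1 : |k * (X ^ 2 - Y ^ 2)| ≤ |k| := by
      rw [abs_mul]
      refine mul_le_of_le_one_right (abs_nonneg _) (abs_le.2 ⟨?_, ?_⟩) <;> nlinarith
    have h2 : |l * (2 * X * Y)| ≤ |l| := by
      rw [abs_mul]
      refine mul_le_of_le_one_right (abs_nonneg _) (abs_le.2 ⟨?_, ?_⟩) <;>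
        nlinarith [sq_nonneg (X - Y), sq_nonneg (X + Y)]
    have := (abs_le.1 h1).1
    have := (abs_le.1 h2).1
    linarith
  set D : Mat2 := !![1 + ε * k, ε * l; ε * l, 1 - ε * k] with hD
  have hDq : ∀ X Y : ℝ, X ^ 2 + Y ^ 2 = 1 →
      quadAt D X Y = 1 + ε * (k * (X ^ 2 - Y ^ 2) + 2 * l * X * Y) := by
    intro X Y hXY
    simp [quadAt, hD]
    linear_combination hXY
  have hcase : ∀ X Y : ℝ, X ^ 2 + Y ^ 2 = 1 → f (X, Y) ≤ quadAt D X Y ∧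
      ((P.comp ψ).eval X Y) ^ 2 ≤ (quadAt D X Y) ^ 3 := by
    intro X Y hXY
    rw [hDq X Y hXY]
    by_cases hle : k * (X ^ 2 - Y ^ 2) + 2 * l * X * Y ≤ 0
    · have hfm : f (X, Y) ≤ m := hmT (X, Y) ⟨hXY, hle⟩
      have h1 : 1 - (1 - m) / 3 ≤ 1 + ε * (k * (X ^ 2 - Y ^ 2) + 2 * l * X * Y) := by
        have := mul_le_mul_of_nonneg_left (hbound X Y hXY) hε0.le
        linarith
      refine ⟨by linarith, ?_⟩
      calc ((P.comp ψ).eval X Y) ^ 2 ≤ m := (le_max_left _ _).trans hfm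
        _ ≤ (1 - (1 - m) / 3) ^ 3 := by nlinarith [sq_nonneg (1 - m), mul_nonneg hm0 hm0]
        _ ≤ _ := pow_le_pow_left₀ (by linarith) h1 3
    · have h0 : 1 ≤ 1 + ε * (k * (X ^ 2 - Y ^ 2) + 2 * l * X * Y) := by
        have := mul_pos hε0 (not_le.1 hle)
        linarith
      refine ⟨(max_le (hc1 X Y hXY) (hc2 X Y hXY)).trans h0, (hc1 X Y hXY).trans ?_⟩
      exact one_le_pow₀ h0
  have hfeas : Feasible P α (transport ψ D) := by
    refine ⟨transport_symm (by simp [hD]), fun x y => ?_, ?_⟩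
    · obtain ⟨x, y, rfl, rfl⟩ := exists_coords hd x y
      rw [quadAt_transport hd]
      obtain ⟨n, X, Y, hn, hXY, rfl, rfl⟩ := unit_scaling x y
      rw [quadAt_smul_arg]
      have := (le_max_right _ _).trans (hcase X Y hXY).1
      calc _ = n ^ 2 * (α * ((ψ 0 0 * X + ψ 0 1 * Y) ^ 2 + (ψ 1 0 * X + ψ 1 1 * Y) ^ 2)) := by ring
        _ ≤ _ := by gcongr
    · exact cubicLe_transport hd (cubicLe_of_unit fun X Y hXY => (hcase X Y hXY).2)
  have h1 := hH.2 _ hfeas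
  have h2 := det_transport hd D
  have h3 := hψ.det
  -- The trace is zero, so the determinant has no first-order term and strictly decreases.
  have h4 : D.det = 1 - ε ^ 2 * (k ^ 2 + l ^ 2) := by
    rw [det_fin_two]; simp [hD]; ring
  have h5 : 0 < ε ^ 2 * (k ^ 2 + l ^ 2) := by
    rcases hkl with h | h <;> positivity
  have h6 : ψ.det ^ 2 * H.det ≤ ψ.det ^ 2 * (transport ψ D).det := by gcongr
  linarith

/-! ### Canonical form of inscribed quadri-tangent ellipses -/

/-- The cubic whose contact points with the unit disc are `(±t, ±√(1 - t²))`. -/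
noncomputable def canonicalCubic (t : ℝ) : BinaryCubic where
  a := (3 * t ^ 2 - 1) / (2 * t ^ 3)
  b := 0
  c := 3 / (2 * t)
  d := 0

/-- Taking the first axis along the sum of the two contact points makes them symmetric, `(t, s)` and
`(t, -s)` with `t > 0`. The gradient equations at both points then determine all four coefficients.
-/
theorem exists_frame_of_two_contacts {P : BinaryCubic} {H : Mat2} (hp : H.PosDef)
    (hc : CubicLe P H) {x₁ y₁ x₂ y₂ : ℝ} (q₁ : quadAt H x₁ y₁ = 1) (q₂ : quadAt H x₂ y₂ = 1)
    (e₁ : P.eval x₁ y₁ = 1) (e₂ : P.eval x₂ y₂ = 1) (hne : x₁ * y₂ - x₂ * y₁ ≠ 0) :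
    ∃ ψ t, IsFrame H ψ ∧ 1 / 2 ≤ t ∧ t < 1 ∧ P.comp ψ = canonicalCubic t := by
  have hN : 0 < quadAt H (x₁ + x₂) (y₁ + y₂) := by
    refine hp.quadAt_pos ?_
    by_contra! h
    apply hne
    rw [eq_neg_of_add_eq_zero_left h.1, eq_neg_of_add_eq_zero_left h.2]
    ring
  set N := √(quadAt H (x₁ + x₂) (y₁ + y₂)) with hNdef
  have hN0 : 0 < N := Real.sqrt_pos.2 hN
  have hN2 : N ^ 2 = quadAt H (x₁ + x₂) (y₁ + y₂) := Real.sq_sqrt hN.le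
  have hz : quadAt H (N⁻¹ * (x₁ + x₂)) (N⁻¹ * (y₁ + y₂)) = 1 := by
    rw [quadAt_smul_arg, ← hN2]
    field_simp
  obtain ⟨ψ, hψ, h00, h10, -⟩ := exists_isFrame_of_quadAt_eq_one hp hz
  have hd := hψ.det_ne_zero
  obtain ⟨t, s, hx1, hy1⟩ := exists_coords hd x₁ y₁
  obtain ⟨t', s', hx2, hy2⟩ := exists_coords hd x₂ y₂
  have hdet := det_fin_two ψ
  have hx : x₁ + x₂ = N * ψ 0 0 := by rw [h00]; field_simp
  have hy : y₁ + y₂ = N * ψ 1 0 := by rw [h10]; field_simp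
  have hss : s' = -s := by
    apply mul_left_cancel₀ hd
    rw [hdet]
    linear_combination ψ 0 0 * (hy - hy1 - hy2) - ψ 1 0 * (hx - hx1 - hx2)
  have htt : t + t' = N := by
    apply mul_left_cancel₀ hd
    rw [hdet]
    linear_combination ψ 1 1 * (hx - hx1 - hx2) - ψ 0 1 * (hy - hy1 - hy2)
  rw [hx1, hy1] at q₁ e₁
  rw [hx2, hy2] at q₂ e₂
  rw [hψ.quadAt] at q₁ q₂
  rw [← eval_comp] at e₁ e₂
  have ht' : t' = t := by
    rw [hss] at q₂
    have h : (t' - t) * (t + t') = 0 := by linear_combination q₂ - q₁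
    rw [htt] at h
    have := (mul_eq_zero.1 h).resolve_right hN0.ne'
    linarith
  subst hss ht'
  have ht0 : 0 < t' := by linarith
  have hs0 : s ≠ 0 := by
    rintro rfl
    apply hne
    rw [hx1, hx2, hy1, hy2]
    ring
  have hle : CubicLe (P.comp ψ) 1 := by
    intro x y
    rw [quadAt_one]
    exact hψ.comp_le hc x y
  have p1 : (1 : Mat2).PosDef := Matrix.PosDef.one
  obtain ⟨g1, g2⟩ := cubic_gradient p1 hle (x := t') (y := s) (by rw [quadAt_one]; exact q₁)
    (by rw [e₁]; norm_num)
  obtain ⟨g3, g4⟩ := cubic_gradient p1 hle (x := t') (y := -s) (by rw [quadAt_one]; exact q₂)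
    (by rw [e₂]; norm_num)
  simp [e₁, e₂, BinaryCubic.dx, BinaryCubic.dy] at g1 g2 g3 g4
  have hb : (P.comp ψ).b = 0 := by
    have : (P.comp ψ).b * (4 * t' * s) = 0 := by linear_combination g1 - g3
    exact (mul_eq_zero.1 this).resolve_right (by positivity)
  have hd' : (P.comp ψ).d = 0 := by
    have : (P.comp ψ).d * (6 * s ^ 2) = 0 := by
      linear_combination g2 + g4 - 2 * t' ^ 2 * hb
    exact (mul_eq_zero.1 this).resolve_right (by positivity)
  have hc' : (P.comp ψ).c = 3 / (2 * t') := by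
    rw [eq_div_iff (by positivity)]
    apply mul_right_cancel₀ hs0
    rw [hb, hd'] at g2
    linarith
  have ha' : (P.comp ψ).a = (3 * t' ^ 2 - 1) / (2 * t' ^ 3) := by
    rw [hb, hc'] at g1
    rw [eq_div_iff (by positivity)]
    field_simp at g1
    have hs2 : s ^ 2 = 1 - t' ^ 2 := by linarith
    rw [hs2] at g1
    linarith
  refine ⟨ψ, t', hψ, ?_, ?_, ?_⟩
  -- Inscription at `(1, 0)` gives `a ≥ -1`, that is `2 t ^ 3 + 3 t ^ 2 - 1 = (2 t - 1) (t + 1) ^ 2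
  -- ≥ 0`.
  · have := hle 1 0
    rw [quadAt_one] at this
    simp [BinaryCubic.eval] at this
    have h1 := (abs_le.1 this).1
    rw [ha', le_div_iff₀ (by positivity)] at h1
    by_contra! hlt
    have : (2 * t' - 1) * (t' + 1) ^ 2 < 0 := mul_neg_of_neg_of_pos (by linarith) (by positivity)
    nlinarith
  · have : 0 < s ^ 2 := by positivity
    nlinarith
  · cases h : P.comp ψ
    simp only [h] at ha' hb hc' hd'
    simp [canonicalCubic, ha', hb, hc', hd']

/-- The gradient at `(1, 0)` kills `b`. Then `(1 + y ^ 2) ^ 3 - Q(1, y) ^ 2` is divisible by `y ^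
2`; the constant term of the quotient bounds `c`, and if that term vanishes, the linear one must
vanish as well. -/
theorem coeffs_of_contact {Q : BinaryCubic} (hle : ∀ x y, (Q.eval x y) ^ 2 ≤ (x ^ 2 + y ^ 2) ^ 3)
    (ha : Q.a = 1) : Q.b = 0 ∧ Q.c ≤ 3 / 2 ∧ (Q.c = 3 / 2 → Q.d = 0) := by
  have hle1 : CubicLe Q 1 := fun x y => by rw [quadAt_one]; exact hle x y
  obtain ⟨-, g⟩ := cubic_gradient Matrix.PosDef.one hle1 (x := 1) (y := 0)
    (by rw [quadAt_one]; norm_num) (by simp [BinaryCubic.eval, ha])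
  simp [BinaryCubic.eval, BinaryCubic.dy, ha] at g
  have key : ∀ y : ℝ, 0 ≤ (3 - 2 * Q.c) - 2 * Q.d * y + (3 - Q.c ^ 2) * y ^ 2
      - 2 * Q.c * Q.d * y ^ 3 + (1 - Q.d ^ 2) * y ^ 4 := by
    intro y
    -- Division by `y ^ 2` gives nothing at `y = 0`, where the inequality is a limit from the right.
    by_cases hy : y = 0
    · subst hy
      by_contra! hneg
      set η := 2 * Q.c - 3 with hη
      have hη0 : 0 < η := by norm_num at hneg; linarith
      have hlim : ContinuousWithinAt (fun y : ℝ => (3 - 2 * Q.c) - 2 * Q.d * y +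
          (3 - Q.c ^ 2) * y ^ 2 - 2 * Q.c * Q.d * y ^ 3 + (1 - Q.d ^ 2) * y ^ 4)
          (Set.Ioi 0) 0 := by
        apply Continuous.continuousWithinAt
        fun_prop
      have : 0 ≤ (3 - 2 * Q.c) - 2 * Q.d * 0 + (3 - Q.c ^ 2) * 0 ^ 2 - 2 * Q.c * Q.d * 0 ^ 3 +
          (1 - Q.d ^ 2) * 0 ^ 4 := by
        refine ge_of_tendsto hlim ?_
        filter_upwards [self_mem_nhdsWithin] with y hy
        have hy0 : (0 : ℝ) < y := hy
        have := hle 1 y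
        simp [BinaryCubic.eval, ha, g] at this
        have h2 : 0 < y ^ 2 := by positivity
        refine nonneg_of_mul_nonneg_right (b := _) (a := y ^ 2) ?_ h2
        nlinarith
      linarith
    · have := hle 1 y
      simp [BinaryCubic.eval, ha, g] at this
      have h2 : 0 < y ^ 2 := by positivity
      refine nonneg_of_mul_nonneg_right (b := _) (a := y ^ 2) ?_ h2
      nlinarith
  refine ⟨g, ?_, fun hc => ?_⟩
  · have := key 0
    norm_num at this
    linarith
  · rw [hc] at key
    have hlin : ∀ y : ℝ, 0 < y → 2 * Q.d ≤
        (3 / 4) * y - 3 * Q.d * y ^ 2 + (1 - Q.d ^ 2) * y ^ 3 ∧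
        -2 * Q.d ≤ (3 / 4) * y + 3 * Q.d * y ^ 2 + (1 - Q.d ^ 2) * y ^ 3 := by
      intro y hy
      constructor
      · have := key y
        refine le_of_mul_le_mul_left ?_ hy
        nlinarith
      · have := key (-y)
        refine le_of_mul_le_mul_left ?_ hy
        nlinarith
    have l1 : ContinuousWithinAt (fun y : ℝ => (3 / 4) * y - 3 * Q.d * y ^ 2 +
        (1 - Q.d ^ 2) * y ^ 3) (Set.Ioi 0) 0 := by
      apply Continuous.continuousWithinAt
      fun_prop
    have l2 : ContinuousWithinAt (fun y : ℝ => (3 / 4) * y + 3 * Q.d * y ^ 2 +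
        (1 - Q.d ^ 2) * y ^ 3) (Set.Ioi 0) 0 := by
      apply Continuous.continuousWithinAt
      fun_prop
    have m1 := ge_of_tendsto l1 (b := 2 * Q.d) (by
      filter_upwards [self_mem_nhdsWithin] with y hy using (hlin y hy).1)
    have m2 := ge_of_tendsto l2 (b := -2 * Q.d) (by
      filter_upwards [self_mem_nhdsWithin] with y hy using (hlin y hy).2)
    norm_num at m1 m2
    linarith

/-- In a frame that starts at the contact point, the second vector is tangent and `c` is half the
second derivative of `P` along it. Both curvatures have the same gradient denominator up to a
constant, so they agree exactly for `c = 3 / 2`. -/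
theorem frame_at_contact {P : BinaryCubic} {H : Mat2} (hp : H.PosDef) {x y : ℝ}
    (q : quadAt H x y = 1) (e : P.eval x y = 1) :
    ∃ ψ, IsFrame H ψ ∧ ψ 0 0 = x ∧ ψ 1 0 = y ∧ (P.comp ψ).a = 1 ∧
      (CubicLe P H → ((P.comp ψ).c = 3 / 2 ↔ levelSetCurvature P x y = ellipseCurvature H x y)) := by
  obtain ⟨ψ, hψ, h00, h10, h01, h11⟩ := exists_isFrame_of_quadAt_eq_one hp q
  refine ⟨ψ, hψ, h00, h10, by simp [BinaryCubic.comp, h00, h10, e], fun hc => ?_⟩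
  have hs := hp.symm_apply
  have hdet := hp.det_pos
  obtain ⟨g1, g2⟩ := cubic_gradient hp hc q (by rw [e]; norm_num)
  rw [e, one_mul] at g1 g2
  set u := H 0 0 * x + H 0 1 * y with hu
  set v := H 0 1 * x + H 1 1 * y with hv
  have hs0 : 0 < √H.det := Real.sqrt_pos.2 hdet
  have hs2 : √H.det ^ 2 = H.det := Real.sq_sqrt hdet.le
  have huv : x * u + y * v = 1 := by
    rw [← q, hu, hv]; simp only [quadAt, hs]; ring
  have hn : 0 < u ^ 2 + v ^ 2 := by
    by_contra! hle
    have h1 : u = 0 := by nlinarith [sq_nonneg u, sq_nonneg v]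
    have h2 : v = 0 := by nlinarith [sq_nonneg u, sq_nonneg v]
    rw [h1, h2] at huv
    norm_num at huv
  have hr : 0 < √(u ^ 2 + v ^ 2) := Real.sqrt_pos.2 hn
  have hQ : H 0 0 * v ^ 2 - 2 * H 0 1 * u * v + H 1 1 * u ^ 2 = H.det := by
    rw [det_fin_two, hs]
    have hq := q
    simp only [quadAt, hs] at hq
    rw [hu, hv]
    linear_combination (H 0 0 * H 1 1 - H 0 1 ^ 2) * hq
  have hcc : (P.comp ψ).c * (2 * √H.det ^ 2)
      = P.dxx x y * v ^ 2 - 2 * P.dxy x y * u * v + P.dyy x y * u ^ 2 := by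
    simp only [BinaryCubic.comp, h00, h10, h01, h11, BinaryCubic.dx, BinaryCubic.dy,
      BinaryCubic.dxx, BinaryCubic.dxy, BinaryCubic.dyy]
    generalize √H.det = s at hs0
    field_simp
    ring
  rw [hs2] at hcc
  have e1 : levelSetCurvature P x y
      = (P.dxx x y * v ^ 2 - 2 * P.dxy x y * u * v + P.dyy x y * u ^ 2)
        / (3 * √(u ^ 2 + v ^ 2) ^ 3) := by
    simp only [levelSetCurvature, levelCurvature, e, one_mul, g1, g2]
    rw [show (3 * u) ^ 2 + (3 * v) ^ 2 = 3 ^ 2 * (u ^ 2 + v ^ 2) by ring,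
      Real.sqrt_mul (by norm_num), Real.sqrt_sq (by norm_num)]
    field_simp
  have e2 : ellipseCurvature H x y = H.det / √(u ^ 2 + v ^ 2) ^ 3 := by
    simp only [ellipseCurvature, levelCurvature]
    rw [hs, ← hu, ← hv,
      show (2 * u) ^ 2 + (2 * v) ^ 2 = 2 ^ 2 * (u ^ 2 + v ^ 2) by ring,
      Real.sqrt_mul (by norm_num), Real.sqrt_sq (by norm_num), ← hQ]
    field_simp
  rw [e1, e2, ← hcc]
  generalize (P.comp ψ).c = c
  rw [div_eq_div_iff (by positivity) (by positivity)]
  constructor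
  · rintro rfl
    ring
  · intro h
    have h0 : (√(u ^ 2 + v ^ 2) ^ 3 * H.det) * (2 * c - 3) = 0 := by linear_combination h
    have := (mul_eq_zero.1 h0).resolve_left (by positivity)
    linarith

theorem levelSetCurvature_neg (P : BinaryCubic) (x y : ℝ) :
    levelSetCurvature P (-x) (-y) = levelSetCurvature P x y := by
  simp only [levelSetCurvature, levelCurvature, BinaryCubic.dx, BinaryCubic.dy, BinaryCubic.dxx,
    BinaryCubic.dxy, BinaryCubic.dyy, eval_neg]
  ring_nf

theorem ellipseCurvature_neg (H : Mat2) (x y : ℝ) :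
    ellipseCurvature H (-x) (-y) = ellipseCurvature H x y := by
  simp only [ellipseCurvature, levelCurvature]
  ring_nf

theorem exists_frame_of_osculation {P : BinaryCubic} {H : Mat2} (hp : H.PosDef)
    (hc : CubicLe P H) {x y : ℝ} (q : quadAt H x y = 1) (e : P.eval x y = 1)
    (hk : levelSetCurvature P x y = ellipseCurvature H x y) :
    ∃ ψ, IsFrame H ψ ∧ P.comp ψ = canonicalCubic 1 := by
  obtain ⟨ψ, hψ, -, -, ha, hiff⟩ := frame_at_contact hp q e
  have hcc := (hiff hc).2 hk
  obtain ⟨hb, -, hd⟩ := coeffs_of_contact (hψ.comp_le hc) ha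
  have hd := hd hcc
  refine ⟨ψ, hψ, ?_⟩
  cases h : P.comp ψ
  simp only [h] at ha hb hcc hd
  simp [canonicalCubic, ha, hb, hcc, hd]
  norm_num

/-! ### Quadri-tangency -/

theorem plane_ext {z w : Plane} (h0 : z 0 = w 0) (h1 : z 1 = w 1) : z = w := by
  ext i
  fin_cases i
  · exact h0
  · exact h1

theorem eq_or_eq_neg_of_parallel {H : Mat2} {z w : Plane} (hz : quadAt H (z 0) (z 1) = 1)
    (hw : quadAt H (w 0) (w 1) = 1) (h : z 0 * w 1 - w 0 * z 1 = 0) : w = z ∨ w = -z := by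
  have hne : z 0 ≠ 0 ∨ z 1 ≠ 0 := by
    by_contra! h0
    simp [quadAt, h0.1, h0.2] at hz
  have key : ∃ c, w 0 = c * z 0 ∧ w 1 = c * z 1 := by
    rcases hne with h0 | h0
    · refine ⟨w 0 / z 0, by field_simp, ?_⟩
      field_simp
      linarith
    · refine ⟨w 1 / z 1, ?_, by field_simp⟩
      field_simp
      linarith
  obtain ⟨c, h1, h2⟩ := key
  rw [h1, h2, quadAt_smul_arg, hz, mul_one] at hw
  rcases sq_eq_one_iff.1 hw with rfl | rfl
  · exact Or.inl (plane_ext (by linarith) (by linarith))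
  · exact Or.inr (plane_ext (by simp [h1]) (by simp [h2]))

/-- Signs can be adjusted so that `P = 1` at the contacts. Two independent contacts give `t < 1`;
otherwise there are at most two antipodal ones, so the count of four needs an osculation point, and
this is `t = 1`. -/
theorem exists_frame_of_quadriTangent {P : BinaryCubic} {H : Mat2} (hp : H.PosDef)
    (hc : CubicLe P H) (hq : IsQuadriTangent P H) :
    ∃ ψ t, IsFrame H ψ ∧ 1 / 2 ≤ t ∧ t ≤ 1 ∧ P.comp ψ = canonicalCubic t := by
  have hpos : ∀ z : Plane, quadAt H (z 0) (z 1) = 1 → |P.eval (z 0) (z 1)| = 1 →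
      ∃ e : ℝ, (e = 1 ∨ e = -1) ∧ quadAt H (e * z 0) (e * z 1) = 1 ∧
        P.eval (e * z 0) (e * z 1) = 1 := by
    intro z h1 h2
    rcases eq_or_eq_neg_of_abs_eq h2 with h | h
    · exact ⟨1, Or.inl rfl, by simpa using h1, by simpa using h⟩
    · refine ⟨-1, Or.inr rfl, ?_, ?_⟩
      · rw [neg_one_mul, neg_one_mul, quadAt_neg, h1]
      · rw [neg_one_mul, neg_one_mul, eval_neg, h, neg_neg]
  by_cases hpar : ∃ z ∈ tangencyPoints P H, ∃ w ∈ tangencyPoints P H, z 0 * w 1 - w 0 * z 1 ≠ 0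
  · obtain ⟨z, hz, w, hw, hne⟩ := hpar
    rw [mem_tangencyPoints_iff hp hc] at hz hw
    obtain ⟨e, he, q1, p1⟩ := hpos z hz.1 hz.2
    obtain ⟨f, hf, q2, p2⟩ := hpos w hw.1 hw.2
    have he0 : e ≠ 0 := by rcases he with rfl | rfl <;> norm_num
    have hf0 : f ≠ 0 := by rcases hf with rfl | rfl <;> norm_num
    obtain ⟨ψ, t, h1, h2, h3, h4⟩ := exists_frame_of_two_contacts hp hc q1 q2 p1 p2 (by
      rw [show e * z 0 * (f * w 1) - f * w 0 * (e * z 1)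
        = e * f * (z 0 * w 1 - w 0 * z 1) by ring]
      positivity)
    exact ⟨ψ, t, h1, h2, h3.le, h4⟩
  · push Not at hpar
    have hsmall : (tangencyPoints P H).encard ≤ 2 := by
      rcases (tangencyPoints P H).eq_empty_or_nonempty with h | ⟨z, hz⟩
      · simp [h]
      · have hsub : tangencyPoints P H ⊆ {z, -z} := by
          intro w hw
          have hz' := (mem_tangencyPoints_iff hp hc z).1 hz
          have hw' := (mem_tangencyPoints_iff hp hc w).1 hw
          exact eq_or_eq_neg_of_parallel hz'.1 hw'.1 (hpar z hz w hw)
        refine (Set.encard_le_encard hsub).trans ((Set.encard_insert_le _ _).trans ?_)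
        rw [Set.encard_singleton]
        norm_num
    have hne : (osculationPoints P H).Nonempty := by
      by_contra hempty
      rw [Set.not_nonempty_iff_eq_empty] at hempty
      rw [IsQuadriTangent, hempty, Set.encard_empty, add_zero] at hq
      exact absurd (hq.trans hsmall) (by norm_num)
    obtain ⟨z, hz, hk⟩ := hne
    rw [mem_tangencyPoints_iff hp hc] at hz
    obtain ⟨e, he, q1, p1⟩ := hpos z hz.1 hz.2
    have hk' : levelSetCurvature P (e * z 0) (e * z 1) = ellipseCurvature H (e * z 0) (e * z 1) := by
      rcases he with rfl | rfl
      · simpa using hk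
      · rw [neg_one_mul, neg_one_mul, levelSetCurvature_neg, ellipseCurvature_neg, hk]
    obtain ⟨ψ, h1, h2⟩ := exists_frame_of_osculation hp hc q1 p1 hk'
    exact ⟨ψ, 1, h1, by norm_num, le_rfl, h2⟩

theorem neg_mem_tangencyPoints {P : BinaryCubic} {H : Mat2} (hp : H.PosDef) (hc : CubicLe P H)
    {z : Plane} (hz : z ∈ tangencyPoints P H) : -z ∈ tangencyPoints P H := by
  rw [mem_tangencyPoints_iff hp hc] at hz ⊢
  simpa [quadAt_neg, eval_neg] using hz

theorem ne_neg_of_quadAt {H : Mat2} {z : Plane} (hz : quadAt H (z 0) (z 1) = 1) : z ≠ -z := by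
  intro h
  have : z = 0 := by
    have h2 : (2 : ℝ) • z = 0 := by
      rw [two_smul]
      nth_rewrite 2 [h]
      simp
    simpa using h2
  simp [quadAt, this] at hz

theorem isQuadriTangent_of_two {P : BinaryCubic} {H : Mat2} (hp : H.PosDef) (hc : CubicLe P H)
    {z w : Plane} (hz : z ∈ tangencyPoints P H) (hw : w ∈ tangencyPoints P H)
    (hne : z 0 * w 1 - w 0 * z 1 ≠ 0) : IsQuadriTangent P H := by
  have hz1 := ((mem_tangencyPoints_iff hp hc z).1 hz).1
  have hw1 := ((mem_tangencyPoints_iff hp hc w).1 hw).1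
  have hsub : ({z, -z, w, -w} : Set Plane) ⊆ tangencyPoints P H := by
    rintro v (rfl | rfl | rfl | rfl)
    · exact hz
    · exact neg_mem_tangencyPoints hp hc hz
    · exact hw
    · exact neg_mem_tangencyPoints hp hc hw
  have h1 := ne_neg_of_quadAt hz1
  have h2 := ne_neg_of_quadAt hw1
  have h3 : z ≠ w := by
    rintro rfl
    exact hne (by ring)
  have h4 : z ≠ -w := by
    rintro rfl
    exact hne (by simp)
  have h5 : -z ≠ w := fun h => h4 (by rw [← h, neg_neg])
  have h6 : -z ≠ -w := fun h => h3 (neg_injective h)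
  have hcard : ({z, -z, w, -w} : Set Plane).encard = 4 := by
    rw [Set.encard_insert_of_notMem (by simp [h1, h3, h4]),
      Set.encard_insert_of_notMem (by simp [h5, h3]),
      Set.encard_pair h2]
    norm_num
  exact le_add_right (hcard ▸ Set.encard_le_encard hsub)

/-- Osculation points come in antipodal pairs, and each counts twice. -/
theorem isQuadriTangent_of_osculation {P : BinaryCubic} {H : Mat2} (hp : H.PosDef)
    (hc : CubicLe P H) {z : Plane} (hz : z ∈ osculationPoints P H) : IsQuadriTangent P H := by
  have hz1 := ((mem_tangencyPoints_iff hp hc z).1 hz.1).1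
  have hzn : -z ∈ osculationPoints P H := by
    refine ⟨neg_mem_tangencyPoints hp hc hz.1, ?_⟩
    simpa [levelSetCurvature_neg, ellipseCurvature_neg] using hz.2
  have hcard : ({z, -z} : Set Plane).encard = 2 := Set.encard_pair (ne_neg_of_quadAt hz1)
  have hsub : ({z, -z} : Set Plane) ⊆ osculationPoints P H := by
    rintro v (rfl | rfl)
    · exact hz
    · exact hzn
  have h1 := hcard ▸ Set.encard_le_encard hsub
  have h2 : (osculationPoints P H).encard ≤ (tangencyPoints P H).encard :=
    Set.encard_le_encard fun v hv => hv.1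
  calc (4 : ℕ∞) = 2 + 2 := by norm_num
    _ ≤ _ := add_le_add (h1.trans h2) h1

/-! ### From the canonical form to the three families -/

theorem exists_cube_root {v : ℝ} (hv : 0 < v) : ∃ l : ℝ, 0 < l ∧ l ^ 3 = v := by
  refine ⟨v ^ (1 / 3 : ℝ), by positivity, ?_⟩
  rw [← Real.rpow_natCast, ← Real.rpow_mul hv.le]
  norm_num

theorem IsFrame.eq_transport_mul {H ψ σ : Mat2} (h : IsFrame H ψ) (hσ : σ.det ≠ 0) :
    H = transport (ψ * σ) (σᵀ * σ) := by
  rw [transport_eq_iff (by rw [det_mul]; exact mul_ne_zero h.det_ne_zero hσ), transpose_mul]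
  calc σᵀ * ψᵀ * H * (ψ * σ) = σᵀ * (ψᵀ * H * ψ) * σ := by simp only [Matrix.mul_assoc]
    _ = _ := by rw [h, Matrix.mul_one]

theorem eval_canonicalCubic (t x y : ℝ) : (canonicalCubic t).eval x y
    = (3 * t ^ 2 - 1) / (2 * t ^ 3) * x ^ 3 + 3 / (2 * t) * x * y ^ 2 := by
  simp [BinaryCubic.eval, canonicalCubic]

theorem disc_canonicalCubic (t : ℝ) : (canonicalCubic t).disc
    = 27 * (1 - 3 * t ^ 2) / (4 * t ^ 6) := by
  simp [BinaryCubic.disc, canonicalCubic]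
  by_cases ht : t = 0
  · simp [ht]
  · field_simp
    ring

theorem det_diagonal_two (a b : ℝ) : (Matrix.diagonal ![a, b] : Mat2).det = a * b := by
  simp [det_diagonal, Fin.prod_univ_two]

theorem disc_sign {P : BinaryCubic} {H ψ : Mat2} (h : IsFrame H ψ) {t : ℝ} (ht : 0 < t)
    (hcan : P.comp ψ = canonicalCubic t) :
    (P.disc < 0 ↔ 1 < 3 * t ^ 2) ∧ (0 < P.disc ↔ 3 * t ^ 2 < 1) := by
  have h1 := disc_comp P ψ
  rw [hcan, disc_canonicalCubic] at h1
  have hd := h.det_ne_zero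
  have hd6 : 0 < ψ.det ^ 6 := by positivity
  rw [div_eq_iff (by positivity)] at h1
  have hpos : 0 < ψ.det ^ 6 * (4 * t ^ 6) := by positivity
  have h2 : 27 * (1 - 3 * t ^ 2) = (ψ.det ^ 6 * (4 * t ^ 6)) * P.disc := by linarith
  constructor
  · constructor
    · intro h; have := mul_neg_of_pos_of_neg hpos h; linarith
    · intro h; by_contra! h3; have := mul_nonneg hpos.le h3; linarith
  · constructor
    · intro h; have := mul_pos hpos h; linarith
    · intro h; by_contra! h3; have := mul_nonpos_of_nonneg_of_nonpos hpos.le h3; linarith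

/-- Scaling the two axes by `2 t / l` and `√l` makes the coefficients `1` and `3` exactly when `l ^
3 = 12 t ^ 2 - 4`; the bound `l ≤ 2` is `t ≤ 1`. -/
theorem familyNeg_of_canonical {P : BinaryCubic} {H ψ : Mat2} (h : IsFrame H ψ) {t : ℝ}
    (ht0 : 0 < t) (ht1 : t ≤ 1) (hcan : P.comp ψ = canonicalCubic t) (hdisc : P.disc < 0) :
    ∃ l ∈ Set.Ioc (0 : ℝ) 2, l ^ 3 = 12 * t ^ 2 - 4 ∧
      IsReduction P (ψ * Matrix.diagonal ![2 * t / l, √l]) ∧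
      H = familyNeg (ψ * Matrix.diagonal ![2 * t / l, √l]) l := by
  have ht := (disc_sign h ht0 hcan).1.1 hdisc
  obtain ⟨l, hl0, hl⟩ := exists_cube_root (v := 12 * t ^ 2 - 4) (by linarith)
  have hs0 := Real.sqrt_pos.2 hl0
  have hs2 := Real.sq_sqrt hl0.le
  have hσ : (Matrix.diagonal ![2 * t / l, √l] : Mat2).det ≠ 0 := by
    rw [det_diagonal_two]; positivity
  refine ⟨l, ⟨hl0, ?_⟩, hl, Or.inr ⟨hdisc, ?_⟩, ?_⟩
  · by_contra! h2
    have : (2 : ℝ) ^ 3 < l ^ 3 := by gcongr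
    nlinarith
  · rw [isChange_iff]
    refine ⟨by rw [det_mul]; exact mul_ne_zero h.det_ne_zero hσ, fun x y => ?_⟩
    rw [eval_comp_mul, hcan, eval_canonicalCubic]
    simp
    have e : 3 * t ^ 2 - 1 = l ^ 3 / 4 := by linarith
    rw [e]
    field_simp
    rw [hs2]
    ring
  · rw [h.eq_transport_mul hσ, familyNeg]
    congr 1
    rw [diagonal_transpose, diagonal_mul_diagonal]
    congr 1
    ext i
    fin_cases i
    · simp
      field_simp
      linarith
    · simp
      rw [← sq, hs2]

theorem planeRotation_zero : planeRotation 0 = 1 := by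
  ext i j
  fin_cases i <;> fin_cases j <;> simp [planeRotation]

/-- The scaling is that of the negative case, with the first axis reversed because `3 t ^ 2 - 1` is
now negative; the bound `l ≤ 1` is `t ≥ 1 / 2`. -/
theorem familyPos_of_canonical {P : BinaryCubic} {H ψ : Mat2} (h : IsFrame H ψ) {t : ℝ}
    (ht0 : 1 / 2 ≤ t) (hcan : P.comp ψ = canonicalCubic t) (hdisc : 0 < P.disc) :
    ∃ φ, ∃ l ∈ Set.Ioc (0 : ℝ) 1, l ^ 3 = 4 - 12 * t ^ 2 ∧ IsReduction P φ ∧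
      H = familyPos φ 1 l := by
  have htp : 0 < t := by linarith
  have ht := (disc_sign h htp hcan).2.1 hdisc
  obtain ⟨l, hl0, hl⟩ := exists_cube_root (v := 4 - 12 * t ^ 2) (by linarith)
  have hs0 := Real.sqrt_pos.2 hl0
  have hs2 := Real.sq_sqrt hl0.le
  have hσ : (Matrix.diagonal ![-(2 * t / l), √l] : Mat2).det ≠ 0 := by
    rw [det_diagonal_two, neg_mul, neg_ne_zero]; positivity
  refine ⟨ψ * Matrix.diagonal ![-(2 * t / l), √l], l, ⟨hl0, ?_⟩, hl, Or.inl ⟨hdisc, ?_⟩, ?_⟩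
  · by_contra! h2
    have : (1 : ℝ) ^ 3 < l ^ 3 := by gcongr
    nlinarith
  · rw [isChange_iff]
    refine ⟨by rw [det_mul]; exact mul_ne_zero h.det_ne_zero hσ, fun x y => ?_⟩
    rw [eval_comp_mul, hcan, eval_canonicalCubic]
    simp
    have e : 3 * t ^ 2 - 1 = -l ^ 3 / 4 := by linarith
    rw [e]
    field_simp
    rw [hs2]
    ring
  · rw [h.eq_transport_mul hσ, familyPos, transpose_one, Matrix.one_mul, Matrix.mul_one]
    congr 1
    rw [diagonal_transpose, diagonal_mul_diagonal]
    congr 1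
    ext i
    fin_cases i
    · simp
      field_simp
      linarith
    · simp
      rw [← sq, hs2]

/-- Here `3 t ^ 2 = 1`, the cubic is a multiple of `x y ^ 2`, and exchanging and scaling the axes
gives `x ^ 2 y`. The frame can always be normalized to the parameter `1`. -/
theorem familyZero_of_canonical {P : BinaryCubic} {H ψ : Mat2} (h : IsFrame H ψ) {t : ℝ}
    (ht0 : 0 < t) (hcan : P.comp ψ = canonicalCubic t) (hdisc : P.disc = 0) :
    ∃ φ, IsChange P φ (fun x y => x ^ 2 * y) ∧ H = familyZero φ 1 := by
  have ht : 3 * t ^ 2 = 1 := by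
    obtain ⟨h1, h2⟩ := disc_sign h ht0 hcan
    rw [hdisc] at h1 h2
    simp at h1 h2
    linarith
  have hσ : (!![0, 2 * t / 3; 1, 0] : Mat2).det ≠ 0 := by
    rw [det_fin_two]; simp; positivity
  refine ⟨ψ * !![0, 2 * t / 3; 1, 0], ?_, ?_⟩
  · rw [isChange_iff]
    refine ⟨by rw [det_mul]; exact mul_ne_zero h.det_ne_zero hσ, fun x y => ?_⟩
    rw [eval_comp_mul, hcan, eval_canonicalCubic]
    simp [ht]
    field_simp
  · rw [h.eq_transport_mul hσ, familyZero]
    congr 1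
    ext i j
    fin_cases i <;> fin_cases j <;> simp [Matrix.mul_apply, Fin.sum_univ_two]
    nlinarith

/-! ### Uniqueness of the reductions -/

theorem change_quotient {P : BinaryCubic} {φ₁ φ₂ : Mat2} {q : ℝ → ℝ → ℝ} (h₁ : IsChange P φ₁ q)
    (h₂ : IsChange P φ₂ q) : ∃ σ : Mat2, φ₂ = φ₁ * σ ∧
      ∀ x y, q (σ 0 0 * x + σ 0 1 * y) (σ 1 0 * x + σ 1 1 * y) = q x y := by
  rw [isChange_iff] at h₁ h₂
  have e : φ₂ = φ₁ * (φ₁⁻¹ * φ₂) := by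
    rw [← Matrix.mul_assoc, Matrix.mul_nonsing_inv _ (isUnit_iff_ne_zero.2 h₁.1), Matrix.one_mul]
  refine ⟨φ₁⁻¹ * φ₂, e, fun x y => ?_⟩
  rw [← h₁.2, ← eval_comp_mul, ← e, h₂.2]

/-- The only real root line `x = 0` must be preserved, and the remaining coefficients leave nothing
but `y ↦ ± y`. -/
theorem stabilizer_neg {p q r s : ℝ} (h : ∀ x y : ℝ, (p * x + q * y) * ((p * x + q * y) ^ 2 +
    3 * (r * x + s * y) ^ 2) = x * (x ^ 2 + 3 * y ^ 2)) : p = 1 ∧ q = 0 ∧ r = 0 ∧ s ^ 2 = 1 := by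
  have h1 := h 1 0
  have h2 := h 0 1
  have h3 := h 1 1
  have h4 := h 1 (-1)
  have hq : q = 0 := by
    by_contra hq
    have : q * (q ^ 2 + 3 * s ^ 2) = 0 := by linear_combination h2
    have := (mul_eq_zero.1 this).resolve_left hq
    have : 0 < q ^ 2 := by positivity
    nlinarith [sq_nonneg s]
  subst hq
  have h5 : p * s ^ 2 = 1 := by linear_combination (h3 + h4) / 6 - h1 / 3
  have h6 : p * r * s = 0 := by linear_combination (h3 - h4) / 12
  have hp : p ≠ 0 := by rintro rfl; norm_num at h5
  have hs : s ≠ 0 := by rintro rfl; norm_num at h5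
  have hr : r = 0 := by
    rcases mul_eq_zero.1 h6 with h | h
    · exact (mul_eq_zero.1 h).resolve_left hp
    · exact absurd h hs
  subst hr
  have hp1 : p = 1 := by
    have : (p - 1) * (p ^ 2 + p + 1) = 0 := by linear_combination h1
    rcases mul_eq_zero.1 this with h | h
    · linarith
    · nlinarith [sq_nonneg (p + 1 / 2)]
  subst hp1
  exact ⟨rfl, rfl, rfl, by linarith⟩

/-- The symmetries form the dihedral group of order six that permutes the three root lines: `p` and
`r` are a cosine and a sine, and `e` is the determinant. -/
theorem stabilizer_pos {p q r s : ℝ} (h : ∀ x y : ℝ, (p * x + q * y) * ((p * x + q * y) ^ 2 -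
    3 * (r * x + s * y) ^ 2) = x * (x ^ 2 - 3 * y ^ 2)) :
    ∃ e : ℝ, e ^ 2 = 1 ∧ q = -e * r ∧ s = e * p ∧
      ((p = 1 ∧ r = 0) ∨ (p = -1 / 2 ∧ r ^ 2 = 3 / 4)) := by
  have h1 := h 1 0
  have h2 := h 0 1
  have h3 := h 1 1
  have h4 := h 1 (-1)
  have c1 : p * (p ^ 2 - 3 * r ^ 2) = 1 := by linear_combination h1
  have c2 : p ^ 2 * q - q * r ^ 2 - 2 * p * r * s = 0 := by
    linear_combination (h3 - h4) / 6 - h2 / 3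
  have c3 : p * q ^ 2 - p * s ^ 2 - 2 * q * r * s = -1 := by
    linear_combination (h3 + h4) / 6 - h1 / 3
  have c4 : q * (q ^ 2 - 3 * s ^ 2) = 0 := by linear_combination h2
  by_cases hq : q = 0
  · subst hq
    have h5 : p * s ^ 2 = 1 := by linear_combination -c3
    have h6 : p * r * s = 0 := by linear_combination -c2 / 2
    have hp : p ≠ 0 := by rintro rfl; norm_num at h5
    have hs : s ≠ 0 := by rintro rfl; norm_num at h5
    have hr : r = 0 := by
      rcases mul_eq_zero.1 h6 with h | h
      · exact (mul_eq_zero.1 h).resolve_left hp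
      · exact absurd h hs
    subst hr
    have hp1 : p = 1 := by
      have : (p - 1) * (p ^ 2 + p + 1) = 0 := by linear_combination c1
      rcases mul_eq_zero.1 this with h | h
      · linarith
      · nlinarith [sq_nonneg (p + 1 / 2)]
    subst hp1
    exact ⟨s, by linarith, by ring, by ring, Or.inl ⟨rfl, rfl⟩⟩
  · have hqs := (mul_eq_zero.1 c4).resolve_left hq
    have hs : s ≠ 0 := by
      rintro rfl
      apply hq
      nlinarith
    -- The root line `x = 0` goes to one of the two other root lines `x = κ y`, `κ ^ 2 = 3`.
    obtain ⟨κ, hκ⟩ : ∃ κ, q = κ * s := ⟨q / s, by field_simp⟩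
    subst hκ
    have hκ3 : κ ^ 2 = 3 := by
      have : (κ ^ 2 - 3) * s ^ 2 = 0 := by linear_combination hqs
      have := (mul_eq_zero.1 this).resolve_right (by positivity)
      linarith
    have c2' : κ * p ^ 2 - κ * r ^ 2 - 2 * p * r = 0 := by
      have : s * (κ * p ^ 2 - κ * r ^ 2 - 2 * p * r) = 0 := by linear_combination c2
      exact (mul_eq_zero.1 this).resolve_left hs
    have hfac : (p - κ * r) * (r + κ * p) = 0 := by
      linear_combination c2' - p * r * hκ3
    have c3' : 2 * s ^ 2 * (p - κ * r) = -1 := by linear_combination c3 - p * s ^ 2 * hκ3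
    have hr : r = -κ * p := by
      rcases mul_eq_zero.1 hfac with h | h
      · rw [h] at c3'
        norm_num at c3'
      · linarith
    subst hr
    have hp3 : p ^ 3 = -1 / 8 := by linear_combination -c1 / 8 - 3 / 8 * p ^ 3 * hκ3
    have hp : p = -1 / 2 := by
      have : (p + 1 / 2) * (p ^ 2 - p / 2 + 1 / 4) = 0 := by linear_combination hp3
      rcases mul_eq_zero.1 this with h | h
      · linarith
      · nlinarith [sq_nonneg (p - 1 / 4)]
    subst hp
    have hs4 : s ^ 2 = 1 / 4 := by linear_combination -c3' / 4 - s ^ 2 / 4 * hκ3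
    exact ⟨-2 * s, by linarith, by ring, by ring,
      Or.inr ⟨rfl, by linear_combination hκ3 / 4⟩⟩

/-- The double and the simple root line are each preserved, which leaves a one-parameter group of
diagonal matrices. -/
theorem stabilizer_zero {p q r s : ℝ} (h : ∀ x y : ℝ, (p * x + q * y) ^ 2 * (r * x + s * y)
    = x ^ 2 * y) : q = 0 ∧ r = 0 ∧ p ^ 2 * s = 1 := by
  have h1 := h 1 0
  have h2 := h 0 1
  have h3 := h 1 1
  have h4 := h 1 (-1)
  have c1 : p ^ 2 * r = 0 := by linear_combination h1
  have c2 : q ^ 2 * s = 0 := by linear_combination h2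
  have c3 : p ^ 2 * s + 2 * p * q * r = 1 := by linear_combination (h3 - h4) / 2 - h2
  have c4 : q ^ 2 * r + 2 * p * q * s = 0 := by linear_combination (h3 + h4) / 2 - h1
  have hp : p ≠ 0 := by rintro rfl; norm_num at c3
  have hr : r = 0 := (mul_eq_zero.1 c1).resolve_left (by positivity)
  subst hr
  have hs : s ≠ 0 := by rintro rfl; norm_num at c3
  have hq : q = 0 := by
    have := (mul_eq_zero.1 c2).resolve_right hs
    simpa using this
  subst hq
  exact ⟨rfl, rfl, by linarith⟩

theorem IsReduction.isChange_neg {P : BinaryCubic} {φ : Mat2} (h : IsReduction P φ)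
    (hd : P.disc < 0) : IsChange P φ fun x y => x * (x ^ 2 + 3 * y ^ 2) := by
  rcases h with h | h
  · linarith [h.1]
  · exact h.2

theorem IsReduction.isChange_pos {P : BinaryCubic} {φ : Mat2} (h : IsReduction P φ)
    (hd : 0 < P.disc) : IsChange P φ fun x y => x * (x ^ 2 - 3 * y ^ 2) := by
  rcases h with h | h
  · exact h.2
  · linarith [h.1]

theorem transport_diagonal_neg {P : BinaryCubic} {φ₁ φ₂ : Mat2} (hd : P.disc < 0)
    (h₁ : IsReduction P φ₁) (h₂ : IsReduction P φ₂) (a b : ℝ) :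
    transport φ₁ (Matrix.diagonal ![a, b]) = transport φ₂ (Matrix.diagonal ![a, b]) := by
  have g₁ := h₁.isChange_neg hd
  have g₂ := h₂.isChange_neg hd
  obtain ⟨σ, hσ, hst⟩ := change_quotient g₁ g₂
  obtain ⟨e1, e2, e3, e4⟩ := stabilizer_neg hst
  rw [transport_eq_iff g₂.1, hσ, transpose_mul]
  have := congr_transport g₁.1 (Matrix.diagonal ![a, b])
  rw [show σᵀ * φ₁ᵀ * transport φ₁ (Matrix.diagonal ![a, b]) * (φ₁ * σ)
    = σᵀ * (φ₁ᵀ * transport φ₁ (Matrix.diagonal ![a, b]) * φ₁) * σ by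
      simp only [Matrix.mul_assoc], this]
  ext i j
  fin_cases i <;> fin_cases j <;> simp [Matrix.mul_apply, Fin.sum_univ_two, e1, e2, e3]
  linear_combination b * e4

theorem mem_threeRotations_iff (V : Mat2) : V ∈ threeRotations ↔ V = 1 ∨
    V = !![1 / 2, -(√3 / 2); √3 / 2, 1 / 2] ∨ V = !![-1 / 2, -(√3 / 2); √3 / 2, -1 / 2] := by
  have h1 : Real.cos (2 * Real.pi / 3) = -1 / 2 := by
    rw [show 2 * Real.pi / 3 = Real.pi - Real.pi / 3 by ring, Real.cos_pi_sub, Real.cos_pi_div_three]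
    norm_num
  have h2 : Real.sin (2 * Real.pi / 3) = √3 / 2 := by
    rw [show 2 * Real.pi / 3 = Real.pi - Real.pi / 3 by ring, Real.sin_pi_sub, Real.sin_pi_div_three]
  simp only [threeRotations, Set.mem_insert_iff, Set.mem_singleton_iff, planeRotation_zero]
  simp only [planeRotation, h1, h2, Real.cos_pi_div_three, Real.sin_pi_div_three]

theorem one_mem_threeRotations : (1 : Mat2) ∈ threeRotations := by
  rw [mem_threeRotations_iff]; exact Or.inl rfl

/-- A reflection in a coordinate axis does not affect a diagonal form, so only rotations by
multiples of 120 degrees matter. Since `V` and `-V` act alike on forms, 240 degrees may be replaced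
by 60. -/
theorem transport_diagonal_pos {P : BinaryCubic} {φ₁ φ₂ : Mat2} (hd : 0 < P.disc)
    (h₁ : IsReduction P φ₁) (h₂ : IsReduction P φ₂) (a b : ℝ) : ∃ V ∈ threeRotations,
    transport φ₁ (Matrix.diagonal ![a, b]) = transport φ₂ (Vᵀ * Matrix.diagonal ![a, b] * V) := by
  have g₁ := h₁.isChange_pos hd
  have g₂ := h₂.isChange_pos hd
  obtain ⟨σ, hσ, hst⟩ := change_quotient g₁ g₂
  obtain ⟨e, he, e1, e2, hpr⟩ := stabilizer_pos hst
  have hred : ∀ V : Mat2, σᵀ * Matrix.diagonal ![a, b] * σ = Vᵀ * Matrix.diagonal ![a, b] * V →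
      transport φ₁ (Matrix.diagonal ![a, b]) = transport φ₂ (Vᵀ * Matrix.diagonal ![a, b] * V) := by
    intro V hV
    rw [transport_eq_iff g₂.1, hσ, transpose_mul, ← hV]
    have := congr_transport g₁.1 (Matrix.diagonal ![a, b])
    rw [show σᵀ * φ₁ᵀ * transport φ₁ (Matrix.diagonal ![a, b]) * (φ₁ * σ)
      = σᵀ * (φ₁ᵀ * transport φ₁ (Matrix.diagonal ![a, b]) * φ₁) * σ by
        simp only [Matrix.mul_assoc], this]
  have h3 : (√3 : ℝ) ^ 2 = 3 := Real.sq_sqrt (by norm_num)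
  rcases hpr with ⟨hp, hr⟩ | ⟨hp, hr⟩
  · refine ⟨1, one_mem_threeRotations, hred _ ?_⟩
    ext i j
    fin_cases i <;> fin_cases j <;> simp [Matrix.mul_apply, Fin.sum_univ_two, e1, e2, hp, hr]
    linear_combination b * he
  · have hcase : e * σ 1 0 = √3 / 2 ∨ e * σ 1 0 = -(√3 / 2) := by
      rw [← sq_eq_sq_iff_eq_or_eq_neg]
      linear_combination σ 1 0 ^ 2 * he + hr - h3 / 4
    rcases hcase with hc | hc
    · refine ⟨_, (mem_threeRotations_iff _).2 (Or.inr (Or.inr rfl)), hred _ ?_⟩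
      ext i j
      fin_cases i <;> fin_cases j <;> simp [Matrix.mul_apply, Fin.sum_univ_two, e1, e2, hp]
      · linear_combination b * hr - b / 4 * h3
      · linear_combination (a / 2 - b / 2) * hc
      · linear_combination (a / 2 - b / 2) * hc
      · linear_combination (a * σ 1 0 ^ 2 + b / 4) * he + a * hr - a / 4 * h3
    · refine ⟨_, (mem_threeRotations_iff _).2 (Or.inr (Or.inl rfl)), hred _ ?_⟩
      ext i j
      fin_cases i <;> fin_cases j <;> simp [Matrix.mul_apply, Fin.sum_univ_two, e1, e2, hp]
      · linear_combination b * hr - b / 4 * h3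
      · linear_combination (a / 2 - b / 2) * hc
      · linear_combination (a / 2 - b / 2) * hc
      · linear_combination (a * σ 1 0 ^ 2 + b / 4) * he + a * hr - a / 4 * h3

/-- The diagonal symmetries act on the family by multiplying the parameter by a square. -/
theorem transport_diagonal_zero {P : BinaryCubic} {φ₁ φ₂ : Mat2}
    (h₁ : IsChange P φ₁ fun x y => x ^ 2 * y) (h₂ : IsChange P φ₂ fun x y => x ^ 2 * y) :
    ∃ l, 0 < l ∧ familyZero φ₁ 1 = familyZero φ₂ l := by
  obtain ⟨σ, hσ, hst⟩ := change_quotient h₁ h₂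
  obtain ⟨e1, e2, e3⟩ := stabilizer_zero hst
  have hp : σ 0 0 ≠ 0 := by
    intro h
    rw [h] at e3
    norm_num at e3
  refine ⟨σ 0 0 ^ 2, by positivity, ?_⟩
  have := congr_transport h₁.1 (Matrix.diagonal ![1, 4 / 27])
  rw [familyZero, familyZero, transport_eq_iff h₂.1, hσ, transpose_mul]
  norm_num
  rw [show σᵀ * φ₁ᵀ * transport φ₁ (Matrix.diagonal ![1, 4 / 27]) * (φ₁ * σ)
      = σᵀ * (φ₁ᵀ * transport φ₁ (Matrix.diagonal ![1, 4 / 27]) * φ₁) * σ by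
        simp only [Matrix.mul_assoc], this]
  ext i j
  fin_cases i <;> fin_cases j <;> simp [Matrix.mul_apply, Fin.sum_univ_two, e1, e2]
  · ring
  · field_simp
    linear_combination (σ 0 0 ^ 2 * σ 1 1 + 1) * e3

/-! ### Bounds for the discriminant -/

/-- Used to choose a direction on the unit circle in which a Fourier coefficient becomes real and
nonnegative. -/
theorem exists_unit_mul_pow (C : ℂ) {n : ℕ} (hn : 0 < n) :
    ∃ w : ℂ, w.re ^ 2 + w.im ^ 2 = 1 ∧ C * w ^ n = (‖C‖ : ℂ) := by
  by_cases hC : C = 0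
  · exact ⟨1, by simp, by simp [hC]⟩
  · have hC' : (‖C‖ : ℂ) ≠ 0 := by simpa using hC
    obtain ⟨w, hw⟩ := IsAlgClosed.exists_pow_nat_eq ((‖C‖ : ℂ) / C) hn
    have h1 : ‖w‖ = 1 := by
      have := congrArg norm hw
      rw [norm_pow, norm_div, Complex.norm_real, norm_norm, div_self (norm_ne_zero_iff.2 hC)] at this
      exact (pow_eq_one_iff_of_nonneg (norm_nonneg _) hn.ne').1 this
    refine ⟨w, ?_, ?_⟩
    · have := Complex.sq_norm w
      rw [h1, Complex.normSq_apply] at this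
      linarith
    · rw [hw]
      field_simp

/-- With `a = ‖A‖` and `b = ‖B‖`, the worst values are `T = ± a b ^ 3`. For the minus sign the
bracket is `-(b + 3 a) ^ 3 (b - a)`, extremal at `b = 3 a`; for the plus sign it is `27 a ^ 4` minus
`b ^ 2 ((b - 4 a) ^ 2 + 2 a ^ 2)`. -/
theorem disc_bounds_of_coeffs {A B : ℂ} (h1 : ‖A‖ ≤ 1) (h2 : (‖A‖ + ‖B‖) ^ 2 ≤ 2) {T : ℝ}
    (hT : T ^ 2 ≤ (‖A‖ * ‖B‖ ^ 3) ^ 2) :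
    -27 ≤ 4 * (27 * ‖A‖ ^ 4 - 18 * ‖A‖ ^ 2 * ‖B‖ ^ 2 - ‖B‖ ^ 4 + 8 * T) ∧
      4 * (27 * ‖A‖ ^ 4 - 18 * ‖A‖ ^ 2 * ‖B‖ ^ 2 - ‖B‖ ^ 4 + 8 * T) ≤ 108 := by
  have ha := norm_nonneg A
  have hb := norm_nonneg B
  set a := ‖A‖
  set b := ‖B‖
  obtain ⟨t1, t2⟩ := abs_le.1 (abs_le_of_sq_le_sq hT (by positivity))
  constructor
  · have key : 16 * ((b + 3 * a) ^ 3 * (b - a)) ≤ 27 * (a + b) ^ 4 := by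
      have e : 27 * (a + b) ^ 4 - 16 * ((b + 3 * a) ^ 3 * (b - a))
          = (b - 3 * a) ^ 2 * (11 * b ^ 2 + 46 * a * b + 51 * a ^ 2) := by ring
      have : 0 ≤ (b - 3 * a) ^ 2 * (11 * b ^ 2 + 46 * a * b + 51 * a ^ 2) := by positivity
      linarith
    have h4 : (a + b) ^ 4 ≤ 4 := by
      calc (a + b) ^ 4 = ((a + b) ^ 2) ^ 2 := by ring
        _ ≤ 2 ^ 2 := by gcongr
        _ = 4 := by norm_num
    nlinarith
  · have ha4 : a ^ 4 ≤ 1 := pow_le_one₀ ha h1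
    have : 0 ≤ b ^ 2 * ((b - 4 * a) ^ 2 + 2 * a ^ 2) := by positivity
    nlinarith

/-- On the unit circle `Q = Re (A w ^ 3 + B w)` with `w = x + i y`. Averaging over three rotations
by 120 degrees isolates `A`. Adding the squares at `w` and `i w` gives `‖A‖ ^ 2 + ‖B‖ ^ 2 + 2 Re (A
B w ^ 4)`, which a suitable `w` turns into `(‖A‖ + ‖B‖) ^ 2`. The discriminant depends only on the
two norms and on `T`, the real part of `A` times the conjugate of `B ^ 3`. -/
theorem disc_bounds {Q : BinaryCubic} (h : ∀ x y, (Q.eval x y) ^ 2 ≤ (x ^ 2 + y ^ 2) ^ 3) :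
    -27 ≤ Q.disc ∧ Q.disc ≤ 108 := by
  set A : ℂ := ⟨(Q.a - Q.c) / 4, (Q.d - Q.b) / 4⟩ with hA
  set B : ℂ := ⟨(3 * Q.a + Q.c) / 4, -(Q.b + 3 * Q.d) / 4⟩ with hB
  have hAn : ‖A‖ ^ 2 = ((Q.a - Q.c) / 4) ^ 2 + ((Q.d - Q.b) / 4) ^ 2 := by
    rw [Complex.sq_norm, Complex.normSq_apply]; ring
  have hBn : ‖B‖ ^ 2 = ((3 * Q.a + Q.c) / 4) ^ 2 + (-(Q.b + 3 * Q.d) / 4) ^ 2 := by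
    rw [Complex.sq_norm, Complex.normSq_apply]; ring
  have h1 : ‖A‖ ≤ 1 := by
    obtain ⟨w, hw, he⟩ := exists_unit_mul_pow A (n := 3) (by norm_num)
    have hre := congrArg Complex.re he
    simp [pow_succ, Complex.mul_re, Complex.mul_im, hA] at hre
    rw [← hA] at hre
    have s3 : (√3 : ℝ) ^ 2 = 3 := Real.sq_sqrt (by norm_num)
    have hb : ∀ x y : ℝ, x ^ 2 + y ^ 2 = 1 → Q.eval x y ≤ 1 := by
      intro x y hxy
      have := h x y
      rw [hxy, one_pow] at this
      exact (abs_le.1 (sq_le_one_iff_abs_le_one _ |>.1 this)).2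
    have k1 := hb w.re w.im hw
    have k2 := hb (-w.re / 2 - √3 / 2 * w.im) (√3 / 2 * w.re - w.im / 2) (by
      linear_combination hw + (w.re ^ 2 + w.im ^ 2) / 4 * s3)
    have k3 := hb (-w.re / 2 + √3 / 2 * w.im) (-(√3 / 2) * w.re - w.im / 2) (by
      linear_combination hw + (w.re ^ 2 + w.im ^ 2) / 4 * s3)
    have e : Q.eval w.re w.im + Q.eval (-w.re / 2 - √3 / 2 * w.im) (√3 / 2 * w.re - w.im / 2)
        + Q.eval (-w.re / 2 + √3 / 2 * w.im) (-(√3 / 2) * w.re - w.im / 2) = 3 * ‖A‖ := by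
      rw [← hre]
      have r3 : √3 ^ 3 = 3 * √3 := by rw [pow_succ, s3]
      simp only [BinaryCubic.eval]
      ring_nf
      rw [s3]
      ring
    linarith
  have h2 : (‖A‖ + ‖B‖) ^ 2 ≤ 2 := by
    obtain ⟨w, hw, he⟩ := exists_unit_mul_pow (A * B) (n := 4) (by norm_num)
    have hre := congrArg Complex.re he
    rw [norm_mul] at hre
    simp only [pow_succ, Complex.mul_re, Complex.mul_im, Complex.ofReal_re, pow_zero,
      Complex.one_re, Complex.one_im] at hre
    have hb : ∀ x y : ℝ, x ^ 2 + y ^ 2 = 1 → (Q.eval x y) ^ 2 ≤ 1 := by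
      intro x y hxy
      have := h x y
      rwa [hxy, one_pow] at this
    have k1 := hb w.re w.im hw
    have k2 := hb (-w.im) w.re (by linarith)
    have e : (‖A‖ + ‖B‖) ^ 2 = (Q.eval w.re w.im) ^ 2 + (Q.eval (-w.im) w.re) ^ 2 := by
      rw [add_sq, mul_assoc, ← hre]
      have hAn' : ‖A‖ ^ 2 = A.re ^ 2 + A.im ^ 2 := hAn
      have hBn' : ‖B‖ ^ 2 = B.re ^ 2 + B.im ^ 2 := hBn
      have ea : Q.a = A.re + B.re := by simp only [hA, hB]; ring
      have eb : Q.b = -3 * A.im - B.im := by simp only [hA, hB]; ring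
      have ec : Q.c = -3 * A.re + B.re := by simp only [hA, hB]; ring
      have ed : Q.d = A.im - B.im := by simp only [hA, hB]; ring
      have e1 : ∀ x y : ℝ, x ^ 2 + y ^ 2 = 1 → Q.eval x y = A.re * (x ^ 3 - 3 * x * y ^ 2)
          - A.im * (3 * x ^ 2 * y - y ^ 3) + (B.re * x - B.im * y) := by
        intro x y hxy
        rw [BinaryCubic.eval, ea, eb, ec, ed]
        linear_combination (B.re * x - B.im * y) * hxy
      rw [e1 _ _ hw, e1 (-w.im) w.re (by linarith), hAn', hBn']
      generalize w.re = x at hw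
      generalize w.im = y at hw
      linear_combination -((A.re ^ 2 + A.im ^ 2) * ((x ^ 2 + y ^ 2) ^ 2 + (x ^ 2 + y ^ 2) + 1)
        + (B.re ^ 2 + B.im ^ 2)) * hw
    linarith
  set T := ((Q.a - Q.c) / 4) * (((3 * Q.a + Q.c) / 4) ^ 3
      - 3 * ((3 * Q.a + Q.c) / 4) * (-(Q.b + 3 * Q.d) / 4) ^ 2)
    + ((Q.d - Q.b) / 4) * (3 * ((3 * Q.a + Q.c) / 4) ^ 2 * (-(Q.b + 3 * Q.d) / 4)
      - (-(Q.b + 3 * Q.d) / 4) ^ 3) with hT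
  have hT2 : T ^ 2 ≤ (‖A‖ * ‖B‖ ^ 3) ^ 2 := by
    rw [mul_pow, ← pow_mul, mul_comm 3 2, pow_mul, hAn, hBn]
    set p := (Q.a - Q.c) / 4
    set q := (Q.d - Q.b) / 4
    set u := (3 * Q.a + Q.c) / 4
    set v := -(Q.b + 3 * Q.d) / 4
    have e : (p ^ 2 + q ^ 2) * (u ^ 2 + v ^ 2) ^ 3 - T ^ 2
        = (p * (3 * u ^ 2 * v - v ^ 3) - q * (u ^ 3 - 3 * u * v ^ 2)) ^ 2 := by
      rw [hT]; ring
    have := sq_nonneg (p * (3 * u ^ 2 * v - v ^ 3) - q * (u ^ 3 - 3 * u * v ^ 2))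
    linarith
  have hdisc : Q.disc = 4 * (27 * ‖A‖ ^ 4 - 18 * ‖A‖ ^ 2 * ‖B‖ ^ 2 - ‖B‖ ^ 4 + 8 * T) := by
    rw [show ‖A‖ ^ 4 = (‖A‖ ^ 2) ^ 2 by ring, show ‖B‖ ^ 4 = (‖B‖ ^ 2) ^ 2 by ring, hAn, hBn, hT]
    simp only [BinaryCubic.disc]
    ring
  rw [hdisc]
  exact disc_bounds_of_coeffs h1 h2 hT2

/-- The volume bound for inscribed ellipses. -/
theorem disc_le_det {P : BinaryCubic} {H : Mat2} (hp : H.PosDef) (hc : CubicLe P H) :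
    -27 * H.det ^ 3 ≤ P.disc ∧ P.disc ≤ 108 * H.det ^ 3 := by
  obtain ⟨ψ, hψ⟩ := exists_isFrame hp
  obtain ⟨h1, h2⟩ := disc_bounds (hψ.comp_le hc)
  rw [disc_comp] at h1 h2
  have hdet := hψ.det
  have h6 : ψ.det ^ 6 * H.det ^ 3 = 1 := by
    calc ψ.det ^ 6 * H.det ^ 3 = (ψ.det ^ 2 * H.det) ^ 3 := by ring
      _ = 1 := by rw [hdet, one_pow]
  have h3 : 0 < H.det ^ 3 := pow_pos hp.det_pos 3
  have e : ψ.det ^ 6 * P.disc * H.det ^ 3 = P.disc := by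
    linear_combination P.disc * h6
  constructor
  · have := mul_le_mul_of_nonneg_right h1 h3.le
    linarith
  · have := mul_le_mul_of_nonneg_right h2 h3.le
    linarith

/-! ### The families consist of inscribed ellipses -/

theorem diagonal_posDef {a b : ℝ} (ha : 0 < a) (hb : 0 < b) :
    (Matrix.diagonal ![a, b] : Mat2).PosDef := by
  refine Matrix.PosDef.diagonal fun i => ?_
  fin_cases i
  · exact ha
  · exact hb

theorem quadAt_diagonal (a b x y : ℝ) :
    quadAt (Matrix.diagonal ![a, b]) x y = a * x ^ 2 + b * y ^ 2 := by
  simp [quadAt]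

/-- The difference of the two sides is a square times a nonnegative form; the zeros of the square
are the contact directions. -/
theorem neg_family_le {l : ℝ} (hl : 0 < l) (x y : ℝ) : (x * (x ^ 2 + 3 * y ^ 2)) ^ 2 ≤
    ((4 + l ^ 3) / (3 * l ^ 2) * x ^ 2 + l * y ^ 2) ^ 3 := by
  set m := (4 + l ^ 3) / (3 * l ^ 2) with hm
  have e : (m * x ^ 2 + l * y ^ 2) ^ 3 - (x * (x ^ 2 + 3 * y ^ 2)) ^ 2
      = (4 / l ^ 2 * x ^ 2 - m * x ^ 2 - l * y ^ 2) ^ 2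
        * ((m - 1 / l ^ 2) * x ^ 2 + l * y ^ 2) := by
    rw [hm]
    field_simp
    ring
  have h1 : 0 ≤ m - 1 / l ^ 2 := by
    rw [hm, show (4 + l ^ 3) / (3 * l ^ 2) - 1 / l ^ 2 = (1 + l ^ 3) / (3 * l ^ 2) by
      field_simp; ring]
    positivity
  have : 0 ≤ (4 / l ^ 2 * x ^ 2 - m * x ^ 2 - l * y ^ 2) ^ 2
        * ((m - 1 / l ^ 2) * x ^ 2 + l * y ^ 2) := by positivity
  linarith

/-- The factorization is that of the negative case, but its second factor is nonnegative only
because `l ≤ 1`. -/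
theorem pos_family_le {l : ℝ} (hl : 0 < l) (hl1 : l ≤ 1) (x y : ℝ) :
    (x * (x ^ 2 - 3 * y ^ 2)) ^ 2 ≤ ((4 - l ^ 3) / (3 * l ^ 2) * x ^ 2 + l * y ^ 2) ^ 3 := by
  set m := (4 - l ^ 3) / (3 * l ^ 2) with hm
  have e : (m * x ^ 2 + l * y ^ 2) ^ 3 - (x * (x ^ 2 - 3 * y ^ 2)) ^ 2
      = (4 / l ^ 2 * x ^ 2 - m * x ^ 2 - l * y ^ 2) ^ 2
        * ((m - 1 / l ^ 2) * x ^ 2 + l * y ^ 2) := by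
    rw [hm]
    field_simp
    ring
  have h1 : 0 ≤ m - 1 / l ^ 2 := by
    rw [hm, show (4 - l ^ 3) / (3 * l ^ 2) - 1 / l ^ 2 = (1 - l ^ 3) / (3 * l ^ 2) by
      field_simp; ring]
    have : l ^ 3 ≤ 1 := pow_le_one₀ hl.le hl1
    exact div_nonneg (by linarith) (by positivity)
  have : 0 ≤ (4 / l ^ 2 * x ^ 2 - m * x ^ 2 - l * y ^ 2) ^ 2
        * ((m - 1 / l ^ 2) * x ^ 2 + l * y ^ 2) := by positivity
  linarith

theorem zero_family_le {l : ℝ} (hl : 0 < l) (x y : ℝ) :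
    (x ^ 2 * y) ^ 2 ≤ (l * x ^ 2 + 4 / (27 * l ^ 2) * y ^ 2) ^ 3 := by
  have e : (l * x ^ 2 + 4 / (27 * l ^ 2) * y ^ 2) ^ 3 - (x ^ 2 * y) ^ 2
      = (4 / (27 * l ^ 2) * y ^ 2 - l * x ^ 2 / 2) ^ 2
        * (4 / (27 * l ^ 2) * y ^ 2 + 4 * l * x ^ 2) := by
    field_simp
    ring
  have : 0 ≤ (4 / (27 * l ^ 2) * y ^ 2 - l * x ^ 2 / 2) ^ 2
        * (4 / (27 * l ^ 2) * y ^ 2 + 4 * l * x ^ 2) := by positivity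
  linarith

theorem isInscribed_transport {P : BinaryCubic} {φ D : Mat2} {q : ℝ → ℝ → ℝ}
    (h : IsChange P φ q) (hD : D.PosDef) (hle : ∀ x y, (q x y) ^ 2 ≤ (quadAt D x y) ^ 3) :
    (transport φ D).PosDef ∧ CubicLe P (transport φ D) := by
  rw [isChange_iff] at h
  exact ⟨transport_posDef h.1 hD, cubicLe_transport h.1 fun x y => by rw [h.2]; exact hle x y⟩

theorem familyNeg_inscribed {P : BinaryCubic} {φ : Mat2} (hd : P.disc < 0) (h : IsReduction P φ)
    {l : ℝ} (hl : 0 < l) : (familyNeg φ l).PosDef ∧ CubicLe P (familyNeg φ l) :=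
  isInscribed_transport (h.isChange_neg hd) (diagonal_posDef (by positivity) hl) fun x y => by
    rw [quadAt_diagonal]; exact neg_family_le hl x y

theorem threeRotations_orthogonal {V : Mat2} (hV : V ∈ threeRotations) : Vᵀ * V = 1 := by
  have h3 : √3 * √3 = 3 := Real.mul_self_sqrt (by norm_num)
  rw [mem_threeRotations_iff] at hV
  rcases hV with rfl | rfl | rfl
  · simp
  all_goals
    ext i j
    fin_cases i <;> fin_cases j <;> simp [Matrix.mul_apply, Fin.sum_univ_two] <;> nlinarith

theorem threeRotations_det {V : Mat2} (hV : V ∈ threeRotations) : V.det ≠ 0 := by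
  have := congrArg Matrix.det (threeRotations_orthogonal hV)
  rw [det_mul, det_transpose, det_one] at this
  intro h
  rw [h] at this
  norm_num at this

theorem threeRotations_cubic {V : Mat2} (hV : V ∈ threeRotations) (x y : ℝ) :
    ((V 0 0 * x + V 0 1 * y) * ((V 0 0 * x + V 0 1 * y) ^ 2 - 3 * (V 1 0 * x + V 1 1 * y) ^ 2)) ^ 2
      = (x * (x ^ 2 - 3 * y ^ 2)) ^ 2 := by
  have h3 : √3 ^ 2 = 3 := Real.sq_sqrt (by norm_num)
  rw [mem_threeRotations_iff] at hV
  rcases hV with rfl | rfl | rfl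
  · simp
  · simp
    rw [sq_eq_sq_iff_eq_or_eq_neg]
    right
    linear_combination (-3 / 8 * x ^ 3 + 9 / 8 * x * y ^ 2 + √3 / 8 * (3 * x ^ 2 * y - y ^ 3)) * h3
  · simp
    rw [sq_eq_sq_iff_eq_or_eq_neg]
    left
    linear_combination (3 / 8 * x ^ 3 - 9 / 8 * x * y ^ 2 + √3 / 8 * (3 * x ^ 2 * y - y ^ 3)) * h3

theorem familyPos_inscribed {P : BinaryCubic} {φ V : Mat2} (hd : 0 < P.disc)
    (h : IsReduction P φ) (hV : V ∈ threeRotations) {l : ℝ} (hl : 0 < l) (hl1 : l ≤ 1) :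
    (familyPos φ V l).PosDef ∧ CubicLe P (familyPos φ V l) := by
  have hVd := threeRotations_det hV
  have hm : 0 < (4 - l ^ 3) / (3 * l ^ 2) := by
    have : l ^ 3 ≤ 1 := pow_le_one₀ hl.le hl1
    exact div_pos (by linarith) (by positivity)
  refine isInscribed_transport (h.isChange_pos hd) ?_ fun x y => ?_
  · rw [posDef_iff_quadAt]
    refine ⟨by simp [Matrix.mul_apply, Fin.sum_univ_two]; ring, fun x y hxy => ?_⟩
    rw [quadAt_congr]
    refine (diagonal_posDef hm hl).quadAt_pos ?_
    by_contra! h0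
    obtain ⟨h1, h2⟩ := h0
    rw [det_fin_two] at hVd
    have e1 : x = 0 := by
      apply (mul_eq_zero.1 (show (V 0 0 * V 1 1 - V 0 1 * V 1 0) * x = 0 by
        linear_combination V 1 1 * h1 - V 0 1 * h2)).resolve_left hVd
    have e2 : y = 0 := by
      apply (mul_eq_zero.1 (show (V 0 0 * V 1 1 - V 0 1 * V 1 0) * y = 0 by
        linear_combination V 0 0 * h2 - V 1 0 * h1)).resolve_left hVd
    tauto
  · rw [quadAt_congr, quadAt_diagonal, ← threeRotations_cubic hV]
    exact pos_family_le hl hl1 _ _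

theorem familyZero_inscribed {P : BinaryCubic} {φ : Mat2} (h : IsChange P φ fun x y => x ^ 2 * y)
    {l : ℝ} (hl : 0 < l) : (familyZero φ l).PosDef ∧ CubicLe P (familyZero φ l) :=
  isInscribed_transport h (diagonal_posDef hl (by positivity)) fun x y => by
    rw [quadAt_diagonal]; exact zero_family_le hl x y

/-! ### The ellipse `E_P` -/

theorem two_rpow_third : ((2 : ℝ) ^ (1 / 3 : ℝ)) ^ 3 = 2 := by
  rw [← Real.rpow_natCast, ← Real.rpow_mul (by norm_num)]
  norm_num

theorem optimalMatrix_pos {P : BinaryCubic} (hd : 0 < P.disc) (φ : Mat2) :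
    optimalMatrix P φ = familyPos φ 1 1 := by
  rw [optimalMatrix, if_pos hd, familyPos, transpose_one, Matrix.one_mul, Matrix.mul_one]
  congr 1
  ext i j
  fin_cases i <;> fin_cases j <;> norm_num

/-- At `l ^ 3 = 2` the two diagonal entries of the family coincide, so the form is scalar in the
reduced coordinates. -/
theorem optimalMatrix_neg {P : BinaryCubic} (hd : P.disc < 0) (φ : Mat2) {l : ℝ}
    (hl : l ^ 3 = 2) : optimalMatrix P φ = familyNeg φ l := by
  have hl2 : l = (2 : ℝ) ^ (1 / 3 : ℝ) := by
    have h := two_rpow_third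
    have : Odd 3 := by decide
    exact this.strictMono_pow.injective (by simp only [hl, h])
  have hl0 : 0 < l := by rw [hl2]; positivity
  rw [optimalMatrix, if_neg (not_lt.2 hd.le), familyNeg, ← hl2]
  have : (Matrix.diagonal ![(4 + l ^ 3) / (3 * l ^ 2), l] : Mat2) = l • 1 := by
    ext i j
    fin_cases i <;> fin_cases j <;> simp
    rw [div_eq_iff (by positivity)]
    linear_combination -2 * hl
  rw [this, transport, transport]
  simp

theorem optimalMatrix_inscribed {P : BinaryCubic} {φ : Mat2} (h : IsReduction P φ) :
    (optimalMatrix P φ).PosDef ∧ CubicLe P (optimalMatrix P φ) := by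
  rcases h with h' | h'
  · rw [optimalMatrix_pos h'.1]
    exact familyPos_inscribed h'.1 (Or.inl h') one_mem_threeRotations one_pos le_rfl
  · rw [optimalMatrix_neg h'.1 φ two_rpow_third]
    exact familyNeg_inscribed h'.1 (Or.inr h') (by positivity)

theorem optimalMatrix_unique {P : BinaryCubic} {φ₁ φ₂ : Mat2} (h₁ : IsReduction P φ₁)
    (h₂ : IsReduction P φ₂) : optimalMatrix P φ₁ = optimalMatrix P φ₂ := by
  rcases h₁ with h | h
  · have e : (1 : Mat2) = Matrix.diagonal ![1, 1] := by
      ext i j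
      fin_cases i <;> fin_cases j <;> simp
    simp only [optimalMatrix, if_pos h.1]
    obtain ⟨V, hV, hV2⟩ := transport_diagonal_pos h.1 (Or.inl h) h₂ 1 1
    rw [e, hV2, ← e, Matrix.mul_one, threeRotations_orthogonal hV]
  · rw [optimalMatrix_neg h.1 φ₁ two_rpow_third, optimalMatrix_neg h.1 φ₂ two_rpow_third]
    exact transport_diagonal_neg h.1 (Or.inr h) h₂ _ _

/-- The normal forms have discriminant `108` and `-108`, so `optimalMatrix` attains equality in one
of the two bounds of `disc_le_det`. -/
theorem det_optimalMatrix_le {P : BinaryCubic} {φ : Mat2} (h : IsReduction P φ) {K : Mat2}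
    (hp : K.PosDef) (hc : CubicLe P K) : (optimalMatrix P φ).det ≤ K.det := by
  obtain ⟨b1, b2⟩ := disc_le_det hp hc
  have hdp := (optimalMatrix_inscribed h).1.det_pos
  suffices (optimalMatrix P φ).det ^ 3 ≤ K.det ^ 3 from
    le_of_pow_le_pow_left₀ (by norm_num) hp.det_pos.le this
  have hdisc := disc_comp P φ
  rcases h with ⟨hd, hch⟩ | ⟨hd, hch⟩
  · rw [isChange_iff] at hch
    obtain ⟨e1, e2, e3, e4⟩ := coeff_of_eval_eq (P := P.comp φ) (a := 1) (b := 0) (c := -3) (d := 0)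
      (fun x y => by rw [hch.2]; ring)
    have hdet := det_transport hch.1 (1 : Mat2)
    rw [det_one] at hdet
    simp only [optimalMatrix, if_pos hd] at hdp ⊢
    have e : φ.det ^ 6 * P.disc = 108 := by
      rw [← hdisc]; simp only [BinaryCubic.disc, e1, e2, e3, e4]; norm_num
    have e' : φ.det ^ 6 * (transport φ 1).det ^ 3 = 1 := by
      calc _ = (φ.det ^ 2 * (transport φ 1).det) ^ 3 := by ring
        _ = 1 := by rw [hdet, one_pow]
    have h6 : 0 < φ.det ^ 6 := by have := hch.1; positivity
    refine le_of_mul_le_mul_left ?_ h6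
    nlinarith
  · rw [isChange_iff] at hch
    obtain ⟨e1, e2, e3, e4⟩ := coeff_of_eval_eq (P := P.comp φ) (a := 1) (b := 0) (c := 3) (d := 0)
      (fun x y => by rw [hch.2]; ring)
    have hdet := det_transport hch.1 (1 : Mat2)
    rw [det_one] at hdet
    simp only [optimalMatrix, if_neg (not_lt.2 hd.le)] at hdp ⊢
    rw [det_smul, Fintype.card_fin]
    have h2 := two_rpow_third
    set l := (2 : ℝ) ^ (1 / 3 : ℝ)
    have e : φ.det ^ 6 * P.disc = -108 := by
      rw [← hdisc]; simp only [BinaryCubic.disc, e1, e2, e3, e4]; norm_num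
    have e' : φ.det ^ 6 * (l ^ 2 * (transport φ 1).det) ^ 3 = 4 := by
      calc _ = (l ^ 3) ^ 2 * (φ.det ^ 2 * (transport φ 1).det) ^ 3 := by ring
        _ = 4 := by rw [hdet, h2]; norm_num
    have h6 : 0 < φ.det ^ 6 := by have := hch.1; positivity
    refine le_of_mul_le_mul_left ?_ h6
    nlinarith

/-! ### Existence of reductions -/

theorem exists_unit_root (P : BinaryCubic) : ∃ u v : ℝ, u ^ 2 + v ^ 2 = 1 ∧ P.eval u v = 0 := by
  have hc : ContinuousOn (fun θ : ℝ => P.eval (Real.cos θ) (Real.sin θ))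
      (Set.uIcc 0 Real.pi) := by
    unfold BinaryCubic.eval
    fun_prop
  have h0 : (0 : ℝ) ∈ Set.uIcc (P.eval (Real.cos 0) (Real.sin 0))
      (P.eval (Real.cos Real.pi) (Real.sin Real.pi)) := by
    simp only [BinaryCubic.eval, Real.cos_zero, Real.sin_zero, Real.cos_pi, Real.sin_pi]
    rw [Set.mem_uIcc]
    rcases le_total 0 P.a with h | h
    · right; constructor <;> linarith
    · left; constructor <;> linarith
  obtain ⟨θ, -, hθ⟩ := intermediate_value_uIcc hc h0
  exact ⟨Real.cos θ, Real.sin θ, Real.cos_sq_add_sin_sq θ, hθ⟩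

theorem exists_cube_root_of_ne {v : ℝ} (hv : v ≠ 0) : ∃ l : ℝ, l ^ 3 = v := by
  rcases hv.lt_or_gt with h | h
  · obtain ⟨l, -, hl⟩ := exists_cube_root (neg_pos.2 h)
    exact ⟨-l, by linear_combination -hl⟩
  · obtain ⟨l, -, hl⟩ := exists_cube_root h
    exact ⟨l, hl⟩

/-- An orthogonal change moves a real root line to the second axis, so `d = 0`. Completing the
square in `y` leaves an `x ^ 3` and an `x y ^ 2` term, and scaling the variables makes the
coefficients `1` and `± 3`. -/
theorem exists_isReduction {P : BinaryCubic} (hd : P.disc ≠ 0) : ∃ φ, IsReduction P φ := by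
  obtain ⟨u, v, huv, h0⟩ := exists_unit_root P
  set ψ : Mat2 := !![-v, u; u, v] with hψ
  have hψd : ψ.det = -1 := by
    rw [det_fin_two]; simp [hψ]; linarith
  have hQd : (P.comp ψ).d = 0 := by simp [BinaryCubic.comp, hψ, h0]
  have hdisc := disc_comp P ψ
  rw [hψd] at hdisc
  set Q := P.comp ψ with hQ
  have hdQ : Q.disc = P.disc := by rw [hdisc]; norm_num
  have hdQ2 : Q.disc = Q.c ^ 2 * (Q.b ^ 2 - 4 * Q.a * Q.c) := by
    simp only [BinaryCubic.disc, hQd]; ring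
  have hc : Q.c ≠ 0 := by
    intro h
    rw [h] at hdQ2
    apply hd
    rw [← hdQ, hdQ2]
    ring
  set a' := Q.a - Q.b ^ 2 / (4 * Q.c) with ha'
  have hda : P.disc = -4 * Q.c ^ 3 * a' := by
    rw [← hdQ, hdQ2, ha']
    field_simp
    ring
  have ha0 : a' ≠ 0 := by
    intro h
    apply hd
    rw [hda, h]
    ring
  obtain ⟨s, hs⟩ := exists_cube_root_of_ne (inv_ne_zero ha0)
  have has : a' * s ^ 3 = 1 := by rw [hs, mul_inv_cancel₀ ha0]
  have hs0 : s ≠ 0 := by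
    rintro rfl
    norm_num at has
  have hcs : Q.c * s ≠ 0 := mul_ne_zero hc hs0
  set e := √(3 / |Q.c * s|) with he
  have he0 : 0 < e := Real.sqrt_pos.2 (by positivity)
  have he2 : |Q.c * s| * e ^ 2 = 3 := by
    rw [he, Real.sq_sqrt (by positivity)]
    field_simp
  have hsign : P.disc * (Q.c * s) < 0 ∨ 0 < P.disc * (Q.c * s) :=
    (mul_ne_zero hd hcs).lt_or_gt
  have hprod : P.disc * (Q.c * s) * s ^ 2 = -4 * Q.c ^ 4 := by
    rw [hda]; linear_combination -4 * Q.c ^ 4 * has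
  -- The scale `s` is forced by the coefficient of `x ^ 3`; the sign of `Q.c * s`, opposite to that
  -- of the discriminant, decides between `3` and `-3`.
  have hneg : P.disc * (Q.c * s) < 0 := by
    by_contra! h
    have h1 : 0 ≤ P.disc * (Q.c * s) * s ^ 2 := mul_nonneg h (sq_nonneg s)
    have : 0 < Q.c ^ 4 := by positivity
    linarith
  set σ : Mat2 := !![s, 0; -Q.b / (2 * Q.c) * s, e] with hσ
  have hφd : (ψ * σ).det ≠ 0 := by
    rw [det_mul, hψd, det_fin_two]
    simp [hσ, hs0, he0.ne']
  have heval : ∀ x y, (P.comp (ψ * σ)).eval x y = x ^ 3 + Q.c * s * e ^ 2 * x * y ^ 2 := by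
    intro x y
    rw [eval_comp_mul, ← hQ]
    simp [BinaryCubic.eval, hσ, hQd]
    have : x ^ 3 = a' * s ^ 3 * x ^ 3 := by rw [has, one_mul]
    rw [this, ha']
    field_simp
    ring
  refine ⟨ψ * σ, ?_⟩
  rcases hd.lt_or_gt with h | h
  · right
    refine ⟨h, (isChange_iff _ _ _).2 ⟨hφd, fun x y => ?_⟩⟩
    have : 0 < Q.c * s := by
      by_contra! h1
      have := mul_nonneg_of_nonpos_of_nonpos h.le h1
      linarith
    rw [abs_of_pos this] at he2
    rw [heval, he2]
    ring
  · left
    refine ⟨h, (isChange_iff _ _ _).2 ⟨hφd, fun x y => ?_⟩⟩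
    have : Q.c * s < 0 := by
      by_contra! h1
      have := mul_nonneg h.le h1
      linarith
    rw [abs_of_neg this] at he2
    rw [heval, show Q.c * s * e ^ 2 = -3 by linarith]
    ring

/-! ### Solutions with inactive diameter constraint -/

/-- On the circle, `1 - P ^ 2` is a positive multiple of `(X ^ 2 - t ^ 2) ^ 2 (4 t ^ 2 - X ^ 2)`.
The second alternative can occur only for `t ≤ 1 / 2`. -/
theorem contact_canonicalCubic {t X Y : ℝ} (ht : 0 < t) (hXY : X ^ 2 + Y ^ 2 = 1)
    (h : ((canonicalCubic t).eval X Y) ^ 2 = 1) : X ^ 2 = t ^ 2 ∨ X ^ 2 = 4 * t ^ 2 := by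
  have e : (canonicalCubic t).eval X Y = (3 * t ^ 2 * X - X ^ 3) / (2 * t ^ 3) := by
    rw [eval_canonicalCubic, show Y ^ 2 = 1 - X ^ 2 by linarith]
    field_simp
    ring
  rw [e, div_pow, div_eq_one_iff_eq (by positivity)] at h
  have : (X ^ 2 - t ^ 2) ^ 2 * (4 * t ^ 2 - X ^ 2) = 0 := by linear_combination -h
  rcases mul_eq_zero.1 this with h1 | h1
  · left; have := pow_eq_zero_iff (two_ne_zero) |>.1 h1; linarith
  · right; linarith

theorem signed_contact {P : BinaryCubic} {H : Mat2} {x y : ℝ} (hq : quadAt H x y = 1)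
    (h : (P.eval x y) ^ 2 = 1) : ∃ e : ℝ, e ^ 2 = 1 ∧ quadAt H (e * x) (e * y) = 1 ∧
      P.eval (e * x) (e * y) = 1 := by
  rcases sq_eq_one_iff.1 h with h | h
  · exact ⟨1, by norm_num, by simpa using hq, by simpa using h⟩
  · exact ⟨-1, by norm_num, by rw [quadAt_smul_arg, hq]; norm_num,
      by rw [eval_smul_arg, h]; norm_num⟩

/-- A contact point and another one in the frame of the first give the canonical form. -/
theorem canonical_of_contacts {P : BinaryCubic} {H ψ : Mat2} (hp : H.PosDef) (hc : CubicLe P H)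
    (hψ : IsFrame H ψ) (ha : (P.comp ψ).a = 1) {X Y : ℝ} (hXY : X ^ 2 + Y ^ 2 = 1) (hY : Y ≠ 0)
    (h : ((P.comp ψ).eval X Y) ^ 2 = 1) :
    ∃ ψ t, IsFrame H ψ ∧ 1 / 2 ≤ t ∧ t < 1 ∧ P.comp ψ = canonicalCubic t := by
  have hd := hψ.det_ne_zero
  rw [eval_comp] at h
  have hq := hψ.quadAt X Y
  rw [hXY] at hq
  obtain ⟨e, he, q2, p2⟩ := signed_contact hq h
  have q1 := hψ.quadAt 1 0
  simp only [mul_one, mul_zero, add_zero] at q1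
  have he0 : e ≠ 0 := by rintro rfl; norm_num at he
  refine exists_frame_of_two_contacts hp hc (by rw [q1]; norm_num) q2 ha p2 ?_
  rw [show ψ 0 0 * (e * (ψ 1 0 * X + ψ 1 1 * Y)) - e * (ψ 0 0 * X + ψ 0 1 * Y) * ψ 1 0
    = e * Y * ψ.det by rw [det_fin_two]; ring]
  positivity

/-- By strictness all contacts are contacts with the cubic. One contact gives a frame that starts at
it; the perturbation `X ^ 2 - Y ^ 2` yields a second, independent one, hence a canonical form, whose
parameter is then determined by two opposite perturbations. -/
theorem IsOptimal.eq_optimalMatrix {P : BinaryCubic} {α : ℝ} (hα : 0 < α) {H : Mat2}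
    (hH : IsOptimal P α H)
    (hstrict : ∀ x y, α * (x ^ 2 + y ^ 2) = quadAt H x y → x = 0 ∧ y = 0) :
    ∃ φ, IsReduction P φ ∧ H = optimalMatrix P φ := by
  have hp := hH.1.posDef hα
  have hc := hH.1.cubic
  have hcon : ∀ {ψ : Mat2}, IsFrame H ψ → ∀ {k l : ℝ}, (k ≠ 0 ∨ l ≠ 0) → ∃ X Y : ℝ,
      X ^ 2 + Y ^ 2 = 1 ∧ ((P.comp ψ).eval X Y) ^ 2 = 1 ∧
      k * (X ^ 2 - Y ^ 2) + 2 * l * X * Y ≤ 0 := by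
    intro ψ hψ k l hkl
    obtain ⟨X, Y, hXY, h1 | h1, h2⟩ := hH.exists_contact hψ hkl
    · exact ⟨X, Y, hXY, h1, h2⟩
    · exfalso
      obtain ⟨z1, z2⟩ := hstrict _ _ (by rw [h1, hψ.quadAt, hXY])
      have hq := hψ.quadAt X Y
      rw [z1, z2, hXY] at hq
      simp [_root_.quadAt] at hq
  obtain ⟨ψ₀, hψ₀⟩ := exists_isFrame hp
  obtain ⟨X₀, Y₀, hXY₀, h₀, -⟩ := hcon hψ₀ (k := 1) (l := 0) (Or.inl one_ne_zero)
  rw [eval_comp] at h₀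
  have hq₀ := hψ₀.quadAt X₀ Y₀
  rw [hXY₀] at hq₀
  obtain ⟨e, -, q1, p1⟩ := signed_contact hq₀ h₀
  obtain ⟨ψ₁, hψ₁, -, -, ha, -⟩ := frame_at_contact hp q1 p1
  obtain ⟨X₁, Y₁, hXY₁, h₁, hle₁⟩ := hcon hψ₁ (k := 1) (l := 0) (Or.inl one_ne_zero)
  have hY : Y₁ ≠ 0 := by
    rintro rfl
    norm_num at hXY₁ hle₁
    rw [hle₁] at hXY₁
    norm_num at hXY₁
  obtain ⟨ψ, t, hψ, ht1, ht2, hcan⟩ := canonical_of_contacts hp hc hψ₁ ha hXY₁ hY h₁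
  have ht0 : 0 < t := by linarith
  -- There must be a contact with `X ^ 2 ≤ Y ^ 2` and one with `X ^ 2 ≥ Y ^ 2`; the second is either
  -- `X ^ 2 = t ^ 2` or the extra pair on the first axis, which needs `t = 1 / 2`.
  have key : t ^ 2 = 1 / 2 ∨ t = 1 / 2 := by
    obtain ⟨X, Y, hXY, h, hle⟩ := hcon hψ (k := 1) (l := 0) (Or.inl one_ne_zero)
    obtain ⟨X', Y', hXY', h', hle'⟩ := hcon hψ (k := -1) (l := 0) (Or.inl (by norm_num))
    rw [hcan] at h h'
    have c1 : t ^ 2 ≤ 1 / 2 := by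
      rcases contact_canonicalCubic ht0 hXY h with h1 | h1 <;> nlinarith
    rcases contact_canonicalCubic ht0 hXY' h' with h1 | h1
    · left; nlinarith
    · right; nlinarith [sq_nonneg Y']
  rcases key with ht | ht
  · have hdisc : P.disc < 0 := (disc_sign hψ ht0 hcan).1.2 (by rw [ht]; norm_num)
    obtain ⟨l, hl, hl3, hred, hfam⟩ := familyNeg_of_canonical hψ ht0 ht2.le hcan hdisc
    refine ⟨_, hred, ?_⟩
    rw [optimalMatrix_neg hdisc _ (l := l) (by rw [hl3, ht]; norm_num)]
    exact hfam
  · have hdisc : 0 < P.disc := (disc_sign hψ ht0 hcan).2.2 (by rw [ht]; norm_num)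
    obtain ⟨φ, l, hl, hl3, hred, hfam⟩ := familyPos_of_canonical hψ ht1 hcan hdisc
    refine ⟨φ, hred, ?_⟩
    have hl1 : l = 1 := by
      rw [ht] at hl3
      have : l ^ 3 = 1 := by rw [hl3]; norm_num
      exact (pow_eq_one_iff_of_nonneg hl.1.le (by norm_num)).1 this
    rw [hl1] at hfam
    rw [optimalMatrix_pos hdisc]
    exact hfam

/-! ### The matrix `h_P` and the number `β_P` -/

theorem hOf_eq {P : BinaryCubic} {φ : Mat2} (h : IsReduction P φ) :
    hOf P = optimalMatrix P φ := by
  have hex : ∃ φ, IsReduction P φ := ⟨φ, h⟩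
  rw [hOf, dif_pos hex]
  exact optimalMatrix_unique hex.choose_spec h

theorem hOf_inscribed {P : BinaryCubic} (hd : P.disc ≠ 0) :
    (hOf P).PosDef ∧ CubicLe P (hOf P) := by
  obtain ⟨φ, h⟩ := exists_isReduction hd
  rw [hOf_eq h]
  exact optimalMatrix_inscribed h

theorem betaOf_pos {P : BinaryCubic} (hd : P.disc ≠ 0) : 0 < betaOf P := by
  have := diam_ellipse_pos (hOf_inscribed hd).1
  rw [betaOf, if_neg hd]
  positivity

theorem diam_ellipse_hOf {P : BinaryCubic} (hd : P.disc ≠ 0) :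
    Metric.diam (ellipse (hOf P)) = 2 / √(betaOf P) := by
  rw [betaOf, if_neg hd, div_sqrt_four_div_sq (diam_ellipse_pos (hOf_inscribed hd).1)]

theorem betaOf_spec {P : BinaryCubic} (hd : P.disc ≠ 0) :
    (∀ x y, betaOf P * (x ^ 2 + y ^ 2) ≤ quadAt (hOf P) x y) ∧
      (hOf P - betaOf P • (1 : Mat2)).det = 0 :=
  (diam_ellipse_eq_iff (hOf_inscribed hd).1 (betaOf_pos hd)).1 (diam_ellipse_hOf hd)

theorem det_hOf_le {P : BinaryCubic} (hd : P.disc ≠ 0) {K : Mat2} (hp : K.PosDef)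
    (hc : CubicLe P K) : (hOf P).det ≤ K.det := by
  obtain ⟨φ, h⟩ := exists_isReduction hd
  rw [hOf_eq h]
  exact det_optimalMatrix_le h hp hc

theorem isUnconstrainedSolution_iff {P : BinaryCubic} {H : Mat2} :
    IsUnconstrainedSolution P H ↔ (H.PosDef ∧ CubicLe P H) ∧
      ∀ K : Mat2, K.PosDef → CubicLe P K → H.det ≤ K.det := by
  unfold IsUnconstrainedSolution
  rw [isInscribed_iff]
  refine and_congr_right fun hH => ?_
  constructor
  · intro h K h1 h2
    exact (volume_ellipse_le_iff hH.1 h1).1 (h K ((isInscribed_iff _ _).2 ⟨h1, h2⟩))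
  · intro h K hK
    rw [isInscribed_iff] at hK
    exact (volume_ellipse_le_iff hH.1 hK.1).2 (h K hK.1 hK.2)

/-- `E_P` is the only solution of the unconstrained problem. -/
theorem eq_hOf_of_minimal {P : BinaryCubic} {H : Mat2} (hp : H.PosDef) (hc : CubicLe P H)
    (hmin : ∀ K : Mat2, K.PosDef → CubicLe P K → H.det ≤ K.det) : H = hOf P := by
  obtain ⟨c, hc0, hcle⟩ := hp.exists_le_quadAt
  -- Half of a lower bound of the form gives a diameter constraint that is inactive at `H`.
  have hα : 0 < c / 2 := by positivity
  have hopt : IsOptimal P (c / 2) H := by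
    refine ⟨⟨hp.symm_apply, fun x y => ?_, hc⟩, fun K hK => hmin K (hK.posDef hα) hK.cubic⟩
    refine le_trans ?_ (hcle x y)
    gcongr
    linarith
  obtain ⟨φ, h1, h2⟩ := hopt.eq_optimalMatrix hα (by
    intro x y hxy
    have := hcle x y
    have h0 : x ^ 2 + y ^ 2 ≤ 0 := by nlinarith
    constructor <;> nlinarith [sq_nonneg x, sq_nonneg y])
  rw [h2, hOf_eq h1]

theorem disc_ne_zero_of_le_betaOf {P : BinaryCubic} {α : ℝ} (hα : 0 < α) (h : α ≤ betaOf P) :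
    P.disc ≠ 0 := by
  intro h0
  rw [betaOf, if_pos h0] at h
  linarith

/-- For `α ≤ β_P` the ellipse `E_P` respects the diameter bound, so it is a competitor. -/
theorem IsOptimal.minimal_of_le_betaOf {P : BinaryCubic} {α : ℝ} (hα : 0 < α) (h : α ≤ betaOf P)
    {H : Mat2} (hH : IsOptimal P α H) (K : Mat2) (hp : K.PosDef) (hc : CubicLe P K) :
    H.det ≤ K.det := by
  have hd := disc_ne_zero_of_le_betaOf hα h
  have hi := hOf_inscribed hd
  refine (hH.2 (hOf P) ⟨hi.1.symm_apply, fun x y => ?_, hi.2⟩).trans (det_hOf_le hd hp hc)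
  refine le_trans ?_ ((betaOf_spec hd).1 x y)
  gcongr

/-! ### The third regime: quadri-tangency -/

/-- If `muOf P = 0`, then `P` vanishes and every disc is inscribed. The convention `1 / √0 = 0`
makes `discOf P` a point, so the diameters are unbounded and `alphaOf P = 0`. -/
theorem muOf_pos_of_alphaOf_pos {P : BinaryCubic} (h : 0 < alphaOf P) : 0 < muOf P := by
  refine (muOf_nonneg P).lt_of_ne fun h0 => ?_
  have hzero : ∀ x y, (P.eval x y) ^ 2 ≤ 0 := by
    intro x y
    have := eval_sq_le_muOf P x y
    rw [← h0] at this
    simpa using this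
  have hb : BddAbove (diametersAroundDisc P) := by
    by_contra hb
    rw [alphaOf, if_neg hb] at h
    exact lt_irrefl _ h
  obtain ⟨B, hB⟩ := hb
  set δ := |B| + 1 with hδ
  have hδ0 : 0 < δ := by positivity
  have hκ : 0 < 4 / δ ^ 2 := by positivity
  have hp := posDef_smul_one hκ
  have hmem : δ ∈ diametersAroundDisc P := by
    refine ⟨(4 / δ ^ 2) • 1, (isInscribed_iff _ _).2 ⟨hp, fun x y => ?_⟩, ?_, ?_⟩
    · refine (hzero x y).trans (pow_nonneg (hp.quadAt_nonneg x y) 3)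
    · rw [discOf, ← h0, Real.sqrt_zero, div_zero, Metric.closedBall_zero]
      rintro z rfl
      simp [ellipse, quadForm_eq_quadAt, quadAt]
    · rw [(diam_ellipse_eq_iff hp hκ).2 ⟨fun x y => by rw [quadAt_smul, quadAt_one], by simp⟩,
        div_sqrt_four_div_sq hδ0]
  have := hB hmem
  linarith [le_abs_self B]

theorem exists_eigenvector {H : Mat2} (hs : H 1 0 = H 0 1) {α : ℝ}
    (h : (H - α • (1 : Mat2)).det = 0) : ∃ a b : ℝ, (a ≠ 0 ∨ b ≠ 0) ∧
      H 0 0 * a + H 0 1 * b = α * a ∧ H 0 1 * a + H 1 1 * b = α * b := by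
  obtain ⟨v, hv, h0⟩ := Matrix.exists_mulVec_eq_zero_iff.2 h
  refine ⟨v 0, v 1, ?_, ?_, ?_⟩
  · by_contra! hc
    apply hv
    ext i
    fin_cases i
    · exact hc.1
    · exact hc.2
  · have := congrFun h0 0
    simp [Matrix.mulVec, dotProduct, Fin.sum_univ_two] at this
    linarith
  · have := congrFun h0 1
    simp [Matrix.mulVec, dotProduct, Fin.sum_univ_two, hs] at this
    linarith

/-- If the constraint were slack, `H` would be the matrix of `E_P`, whose smallest eigenvalue is
`β_P ≤ α`. -/
theorem IsOptimal.det_sub_eq_zero {P : BinaryCubic} {α : ℝ} (hα : 0 < α) (hβ : betaOf P ≤ α)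
    {H : Mat2} (hH : IsOptimal P α H) : (H - α • (1 : Mat2)).det = 0 := by
  by_contra hd
  obtain ⟨α', h1, h2⟩ := exists_lt_quadAt hH.1.symm hH.1.disk hd
  obtain ⟨φ, hφ, he⟩ := hH.eq_optimalMatrix hα (by
    intro x y hxy
    have := h2 x y
    have h0 : x ^ 2 + y ^ 2 ≤ 0 := by nlinarith
    constructor <;> nlinarith [sq_nonneg x, sq_nonneg y])
  have hdisc : P.disc ≠ 0 := by
    rcases hφ with h | h
    · exact h.1.ne'
    · exact h.1.ne
  rw [← hOf_eq hφ] at he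
  have h3 := (betaOf_spec hdisc).2
  rw [← he, det_sub_smul _ _ hH.1.symm] at h3
  obtain ⟨d1, d2, d3⟩ := disk_det hH.1.symm h2
  nlinarith

theorem IsOptimal.ne_smul_one {P : BinaryCubic} {α : ℝ} (hα : 0 < α) (hμ : α < muOf P)
    {H : Mat2} (hH : IsOptimal P α H) :
    ¬(H 0 0 = α ∧ H 0 1 = 0 ∧ H 1 1 = α) := by
  rintro ⟨h1, h2, h3⟩
  have hμ0 := hα.trans hμ
  obtain ⟨z, hz⟩ := exists_isNearestPoint hμ0
  have h4 := one_le_quadAt_of_eval (hH.1.posDef hα) hH.1.cubic hz.1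
  have h5 := hz.muOf_mul hμ0
  simp only [quadAt, h1, h2, h3, hH.1.symm] at h4
  have : 0 < z 0 ^ 2 + z 1 ^ 2 := by
    by_contra! hle
    nlinarith
  nlinarith

/-- The eigenvectors for `α` are on one line, unless `H = α`. -/
theorem eigen_parallel {H : Mat2} (hs : H 1 0 = H 0 1) {α : ℝ}
    (hdisk : ∀ x y, α * (x ^ 2 + y ^ 2) ≤ quadAt H x y)
    (hne : ¬(H 0 0 = α ∧ H 0 1 = 0 ∧ H 1 1 = α)) {a b x y : ℝ}
    (hab : α * (a ^ 2 + b ^ 2) = quadAt H a b) (hxy : α * (x ^ 2 + y ^ 2) = quadAt H x y) :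
    a * y - x * b = 0 := by
  have hk : ∀ u v, α * (u ^ 2 + v ^ 2) = quadAt H u v →
      (H 0 0 - α) * u + H 0 1 * v = 0 ∧ H 0 1 * u + (H 1 1 - α) * v = 0 := by
    intro u v huv
    refine kernel_of_quadAt_eq_zero (fun x y => ?_) ?_
    · have := hdisk x y
      simp only [quadAt, hs] at this
      nlinarith
    · simp only [quadAt, hs] at huv
      linarith
  obtain ⟨k1, k2⟩ := hk _ _ hab
  obtain ⟨k3, k4⟩ := hk _ _ hxy
  by_contra hdet
  apply hne
  refine ⟨?_, ?_, ?_⟩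
  · have : (H 0 0 - α) * (a * y - x * b) = 0 := by linear_combination y * k1 - b * k3
    have := (mul_eq_zero.1 this).resolve_right hdet
    linarith
  · have : H 0 1 * (a * y - x * b) = 0 := by linear_combination a * k3 - x * k1
    exact (mul_eq_zero.1 this).resolve_right hdet
  · have : (H 1 1 - α) * (a * y - x * b) = 0 := by linear_combination a * k4 - x * k2
    have := (mul_eq_zero.1 this).resolve_right hdet
    linarith

theorem IsFrame.parallel {H ψ : Mat2} (h : IsFrame H ψ) {a b X Y : ℝ}
    (hp : (ψ 0 0 * a + ψ 0 1 * b) * (ψ 1 0 * X + ψ 1 1 * Y)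
      - (ψ 0 0 * X + ψ 0 1 * Y) * (ψ 1 0 * a + ψ 1 1 * b) = 0) : a * Y - X * b = 0 := by
  have hd := h.det_ne_zero
  rw [det_fin_two] at hd
  have : (ψ 0 0 * ψ 1 1 - ψ 0 1 * ψ 1 0) * (a * Y - X * b) = 0 := by linear_combination hp
  exact (mul_eq_zero.1 this).resolve_left hd

theorem exists_unit_eigenvector {H : Mat2} (hp : H.PosDef) {α : ℝ}
    (h : (H - α • (1 : Mat2)).det = 0) : ∃ a b : ℝ, quadAt H a b = 1 ∧
      α * (a ^ 2 + b ^ 2) = 1 ∧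
      H 0 0 * a + H 0 1 * b = α * a ∧ H 0 1 * a + H 1 1 * b = α * b := by
  obtain ⟨a, b, hab, e1, e2⟩ := exists_eigenvector hp.symm_apply h
  have hq := hp.quadAt_pos hab
  set c := (√(quadAt H a b))⁻¹ with hc
  have hc2 : c ^ 2 * quadAt H a b = 1 := by
    rw [hc, inv_pow, Real.sq_sqrt hq.le]
    field_simp
  have hα : quadAt H a b = α * (a ^ 2 + b ^ 2) := by
    simp only [quadAt, hp.symm_apply]
    linear_combination a * e1 + b * e2
  refine ⟨c * a, c * b, by rw [quadAt_smul_arg, hc2], ?_, ?_, ?_⟩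
  · rw [hα] at hc2
    linear_combination hc2
  · linear_combination c * e1
  · linear_combination c * e2

/-- If a contact point is conjugate to the major axis, then the ellipse is around the disc. -/
theorem around_of_conjugate {P : BinaryCubic} {α : ℝ} (hα : 0 < α) (hμ : α ≤ muOf P) {H ψ : Mat2}
    (hs : H 1 0 = H 0 1) (hψ : IsFrame H ψ) (ha : |(P.comp ψ).a| = 1)
    (e1 : H 0 0 * ψ 0 1 + H 0 1 * ψ 1 1 = α * ψ 0 1)
    (e2 : H 0 1 * ψ 0 1 + H 1 1 * ψ 1 1 = α * ψ 1 1) (x y : ℝ) :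
    quadAt H x y ≤ muOf P * (x ^ 2 + y ^ 2) := by
  obtain ⟨X, Y, rfl, rfl⟩ := exists_coords hψ.det_ne_zero x y
  rw [hψ.quadAt]
  have f01 := congrFun (congrFun hψ 0) 1
  have f11 := congrFun (congrFun hψ 1) 1
  simp [Matrix.mul_apply, Fin.sum_univ_two, hs] at f01 f11
  have horth : ψ 0 0 * ψ 0 1 + ψ 1 0 * ψ 1 1 = 0 := by
    have : α * (ψ 0 0 * ψ 0 1 + ψ 1 0 * ψ 1 1) = 0 := by
      linear_combination f01 - ψ 0 0 * e1 - ψ 1 0 * e2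
    exact (mul_eq_zero.1 this).resolve_left hα.ne'
  have hτ : α * (ψ 0 1 ^ 2 + ψ 1 1 ^ 2) = 1 := by
    linear_combination f11 - ψ 0 1 * e1 - ψ 1 1 * e2
  have hz := one_le_muOf_mul ha
  have hτ' : 1 ≤ muOf P * (ψ 0 1 ^ 2 + ψ 1 1 ^ 2) := by
    rw [← hτ]
    gcongr
  have e : muOf P * ((ψ 0 0 * X + ψ 0 1 * Y) ^ 2 + (ψ 1 0 * X + ψ 1 1 * Y) ^ 2)
      = (muOf P * (ψ 0 0 ^ 2 + ψ 1 0 ^ 2)) * X ^ 2 + (muOf P * (ψ 0 1 ^ 2 + ψ 1 1 ^ 2)) * Y ^ 2 := by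
    linear_combination 2 * muOf P * X * Y * horth
  rw [e]
  nlinarith [sq_nonneg X, sq_nonneg Y]

/-- A perturbation positive on the major axis produces a contact with the cubic. It cannot be
conjugate to that axis, for then the ellipse would contain the disc and `α_P ≤ α`. So a second
perturbation can be positive both there and on the major axis, and it produces another contact. -/
theorem IsOptimal.canonical_of_lt {P : BinaryCubic} {α : ℝ} (hα : 0 < α) (hβ : betaOf P ≤ α)
    (hlt : α < alphaOf P) {H : Mat2} (hH : IsOptimal P α H) :
    ∃ ψ t, IsFrame H ψ ∧ 1 / 2 ≤ t ∧ t < 1 ∧ P.comp ψ = canonicalCubic t := by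
  have hα' := hα.trans hlt
  have hμ0 := muOf_pos_of_alphaOf_pos hα'
  have hμ : α < muOf P := hlt.trans_le (alphaOf_le_muOf hμ0)
  have hp := hH.1.posDef hα
  have hc := hH.1.cubic
  have hs := hH.1.symm
  obtain ⟨a, b, q, hab, e1, e2⟩ := exists_unit_eigenvector hp (hH.det_sub_eq_zero hα hβ)
  have hne := hH.ne_smul_one hα hμ
  have hpar : ∀ x y, α * (x ^ 2 + y ^ 2) = quadAt H x y → a * y - x * b = 0 := fun x y h =>
    eigen_parallel hs hH.1.disk hne (by rw [hab, q]) h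
  obtain ⟨ψ₀, hψ₀, h00, h10, -⟩ := exists_isFrame_of_quadAt_eq_one hp q
  obtain ⟨X, Y, hXY, h1, h2⟩ := hH.exists_contact hψ₀ (k := 1) (l := 0) (Or.inl one_ne_zero)
  have hY : Y ≠ 0 := by
    rintro rfl
    norm_num at hXY h2
    rw [h2] at hXY
    norm_num at hXY
  have hq := hψ₀.quadAt X Y
  rw [hXY] at hq
  have hcontact : ((P.comp ψ₀).eval X Y) ^ 2 = 1 := by
    rcases h1 with h1 | h1
    · exact h1
    · exfalso
      have := hpar _ _ (by rw [h1, hq])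
      rw [← h00, ← h10] at this
      have := hψ₀.parallel (a := 1) (b := 0) (X := X) (Y := Y) (by simpa using this)
      simp at this
      exact hY this
  rw [eval_comp] at hcontact
  obtain ⟨e, -, q1, p1⟩ := signed_contact hq hcontact
  obtain ⟨ψ, hψ, -, -, ha, -⟩ := frame_at_contact hp q1 p1
  obtain ⟨v₁, v₂, hv1, hv2⟩ := exists_coords hψ.det_ne_zero a b
  have hv : v₁ ^ 2 + v₂ ^ 2 = 1 := by rw [← hψ.quadAt, ← hv1, ← hv2, q]
  by_cases hv0 : v₁ = 0
  · exfalso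
    subst hv0
    have hv2' : v₂ ≠ 0 := by rintro rfl; norm_num at hv
    have g1 : H 0 0 * ψ 0 1 + H 0 1 * ψ 1 1 = α * ψ 0 1 := by
      apply mul_left_cancel₀ hv2'
      rw [hv1, hv2] at e1
      linear_combination e1
    have g2 : H 0 1 * ψ 0 1 + H 1 1 * ψ 1 1 = α * ψ 1 1 := by
      apply mul_left_cancel₀ hv2'
      rw [hv1, hv2] at e2
      linear_combination e2
    have h3 := alphaOf_le_quadAt hα' hμ0 hp hc
      (around_of_conjugate hα hμ.le hs hψ (by rw [ha, abs_one]) g1 g2) a b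
    rw [q, ← hab] at h3
    have : 0 < a ^ 2 + b ^ 2 := by
      by_contra! h
      nlinarith
    nlinarith
  -- With this `l` the perturbation equals `X ^ 2` on the first axis, which carries the known
  -- contact, and on the line of the major axis.
  · obtain ⟨X', Y', hXY', h1', h2'⟩ := hH.exists_contact hψ (k := 1) (l := v₂ / (2 * v₁))
      (Or.inl one_ne_zero)
    have hY' : Y' ≠ 0 := by
      rintro rfl
      norm_num at hXY' h2'
      rw [h2'] at hXY'
      norm_num at hXY'
    rcases h1' with h1' | h1'
    · exact canonical_of_contacts hp hc hψ ha hXY' hY' h1'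
    · exfalso
      have := hpar _ _ (by rw [h1', hψ.quadAt, hXY'])
      rw [hv1, hv2] at this
      have hpl := hψ.parallel (a := v₁) (b := v₂) (X := X') (Y := Y') this
      have hX0 : X' ≠ 0 := by
        rintro rfl
        have : v₁ * Y' = 0 := by linarith
        rcases mul_eq_zero.1 this with h | h
        · exact hv0 h
        · exact hY' h
      have hK : 1 * (X' ^ 2 - Y' ^ 2) + 2 * (v₂ / (2 * v₁)) * X' * Y' = X' ^ 2 := by
        field_simp
        linear_combination -Y' * hpl
      rw [hK] at h2'
      have : 0 < X' ^ 2 := by positivity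
      linarith

theorem toLp_mem_tangencyPoints {P : BinaryCubic} {H : Mat2} (hp : H.PosDef) (hc : CubicLe P H)
    {x y : ℝ} (hq : quadAt H x y = 1) (he : (P.eval x y) ^ 2 = 1) :
    (!₂[x, y] : Plane) ∈ tangencyPoints P H := by
  rw [mem_tangencyPoints_iff hp hc]
  refine ⟨by simpa using hq, ?_⟩
  simp only [Matrix.cons_val_zero, Matrix.cons_val_one]
  rcases sq_eq_one_iff.1 he with h | h <;> simp [h]

theorem isQuadriTangent_of_canonical {P : BinaryCubic} {H ψ : Mat2} (hp : H.PosDef)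
    (hc : CubicLe P H) (h : IsFrame H ψ) {t : ℝ} (ht0 : 0 < t) (ht1 : t < 1)
    (hcan : P.comp ψ = canonicalCubic t) : IsQuadriTangent P H := by
  have h1 : 0 < 1 - t ^ 2 := by nlinarith
  have hs := Real.sqrt_pos.2 h1
  have hs2 := Real.sq_sqrt h1.le
  set s := √(1 - t ^ 2)
  have hmem : ∀ u, u ^ 2 = s ^ 2 →
      (!₂[ψ 0 0 * t + ψ 0 1 * u, ψ 1 0 * t + ψ 1 1 * u] : Plane) ∈ tangencyPoints P H := by
    intro u hu
    apply toLp_mem_tangencyPoints hp hc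
    · rw [h.quadAt, hu, hs2]; ring
    · rw [← eval_comp, hcan, eval_canonicalCubic, hu, hs2]
      field_simp
      ring
  refine isQuadriTangent_of_two hp hc (hmem s rfl) (hmem (-s) (by ring)) ?_
  have hd := h.det_ne_zero
  rw [det_fin_two] at hd
  simp only [Matrix.cons_val_zero, Matrix.cons_val_one]
  intro h0
  have : (ψ 0 0 * ψ 1 1 - ψ 0 1 * ψ 1 0) * (t * s) = 0 := by linear_combination (-1 / 2) * h0
  rcases mul_eq_zero.1 this with h | h
  · exact hd h
  · exact (mul_pos ht0 hs).ne' h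

/-- This is the quotient from `coeffs_of_contact`, homogenized so that it can be minimized over the
whole circle. -/
theorem one_sub_eval_sq {Q : BinaryCubic} (ha : Q.a = 1) (hb : Q.b = 0) {X Y : ℝ}
    (h : X ^ 2 + Y ^ 2 = 1) : 1 - (Q.eval X Y) ^ 2 = Y ^ 2 * ((3 - 2 * Q.c) * X ^ 4
      - 2 * Q.d * X ^ 3 * Y + (3 - Q.c ^ 2) * X ^ 2 * Y ^ 2 - 2 * Q.c * Q.d * X * Y ^ 3
      + (1 - Q.d ^ 2) * Y ^ 4) := by
  have h3 : (X ^ 2 + Y ^ 2) ^ 3 = 1 := by rw [h, one_pow]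
  simp only [BinaryCubic.eval, ha, hb]
  linear_combination -h3

/-- A cubic that touches the unit circle at `(±1, 0)` only, to the lowest order, leaves room. -/
theorem exists_shrink {Q : BinaryCubic} (ha : Q.a = 1) (hb : Q.b = 0) (hc : Q.c < 3 / 2)
    (hle : ∀ X Y, X ^ 2 + Y ^ 2 = 1 → Y ≠ 0 → (Q.eval X Y) ^ 2 < 1) :
    ∃ ε, 0 < ε ∧ ε < 1 ∧ CubicLe Q (Matrix.diagonal ![1, 1 - ε]) := by
  have hform := fun X Y h => one_sub_eval_sq ha hb (X := X) (Y := Y) h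
  set q₀ : ℝ → ℝ → ℝ := fun X Y => (3 - 2 * Q.c) * X ^ 4 - 2 * Q.d * X ^ 3 * Y
    + (3 - Q.c ^ 2) * X ^ 2 * Y ^ 2 - 2 * Q.c * Q.d * X * Y ^ 3 + (1 - Q.d ^ 2) * Y ^ 4 with hq₀
  replace hform : ∀ X Y, X ^ 2 + Y ^ 2 = 1 → 1 - (Q.eval X Y) ^ 2 = Y ^ 2 * q₀ X Y := hform
  have hpos : ∀ X Y, X ^ 2 + Y ^ 2 = 1 → 0 < q₀ X Y := by
    intro X Y hXY
    by_cases hY : Y = 0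
    · subst hY
      have hX : X ^ 2 = 1 := by linarith
      have : q₀ X 0 = (3 - 2 * Q.c) * (X ^ 2) ^ 2 := by simp only [hq₀]; ring
      rw [this, hX]
      linarith
    · have h2 : 0 < Y ^ 2 := by positivity
      have h3 := hform X Y hXY
      have h4 := hle X Y hXY hY
      exact pos_of_mul_pos_right (by linarith : 0 < Y ^ 2 * q₀ X Y) h2.le
  have hcont : Continuous fun p : ℝ × ℝ => q₀ p.1 p.2 := by
    simp only [hq₀]
    fun_prop
  obtain ⟨p₀, hp₀, hmin⟩ := isCompact_unit_circle.exists_isMinOn ⟨(1, 0), by simp⟩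
    hcont.continuousOn
  have hδ := hpos p₀.1 p₀.2 hp₀
  replace hmin : ∀ X Y, X ^ 2 + Y ^ 2 = 1 → q₀ p₀.1 p₀.2 ≤ q₀ X Y :=
    fun X Y h => hmin (a := (X, Y)) h
  generalize q₀ p₀.1 p₀.2 = δ at hδ hmin
  -- The factor `3` comes from `(1 - s) ^ 3 ≥ 1 - 3 s` with `s = ε Y ^ 2`.
  have hε1 : min (δ / 3) (1 / 2) ≤ δ / 3 := min_le_left _ _
  have hε2 : min (δ / 3) (1 / 2) ≤ 1 / 2 := min_le_right _ _
  have hε0 : 0 < min (δ / 3) (1 / 2) := lt_min (by positivity) (by norm_num)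
  generalize min (δ / 3) (1 / 2) = ε at hε0 hε1 hε2
  refine ⟨ε, hε0, by linarith, cubicLe_of_unit fun X Y hXY => ?_⟩
  have h3 := hform X Y hXY
  have h5 : Y ^ 2 * (3 * ε) ≤ Y ^ 2 * q₀ X Y :=
    mul_le_mul_of_nonneg_left (by linarith [hmin X Y hXY]) (sq_nonneg Y)
  rw [quadAt_diagonal]
  have e1 : 1 * X ^ 2 + (1 - ε) * Y ^ 2 = 1 - ε * Y ^ 2 := by linear_combination hXY
  rw [e1]
  have h6 : 0 ≤ ε * Y ^ 2 := by positivity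
  have h7 : ε * Y ^ 2 ≤ 1 := by nlinarith [sq_nonneg X]
  have h8 : 0 ≤ (ε * Y ^ 2) ^ 2 * (3 - ε * Y ^ 2) := mul_nonneg (sq_nonneg _) (by linarith)
  linarith

/-- The largest ellipse around the disc is quadri-tangent. -/
theorem isQuadriTangent_alignedMatrix {P : BinaryCubic} (hα : 0 < alphaOf P) {z : Plane}
    (hz : IsNearestPoint P z) :
    IsQuadriTangent P (alignedMatrix z (muOf P) (alphaOf P)) := by
  have hμ := muOf_pos_of_alphaOf_pos hα
  have hαμ := alphaOf_le_muOf hμ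
  have hn := hz.norm_pos hμ
  have hp := alignedMatrix_posDef hn hα hαμ
  have hc := (feasible_alignedMatrix hα le_rfl hαμ hz).cubic
  have hle := alignedMatrix_le hn hαμ
  have hv := quadAt_alignedMatrix hn (muOf P) (alphaOf P) (-z 1) (z 0)
  have hn2 := norm_sq_eq z
  set H := alignedMatrix z (muOf P) (alphaOf P) with hH
  by_contra hq
  have hz1 : quadAt H (z 0) (z 1) = 1 :=
    le_antisymm ((hle _ _).trans (hz.muOf_mul hμ).le) (one_le_quadAt_of_eval hp hc hz.1)
  obtain ⟨e, he, q1, p1⟩ := signed_contact hz1 (P := P) (by rw [← sq_abs, hz.1, one_pow])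
  obtain ⟨ψ, hψ, h00, h10, ha, hcurv⟩ := frame_at_contact hp q1 p1
  have hle1 := hψ.comp_le hc
  obtain ⟨hb, hc1, -⟩ := coeffs_of_contact hle1 ha
  have hc2 : (P.comp ψ).c < 3 / 2 := by
    refine hc1.lt_of_ne fun h => hq ?_
    refine isQuadriTangent_of_osculation hp hc (z := !₂[e * z 0, e * z 1])
      ⟨toLp_mem_tangencyPoints hp hc q1 (by rw [p1, one_pow]), ?_⟩
    simpa using (hcurv hc).1 h
  -- Without a second contact direction or an osculation, the form can be lowered away from the
  -- contact; the new ellipse is inscribed and still contains the disc.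
  obtain ⟨ε, hε0, hε1, hDc⟩ := exists_shrink ha hb hc2 (by
    intro X Y hXY hY
    have h4 := hle1 X Y
    rw [hXY, one_pow] at h4
    refine h4.lt_of_ne fun h5 => hq ?_
    refine isQuadriTangent_of_two hp hc
      (toLp_mem_tangencyPoints hp hc (hψ.quadAt 1 0 |>.trans (by norm_num)) (by
        rw [← eval_comp]; simp [BinaryCubic.eval, ha]))
      (toLp_mem_tangencyPoints hp hc (hψ.quadAt X Y |>.trans hXY) (by rw [← eval_comp, h5])) ?_
    simp only [Matrix.cons_val_zero, Matrix.cons_val_one]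
    intro h0
    have := hψ.parallel h0
    simp at this
    exact hY this)
  have hD : (Matrix.diagonal ![1, 1 - ε] : Mat2).PosDef := diagonal_posDef one_pos (by linarith)
  have hd := hψ.det_ne_zero
  have hlow : ∀ X Y, quadAt (transport ψ (Matrix.diagonal ![1, 1 - ε]))
      (ψ 0 0 * X + ψ 0 1 * Y) (ψ 1 0 * X + ψ 1 1 * Y)
      = quadAt H (ψ 0 0 * X + ψ 0 1 * Y) (ψ 1 0 * X + ψ 1 1 * Y) - ε * Y ^ 2 := by
    intro X Y
    rw [quadAt_transport hd, quadAt_diagonal, hψ.quadAt]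
    ring
  have hmain := alphaOf_le_quadAt hα hμ (transport_posDef hd hD) (cubicLe_transport hd hDc)
    (by
      intro x y
      obtain ⟨X, Y, rfl, rfl⟩ := exists_coords hd x y
      rw [hlow]
      have := hle (ψ 0 0 * X + ψ 0 1 * Y) (ψ 1 0 * X + ψ 1 1 * Y)
      have : 0 ≤ ε * Y ^ 2 := by positivity
      linarith) (-z 1) (z 0)
  have hv' : quadAt H (-z 1) (z 0) = alphaOf P * ((-z 1) ^ 2 + z 0 ^ 2) := by
    apply mul_left_cancel₀ (pow_pos hn 2).ne'
    rw [hv, hn2]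
    ring
  obtain ⟨X, Y, hX, hY⟩ := exists_coords hd (-z 1) (z 0)
  rw [← hv', hX, hY, hlow] at hmain
  -- The quarter turn of `z` is an eigenvector for `α_P`, where the form cannot be lowered; so it
  -- would have to be parallel to `z`.
  have hY0 : Y = 0 := by
    by_contra h
    have : 0 < ε * Y ^ 2 := by positivity
    linarith
  subst hY0
  rw [h00] at hX
  rw [h10] at hY
  have h0 : z 0 ^ 2 + z 1 ^ 2 = 0 := by linear_combination z 0 * hY - z 1 * hX
  rw [← hn2] at h0
  exact (pow_pos hn 2).ne' h0

/-- The perturbation argument needs `α < α_P`; the endpoint is covered by the largest ellipse around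
the disc. -/
theorem IsOptimal.mem_quadriTangentFamily {P : BinaryCubic} {α : ℝ} (hα : 0 < α)
    (hβ : betaOf P ≤ α) (hle : α ≤ alphaOf P) {H : Mat2} (hH : IsOptimal P α H) :
    H ∈ quadriTangentFamily P α := by
  have hp := hH.1.posDef hα
  have hc := hH.1.cubic
  refine ⟨(isInscribed_iff _ _).2 ⟨hp, hc⟩, ?_,
    (diam_ellipse_eq_iff hp hα).2 ⟨hH.1.disk, hH.det_sub_eq_zero hα hβ⟩⟩
  rcases hle.lt_or_eq with h | rfl
  · obtain ⟨ψ, t, hψ, ht0, ht1, hcan⟩ := hH.canonical_of_lt hα hβ h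
    exact isQuadriTangent_of_canonical hp hc hψ (by linarith) ht1 hcan
  · have hμ := muOf_pos_of_alphaOf_pos hα
    obtain ⟨z, hz⟩ := exists_isNearestPoint hμ
    rw [hH.eq_alignedMatrix hα le_rfl (alphaOf_le_muOf hμ) hz]
    exact isQuadriTangent_alignedMatrix hα hz

theorem mem_quadriTangentFamily_iff {P : BinaryCubic} {α : ℝ} (hα : 0 < α) {H : Mat2} :
    H ∈ quadriTangentFamily P α ↔
      Feasible P α H ∧ IsQuadriTangent P H ∧ (H - α • (1 : Mat2)).det = 0 := by
  rw [feasible_iff hα]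
  constructor
  · rintro ⟨h1, h2, h3⟩
    exact ⟨⟨h1, h3.le⟩, h2, ((diam_ellipse_eq_iff ((isInscribed_iff _ _).1 h1).1 hα).1 h3).2⟩
  · rintro ⟨⟨h1, h3⟩, h2, h4⟩
    have hp := ((isInscribed_iff _ _).1 h1).1
    exact ⟨h1, h2, (diam_ellipse_eq_iff hp hα).2 ⟨(diam_ellipse_le_iff hp hα).1 h3, h4⟩⟩

/-! ### The families of the third regime -/

/-- Squared length of the first column; `colSq₁` is that of the second column, and `colInner` the
inner product of the columns. -/
def colSq₀ (φ : Mat2) : ℝ := φ 0 0 ^ 2 + φ 1 0 ^ 2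

def colSq₁ (φ : Mat2) : ℝ := φ 0 1 ^ 2 + φ 1 1 ^ 2

def colInner (φ : Mat2) : ℝ := φ 0 0 * φ 0 1 + φ 1 0 * φ 1 1

theorem colSq_mul_sub (φ : Mat2) : colSq₀ φ * colSq₁ φ - colInner φ ^ 2 = φ.det ^ 2 := by
  simp only [colSq₀, colSq₁, colInner, det_fin_two]
  ring

theorem colSq₁_pos {φ : Mat2} (hd : φ.det ≠ 0) : 0 < colSq₁ φ := by
  have h1 := colSq_mul_sub φ
  have h2 : 0 < φ.det ^ 2 := by positivity
  have h3 : 0 ≤ colSq₁ φ := by unfold colSq₁; positivity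
  refine h3.lt_of_ne fun h => ?_
  rw [← h] at h1
  nlinarith [sq_nonneg (colInner φ)]

/-- Pulling back by `φ` replaces the identity by the Gram matrix of the columns, so the eigenvalue
condition becomes polynomial in the diagonal entries. -/
theorem det_transport_diagonal_sub {φ : Mat2} (hd : φ.det ≠ 0) (a b α : ℝ) :
    φ.det ^ 2 * (transport φ (Matrix.diagonal ![a, b]) - α • (1 : Mat2)).det
      = a * b - α * (a * colSq₁ φ + b * colSq₀ φ)
        + α ^ 2 * (colSq₀ φ * colSq₁ φ - colInner φ ^ 2) := by
  have h : φᵀ * (transport φ (Matrix.diagonal ![a, b]) - α • (1 : Mat2)) * φ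
      = !![a - α * colSq₀ φ, -(α * colInner φ); -(α * colInner φ), b - α * colSq₁ φ] := by
    rw [Matrix.mul_sub, Matrix.sub_mul, congr_transport hd]
    ext i j
    fin_cases i <;> fin_cases j <;>
      simp [colSq₀, colSq₁, colInner, Matrix.mul_apply, Fin.sum_univ_two] <;>
      first | ring1 | (left; ring1)
  have h2 := congrArg Matrix.det h
  rw [det_mul, det_mul, det_transpose, det_fin_two_of] at h2
  linear_combination h2

theorem disk_transport_diagonal {φ : Mat2} (hd : φ.det ≠ 0) {a b α : ℝ}
    (h : ∀ x y, α * (x ^ 2 + y ^ 2) ≤ quadAt (transport φ (Matrix.diagonal ![a, b])) x y) :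
    α * colSq₀ φ ≤ a ∧ α * colSq₁ φ ≤ b := by
  have h0 := h (φ 0 0 * 1 + φ 0 1 * 0) (φ 1 0 * 1 + φ 1 1 * 0)
  have h1 := h (φ 0 0 * 0 + φ 0 1 * 1) (φ 1 0 * 0 + φ 1 1 * 1)
  rw [quadAt_transport hd, quadAt_diagonal] at h0 h1
  norm_num at h0 h1
  exact ⟨h0, h1⟩

theorem transport_diagonal_inj {φ : Mat2} (hd : φ.det ≠ 0) {a b a' b' : ℝ}
    (h : transport φ (Matrix.diagonal ![a, b]) = transport φ (Matrix.diagonal ![a', b'])) :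
    a = a' ∧ b = b' := by
  have h1 := (transport_eq_iff hd).1 h
  rw [congr_transport hd] at h1
  exact ⟨by simpa using congrFun (congrFun h1 0) 0, by simpa using congrFun (congrFun h1 1) 1⟩

theorem familyNeg_inj {φ : Mat2} (hd : φ.det ≠ 0) {l l' : ℝ} (h : familyNeg φ l = familyNeg φ l') :
    l = l' := (transport_diagonal_inj hd h).2

theorem familyZero_inj {φ : Mat2} (hd : φ.det ≠ 0) {l l' : ℝ}
    (h : familyZero φ l = familyZero φ l') : l = l' := (transport_diagonal_inj hd h).1

theorem familyNeg_quartic {φ : Mat2} (hd : φ.det ≠ 0) {l α : ℝ} (hl : 0 < l)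
    (h : (familyNeg φ l - α • (1 : Mat2)).det = 0) :
    l ^ 4 + -(α * (colSq₁ φ + 3 * colSq₀ φ)) * l ^ 3 + 3 * (α * φ.det) ^ 2 * l ^ 2 + 4 * l
      + -(4 * (α * colSq₁ φ)) = 0 := by
  have h1 := det_transport_diagonal_sub hd ((4 + l ^ 3) / (3 * l ^ 2)) l α
  rw [colSq_mul_sub] at h1
  rw [familyNeg] at h
  rw [h, mul_zero] at h1
  field_simp at h1
  linear_combination -h1

theorem familyZero_cubic {φ : Mat2} (hd : φ.det ≠ 0) {l α : ℝ} (hl : 0 < l)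
    (h : (familyZero φ l - α • (1 : Mat2)).det = 0) :
    -(27 * (α * colSq₁ φ)) * l ^ 3 + 27 * (α * φ.det) ^ 2 * l ^ 2 + 4 * l
      + -(4 * (α * colSq₀ φ)) = 0 := by
  have h1 := det_transport_diagonal_sub hd l (4 / (27 * l ^ 2)) α
  rw [colSq_mul_sub] at h1
  rw [familyZero] at h
  rw [h, mul_zero] at h1
  field_simp at h1
  linear_combination -h1

theorem familyPos_eq (φ : Mat2) {V : Mat2} (hV : V ∈ threeRotations) (l : ℝ) :
    familyPos φ V l
      = transport (φ * Vᵀ) (Matrix.diagonal ![(4 - l ^ 3) / (3 * l ^ 2), l]) := by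
  have h : Vᵀ⁻¹ = V :=
    Matrix.inv_eq_left_inv (mul_eq_one_comm.1 (threeRotations_orthogonal hV))
  have h2 : ∀ D, transport Vᵀ D = Vᵀ * D * V := fun D => by rw [transport, h]
  rw [familyPos, transport_mul, h2]

theorem det_mul_rotation (φ : Mat2) {V : Mat2} (hV : V ∈ threeRotations) :
    (φ * Vᵀ).det ^ 2 = φ.det ^ 2 := by
  have h := congrArg Matrix.det (threeRotations_orthogonal hV)
  rw [det_mul, det_transpose, det_one] at h
  rw [det_mul, det_transpose]
  linear_combination φ.det ^ 2 * h

theorem familyPos_quartic {φ V : Mat2} (hd : φ.det ≠ 0) (hV : V ∈ threeRotations) {l α : ℝ}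
    (hl : 0 < l) (h : (familyPos φ V l - α • (1 : Mat2)).det = 0) :
    l ^ 4 + -(α * (colSq₁ (φ * Vᵀ) - 3 * colSq₀ (φ * Vᵀ))) * l ^ 3 + -(3 * (α * φ.det) ^ 2) * l ^ 2
      + -4 * l + 4 * (α * colSq₁ (φ * Vᵀ)) = 0 := by
  have hd2 := det_mul_rotation φ hV
  have hd' : (φ * Vᵀ).det ≠ 0 := by
    intro h0
    rw [h0] at hd2
    have : 0 < φ.det ^ 2 := by positivity
    linarith
  have h1 := det_transport_diagonal_sub hd' ((4 - l ^ 3) / (3 * l ^ 2)) l α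
  rw [colSq_mul_sub, hd2] at h1
  rw [familyPos_eq φ hV] at h
  rw [h, mul_zero] at h1
  field_simp at h1
  linear_combination h1

theorem colSq_add (φ : Mat2) {V : Mat2} (hV : V ∈ threeRotations) :
    colSq₀ (φ * Vᵀ) + colSq₁ (φ * Vᵀ) = colSq₀ φ + colSq₁ φ := by
  have h3 : √3 ^ 2 = 3 := Real.sq_sqrt (by norm_num)
  rcases (mem_threeRotations_iff V).1 hV with rfl | rfl | rfl
  · simp
  · simp [colSq₀, colSq₁, Matrix.mul_apply, Fin.sum_univ_two]
    linear_combination (φ 0 0 ^ 2 + φ 0 1 ^ 2 + φ 1 0 ^ 2 + φ 1 1 ^ 2) / 4 * h3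
  · simp [colSq₀, colSq₁, Matrix.mul_apply, Fin.sum_univ_two]
    linear_combination (φ 0 0 ^ 2 + φ 0 1 ^ 2 + φ 1 0 ^ 2 + φ 1 1 ^ 2) / 4 * h3

/-- The difference of the squared lengths of the columns, for the three rotated matrices. -/
theorem colSq_sub_rotations (φ : Mat2) :
    (colSq₀ (φ * (!![1 / 2, -(√3 / 2); √3 / 2, 1 / 2] : Mat2)ᵀ)
        - colSq₁ (φ * (!![1 / 2, -(√3 / 2); √3 / 2, 1 / 2] : Mat2)ᵀ)
      = -(colSq₀ φ - colSq₁ φ) / 2 - √3 * colInner φ) ∧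
    (colSq₀ (φ * (!![-1 / 2, -(√3 / 2); √3 / 2, -1 / 2] : Mat2)ᵀ)
        - colSq₁ (φ * (!![-1 / 2, -(√3 / 2); √3 / 2, -1 / 2] : Mat2)ᵀ)
      = -(colSq₀ φ - colSq₁ φ) / 2 + √3 * colInner φ) := by
  have h3 : √3 ^ 2 = 3 := Real.sq_sqrt (by norm_num)
  constructor
  · simp [colSq₀, colSq₁, colInner, Matrix.mul_apply, Fin.sum_univ_two]
    linear_combination (φ 0 1 ^ 2 + φ 1 1 ^ 2 - φ 0 0 ^ 2 - φ 1 0 ^ 2) / 4 * h3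
  · simp [colSq₀, colSq₁, colInner, Matrix.mul_apply, Fin.sum_univ_two]
    linear_combination (φ 0 1 ^ 2 + φ 1 1 ^ 2 - φ 0 0 ^ 2 - φ 1 0 ^ 2) / 4 * h3

/-- The three differences behave like `R` times cosines of angles 120 degrees apart: their sum is
zero and the sum of their squares is `3 / 2 * R ^ 2`. -/
theorem exists_third_rotation (φ : Mat2) {V₁ V₂ : Mat2} (h₁ : V₁ ∈ threeRotations)
    (h₂ : V₂ ∈ threeRotations) (hne : V₁ ≠ V₂) : ∃ V₃ ∈ threeRotations,
    (colSq₀ (φ * V₁ᵀ) - colSq₁ (φ * V₁ᵀ)) + (colSq₀ (φ * V₂ᵀ) - colSq₁ (φ * V₂ᵀ))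
      + (colSq₀ (φ * V₃ᵀ) - colSq₁ (φ * V₃ᵀ)) = 0 ∧
    (colSq₀ (φ * V₁ᵀ) - colSq₁ (φ * V₁ᵀ)) ^ 2 + (colSq₀ (φ * V₂ᵀ) - colSq₁ (φ * V₂ᵀ)) ^ 2
      + (colSq₀ (φ * V₃ᵀ) - colSq₁ (φ * V₃ᵀ)) ^ 2
      = 3 / 2 * ((colSq₀ φ + colSq₁ φ) ^ 2 - 4 * φ.det ^ 2) := by
  obtain ⟨e1, e2⟩ := colSq_sub_rotations φ
  have h3 : √3 ^ 2 = 3 := Real.sq_sqrt (by norm_num)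
  have m1 := one_mem_threeRotations
  have m2 := (mem_threeRotations_iff _).2 (Or.inr (Or.inl rfl))
  have m3 := (mem_threeRotations_iff _).2 (Or.inr (Or.inr rfl))
  have hdet := colSq_mul_sub φ
  rcases (mem_threeRotations_iff V₁).1 h₁ with rfl | rfl | rfl <;>
    rcases (mem_threeRotations_iff V₂).1 h₂ with rfl | rfl | rfl
  all_goals first
    | exact absurd rfl hne
    | refine ⟨_, m1, ?_⟩
      rw [e1, e2, transpose_one, mul_one]
      exact ⟨by ring, by linear_combination 2 * colInner φ ^ 2 * h3 - 6 * hdet⟩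
    | refine ⟨_, m2, ?_⟩
      rw [e1, e2, transpose_one, mul_one]
      exact ⟨by ring, by linear_combination 2 * colInner φ ^ 2 * h3 - 6 * hdet⟩
    | refine ⟨_, m3, ?_⟩
      rw [e1, e2, transpose_one, mul_one]
      exact ⟨by ring, by linear_combination 2 * colInner φ ^ 2 * h3 - 6 * hdet⟩

/-! ### Numbers of roots -/

theorem encard_le_two_of {β : Type*} {s : Set β}
    (h : ∀ a ∈ s, ∀ b ∈ s, ∀ c ∈ s, a ≠ b → a ≠ c → b ≠ c → False) : s.encard ≤ 2 := by
  by_contra! hc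
  obtain ⟨t, ht, hcard⟩ := Set.exists_subset_encard_eq (Order.add_one_le_of_lt hc)
  obtain ⟨a, b, c, h1, h2, h3, rfl⟩ := Set.encard_eq_three.1 (hcard.trans (by norm_num))
  exact h a (ht (by simp)) b (ht (by simp)) c (ht (by simp)) h1 h2 h3

/-- Repeated divided differences express the coefficients through three distinct roots; the fourth
root is then real. -/
theorem quartic_vieta {p q s k r₁ r₂ r₃ : ℝ} (h12 : r₁ ≠ r₂) (h13 : r₁ ≠ r₃) (h23 : r₂ ≠ r₃)
    (h₁ : r₁ ^ 4 + p * r₁ ^ 3 + q * r₁ ^ 2 + s * r₁ + k = 0)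
    (h₂ : r₂ ^ 4 + p * r₂ ^ 3 + q * r₂ ^ 2 + s * r₂ + k = 0)
    (h₃ : r₃ ^ 4 + p * r₃ ^ 3 + q * r₃ ^ 2 + s * r₃ + k = 0) :
    ∃ r₄, q = r₁ * r₂ + r₁ * r₃ + r₂ * r₃ + r₄ * (r₁ + r₂ + r₃) ∧ k = r₁ * r₂ * r₃ * r₄ ∧
      ∀ x : ℝ, x ^ 4 + p * x ^ 3 + q * x ^ 2 + s * x + k
        = (x - r₁) * (x - r₂) * (x - r₃) * (x - r₄) := by
  have d12 : (r₁ ^ 3 + r₁ ^ 2 * r₂ + r₁ * r₂ ^ 2 + r₂ ^ 3) + p * (r₁ ^ 2 + r₁ * r₂ + r₂ ^ 2)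
      + q * (r₁ + r₂) + s = 0 := by
    apply mul_left_cancel₀ (sub_ne_zero.2 h12)
    linear_combination h₁ - h₂
  have d13 : (r₁ ^ 3 + r₁ ^ 2 * r₃ + r₁ * r₃ ^ 2 + r₃ ^ 3) + p * (r₁ ^ 2 + r₁ * r₃ + r₃ ^ 2)
      + q * (r₁ + r₃) + s = 0 := by
    apply mul_left_cancel₀ (sub_ne_zero.2 h13)
    linear_combination h₁ - h₃
  have d : (r₁ ^ 2 + r₂ ^ 2 + r₃ ^ 2 + r₁ * r₂ + r₁ * r₃ + r₂ * r₃) + p * (r₁ + r₂ + r₃) + q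
      = 0 := by
    apply mul_left_cancel₀ (sub_ne_zero.2 h23)
    linear_combination d12 - d13
  have hq : q = r₁ * r₂ + r₁ * r₃ + r₂ * r₃ + (-p - r₁ - r₂ - r₃) * (r₁ + r₂ + r₃) := by
    linear_combination d
  have hs : s = -(r₁ * r₂ * r₃ + (-p - r₁ - r₂ - r₃) * (r₁ * r₂ + r₁ * r₃ + r₂ * r₃)) := by
    rw [hq] at d12
    linear_combination d12
  have hk : k = r₁ * r₂ * r₃ * (-p - r₁ - r₂ - r₃) := by
    rw [hq, hs] at h₁
    linear_combination h₁
  refine ⟨_, hq, hk, fun x => ?_⟩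
  rw [hs, hk, hq]
  ring

/-- Three positive roots and a negative product force the fourth root to be negative. -/
theorem encard_quartic_le_three {p q s k : ℝ} (hk : k < 0) :
    {l : ℝ | 0 < l ∧ l ^ 4 + p * l ^ 3 + q * l ^ 2 + s * l + k = 0}.encard ≤ 3 := by
  by_contra! hc
  obtain ⟨t, ht, hcard⟩ := Set.exists_subset_encard_eq hc.le
  obtain ⟨r₁, r₂, r₃, h1, h2, h3, rfl⟩ := Set.encard_eq_three.1 hcard
  obtain ⟨p1, e1⟩ := ht (show r₁ ∈ _ by simp)
  obtain ⟨p2, e2⟩ := ht (show r₂ ∈ _ by simp)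
  obtain ⟨p3, e3⟩ := ht (show r₃ ∈ _ by simp)
  obtain ⟨r₄, -, hk4, hfac⟩ := quartic_vieta h1 h2 h3 e1 e2 e3
  have h4 : r₄ < 0 := by
    by_contra! h
    have : 0 ≤ r₁ * r₂ * r₃ * r₄ := by positivity
    linarith
  refine absurd (Set.encard_le_encard (t := {r₁, r₂, r₃}) ?_) (not_le.2 (hcard ▸ hc))
  rintro x ⟨hx, hx0⟩
  rw [hfac] at hx0
  have : x - r₄ ≠ 0 := by linarith [hx, h4] |> fun h : 0 < x - r₄ => h.ne'
  rcases mul_eq_zero.1 ((mul_eq_zero.1 hx0).resolve_right this) with h | h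
  · rcases mul_eq_zero.1 h with h | h
    · simp [sub_eq_zero.1 h]
    · simp [sub_eq_zero.1 h]
  · simp [sub_eq_zero.1 h]

/-- Three positive roots and a positive product make the fourth root positive, so the second
symmetric function cannot be negative. -/
theorem quartic_no_three_roots {p q s k r₁ r₂ r₃ : ℝ} (hq : q < 0) (hk : 0 < k)
    (p1 : 0 < r₁) (p2 : 0 < r₂) (p3 : 0 < r₃) (h12 : r₁ ≠ r₂) (h13 : r₁ ≠ r₃) (h23 : r₂ ≠ r₃)
    (h₁ : r₁ ^ 4 + p * r₁ ^ 3 + q * r₁ ^ 2 + s * r₁ + k = 0)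
    (h₂ : r₂ ^ 4 + p * r₂ ^ 3 + q * r₂ ^ 2 + s * r₂ + k = 0)
    (h₃ : r₃ ^ 4 + p * r₃ ^ 3 + q * r₃ ^ 2 + s * r₃ + k = 0) : False := by
  obtain ⟨r₄, hq4, hk4, -⟩ := quartic_vieta h12 h13 h23 h₁ h₂ h₃
  have h4 : 0 < r₄ := by
    rw [hk4] at hk
    exact pos_of_mul_pos_right hk (by positivity)
  have : 0 < r₁ * r₂ + r₁ * r₃ + r₂ * r₃ + r₄ * (r₁ + r₂ + r₃) := by positivity
  linarith

theorem cubic_no_three_roots {a b c d r₁ r₂ r₃ : ℝ} (ha : a < 0) (hc : 0 < c)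
    (p1 : 0 < r₁) (p2 : 0 < r₂) (p3 : 0 < r₃) (h12 : r₁ ≠ r₂) (h13 : r₁ ≠ r₃) (h23 : r₂ ≠ r₃)
    (h₁ : a * r₁ ^ 3 + b * r₁ ^ 2 + c * r₁ + d = 0)
    (h₂ : a * r₂ ^ 3 + b * r₂ ^ 2 + c * r₂ + d = 0)
    (h₃ : a * r₃ ^ 3 + b * r₃ ^ 2 + c * r₃ + d = 0) : False := by
  have d12 : a * (r₁ ^ 2 + r₁ * r₂ + r₂ ^ 2) + b * (r₁ + r₂) + c = 0 := by
    apply mul_left_cancel₀ (sub_ne_zero.2 h12)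
    linear_combination h₁ - h₂
  have d13 : a * (r₁ ^ 2 + r₁ * r₃ + r₃ ^ 2) + b * (r₁ + r₃) + c = 0 := by
    apply mul_left_cancel₀ (sub_ne_zero.2 h13)
    linear_combination h₁ - h₃
  have dd : a * (r₁ + r₂ + r₃) + b = 0 := by
    apply mul_left_cancel₀ (sub_ne_zero.2 h23)
    linear_combination d12 - d13
  have : c = a * (r₁ * r₂ + r₁ * r₃ + r₂ * r₃) := by
    linear_combination d12 - (r₁ + r₂) * dd
  have h : 0 < r₁ * r₂ + r₁ * r₃ + r₂ * r₃ := by positivity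
  nlinarith

/-! ### Quadri-tangent ellipses belong to the families. -/

/-- The canonical form produces its own reduction; the symmetries of the normal form carry the
result to the given one. -/
theorem exists_familyNeg {P : BinaryCubic} (hd : P.disc < 0) {φ : Mat2} (hφ : IsReduction P φ)
    {H : Mat2} (hp : H.PosDef) (hc : CubicLe P H) (hq : IsQuadriTangent P H) :
    ∃ l ∈ Set.Ioc (0 : ℝ) 2, H = familyNeg φ l := by
  obtain ⟨ψ, t, hψ, ht0, ht1, hcan⟩ := exists_frame_of_quadriTangent hp hc hq
  obtain ⟨l, hl, -, hr, he⟩ := familyNeg_of_canonical hψ (by linarith) ht1 hcan hd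
  exact ⟨l, hl, he.trans (transport_diagonal_neg hd hr hφ _ _)⟩

theorem exists_familyPos {P : BinaryCubic} (hd : 0 < P.disc) {φ : Mat2} (hφ : IsReduction P φ)
    {H : Mat2} (hp : H.PosDef) (hc : CubicLe P H) (hq : IsQuadriTangent P H) :
    ∃ V ∈ threeRotations, ∃ l ∈ Set.Ioc (0 : ℝ) 1, H = familyPos φ V l := by
  obtain ⟨ψ, t, hψ, ht0, ht1, hcan⟩ := exists_frame_of_quadriTangent hp hc hq
  obtain ⟨φ', l, hl, -, hr, he⟩ := familyPos_of_canonical hψ ht0 hcan hd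
  obtain ⟨V, hV, h2⟩ := transport_diagonal_pos hd hr hφ ((4 - l ^ 3) / (3 * l ^ 2)) l
  refine ⟨V, hV, l, hl, ?_⟩
  rw [he, familyPos, transpose_one, one_mul, mul_one, h2, familyPos]

theorem exists_familyZero {P : BinaryCubic} (hd : P.disc = 0) {φ : Mat2}
    (hφ : IsChange P φ fun x y => x ^ 2 * y) {H : Mat2} (hp : H.PosDef) (hc : CubicLe P H)
    (hq : IsQuadriTangent P H) : ∃ l, 0 < l ∧ H = familyZero φ l := by
  obtain ⟨ψ, t, hψ, ht0, ht1, hcan⟩ := exists_frame_of_quadriTangent hp hc hq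
  obtain ⟨φ', hr, he⟩ := familyZero_of_canonical hψ (by linarith) hcan hd
  obtain ⟨l, hl, h2⟩ := transport_diagonal_zero hr hφ
  exact ⟨l, hl, he.trans h2⟩

theorem exists_change_zero {P : BinaryCubic} (hd : P.disc = 0) {H : Mat2} (hp : H.PosDef)
    (hc : CubicLe P H) (hq : IsQuadriTangent P H) : ∃ φ, IsChange P φ fun x y => x ^ 2 * y := by
  obtain ⟨ψ, t, hψ, ht0, ht1, hcan⟩ := exists_frame_of_quadriTangent hp hc hq
  obtain ⟨φ', hr, -⟩ := familyZero_of_canonical hψ (by linarith) hcan hd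
  exact ⟨φ', hr⟩

theorem IsReduction.det_ne_zero {P : BinaryCubic} {φ : Mat2} (h : IsReduction P φ) : φ.det ≠ 0 := by
  rcases h with h | h
  · exact h.2.1
  · exact h.2.1

theorem IsOptimal.det_eq {P : BinaryCubic} {α : ℝ} {H K : Mat2} (hH : IsOptimal P α H)
    (hK : IsOptimal P α K) : H.det = K.det :=
  le_antisymm (hH.2 _ hK.1) (hK.2 _ hH.1)

theorem det_transport_inj {φ D D' : Mat2} (hd : φ.det ≠ 0)
    (h : (transport φ D).det = (transport φ D').det) : D.det = D'.det := by
  rw [← det_transport hd D, ← det_transport hd D', h]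

/-! ### Uniqueness for negative discriminants -/

/-- The determinant along the family, `(4 + l ^ 3) / (3 l)` up to a constant, is not monotone, so
two parameters can give the same area; removing the factor `u - w` leaves this relation. -/
theorem neg_tie {u w : ℝ} (hu : 0 < u) (hw : 0 < w) (hne : u ≠ w)
    (h : (4 + u ^ 3) / (3 * u ^ 2) * u = (4 + w ^ 3) / (3 * w ^ 2) * w) : u * w * (u + w) = 4 := by
  field_simp at h
  apply mul_left_cancel₀ (sub_ne_zero.2 hne)
  linear_combination h

/-- In the frame of the optimal ellipse, the major axis is not inside the sector of the contact
points. -/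
theorem IsOptimal.sector {P : BinaryCubic} {α : ℝ} {H ψ : Mat2} (hH : IsOptimal P α H)
    (hψ : IsFrame H ψ) {t : ℝ} (ht1 : t < 1) (ht0 : 0 < t) (ht : 1 / 2 < t ^ 2)
    (hcan : P.comp ψ = canonicalCubic t) {v₁ v₂ : ℝ} (hv : v₁ ^ 2 + v₂ ^ 2 = 1)
    (hpar : ∀ X Y, X ^ 2 + Y ^ 2 = 1 →
      α * ((ψ 0 0 * X + ψ 0 1 * Y) ^ 2 + (ψ 1 0 * X + ψ 1 1 * Y) ^ 2) = 1 →
      v₁ * Y - X * v₂ = 0) :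
    t ^ 2 * v₁ ^ 2 ≤ (1 - t ^ 2) * v₂ ^ 2 := by
  have h1 : 0 < 1 - t ^ 2 := by nlinarith
  have hs := Real.sqrt_pos.2 h1
  have hs2 := Real.sq_sqrt h1.le
  set s := √(1 - t ^ 2)
  by_contra! hlt
  rw [← hs2, ← mul_pow, ← mul_pow, ← sq_abs (s * v₂), ← sq_abs (t * v₁)] at hlt
  have hlt' := lt_of_pow_lt_pow_left₀ 2 (abs_nonneg _) hlt
  rw [abs_mul, abs_mul, abs_of_pos ht0, abs_of_pos hs] at hlt'
  -- The sign `σ` reflects the situation so that the major axis may be treated as lying in the first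
  -- quadrant.
  obtain ⟨σ, hσ, hσ'⟩ : ∃ σ : ℝ, σ ^ 2 = 1 ∧ σ * (v₁ * v₂) = |v₁| * |v₂| := by
    rcases abs_cases (v₁ * v₂) with ⟨h, -⟩ | ⟨h, -⟩
    · exact ⟨1, by norm_num, by rw [one_mul, ← abs_mul, h]⟩
    · exact ⟨-1, by norm_num, by rw [← abs_mul, h]; ring⟩
  set A := 2 * ((t * |v₁| - s * |v₂|) * (s * |v₁| + t * |v₂|)) with hA
  have hv1 : 0 < |v₁| := by
    have : 0 ≤ s * |v₂| := by positivity
    exact pos_of_mul_pos_right (this.trans_lt hlt') ht0.le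
  have hA0 : 0 < A := by
    have : 0 < s * |v₁| + t * |v₂| := by positivity
    have := mul_pos (sub_pos.2 hlt') this
    linarith
  have hst : 0 < t ^ 2 - s ^ 2 := by linarith
  -- Without the term `A / 2`, this perturbation is nonnegative at the four contacts, zero at two of
  -- them, and equal to `A` on the major axis. Adding `A / 2 * (X ^ 2 - Y ^ 2)` makes it positive at
  -- all of them.
  obtain ⟨X, Y, hXY, hcon, hle⟩ := hH.exists_contact hψ (k := 2 * t * s + A / 2)
    (l := (t ^ 2 - s ^ 2) * σ) (Or.inl (by positivity))
  have hcase : (X ^ 2 = t ^ 2 ∧ Y ^ 2 = s ^ 2) ∨ v₁ * Y - X * v₂ = 0 := by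
    rcases hcon with h | h
    · left
      rw [hcan] at h
      rcases contact_canonicalCubic ht0 hXY h with h | h
      · exact ⟨h, by linarith⟩
      · nlinarith [sq_nonneg Y]
    · exact Or.inr (hpar X Y hXY h)
  rcases hcase with ⟨hX, hY⟩ | hpl
  · have e : (σ * X * Y) ^ 2 = (t * s) ^ 2 := by rw [mul_pow, mul_pow, hσ, hX, hY]; ring
    have hge := abs_le_of_sq_le_sq' e.le (by positivity)
    rw [hX, hY] at hle
    have := mul_le_mul_of_nonneg_left hge.1 hst.le
    nlinarith [mul_pos hA0 hst]
  · obtain ⟨c, hc⟩ : ∃ c, c = v₁ * X + v₂ * Y := ⟨_, rfl⟩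
    have hX : X = c * v₁ := by rw [hc]; linear_combination (-X) * hv - v₂ * hpl
    have hY : Y = c * v₂ := by rw [hc]; linear_combination (-Y) * hv + v₁ * hpl
    have hc2 : c ^ 2 = 1 := by
      rw [hX, hY] at hXY
      linear_combination hXY - c ^ 2 * hv
    have e : (2 * t * s + A / 2) * (X ^ 2 - Y ^ 2) + 2 * ((t ^ 2 - s ^ 2) * σ) * X * Y
        = A + A / 2 * (v₁ ^ 2 - v₂ ^ 2) := by
      rw [hX, hY, hA]
      have a1 := sq_abs v₁
      have a2 := sq_abs v₂
      linear_combination ((2 * t * s + A / 2) * (v₁ ^ 2 - v₂ ^ 2)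
        + 2 * (t ^ 2 - s ^ 2) * σ * v₁ * v₂) * hc2 + 2 * (t ^ 2 - s ^ 2) * hσ'
        - 2 * t * s * (a1 - a2)
    rw [e] at hle
    nlinarith [sq_nonneg v₁, sq_nonneg v₂]

/-- `a`, `n`, `g` are the entries of `α` times the Gram matrix, and `δ` is the common determinant of
the two diagonal forms. Eliminating `g` from the eigenvector equations and inserting the sector
bound `hsec` gives `w - a ≤ u - a`. -/
theorem neg_tie_absurd {u w a n g w₁ w₂ δ : ℝ} (hu : 0 < u) (huw : u < w)
    (hsum : u * w * (u + w) = 4) (hδ0 : 0 < δ)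
    (hδw : 3 * δ * w = 4 + w ^ 3) (ha : a ≤ u)
    (hn : n * (u * w) = a * δ)
    (e1 : (δ / w - n) * w₁ = g * w₂) (e2 : (w - a) * w₂ = g * w₁) (hw2 : w₂ ≠ 0)
    (hsec : (4 + w ^ 3) ^ 2 * w₁ ^ 2 ≤ 3 * w ^ 3 * (8 - w ^ 3) * w₂ ^ 2) : False := by
  have hw : 0 < w := hu.trans huw
  have k1 : δ * (u - a) * w₁ ^ 2 = u * w * ((w - a) * w₂ ^ 2) := by
    have h3 : u * w * (δ / w - n) = δ * (u - a) := by
      field_simp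
      linear_combination -hn
    linear_combination (-w₁ ^ 2) * h3 + u * w * w₁ * e1 - u * w * w₂ * e2
  have hw22 : 0 < w₂ ^ 2 := by positivity
  have k2 : 3 * δ ^ 2 * w₁ ^ 2 ≤ w * (8 - w ^ 3) * w₂ ^ 2 := by
    rw [← hδw] at hsec
    have : 0 < 3 * w ^ 2 := by positivity
    refine le_of_mul_le_mul_left ?_ this
    linarith
  have hua : 0 ≤ u - a := by linarith
  have k3 : 3 * δ * (u * w * ((w - a) * w₂ ^ 2)) ≤ (u - a) * (w * (8 - w ^ 3) * w₂ ^ 2) := by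
    rw [← k1]
    have := mul_le_mul_of_nonneg_left k2 hua
    linarith
  have k4 : w * (8 - w ^ 3) ≤ 3 * δ * (u * w) := by
    have h0 : 3 * δ * (u * w) - w * (8 - w ^ 3) = w * ((w - u) ^ 2 * (w + u)) := by
      linear_combination u * hδw + (2 * w - u) * hsum
    have : 0 ≤ w * ((w - u) ^ 2 * (w + u)) := by positivity
    linarith
  have k5 : 3 * δ * (u * w) * (w - a) * w₂ ^ 2 ≤ 3 * δ * (u * w) * (u - a) * w₂ ^ 2 := by
    have := mul_le_mul_of_nonneg_left k4 (mul_nonneg hua hw22.le)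
    linarith
  have k6 : 0 < 3 * δ * (u * w) * w₂ ^ 2 := by positivity
  have k7 : 0 < (3 * δ * (u * w) * w₂ ^ 2) * (w - u) := mul_pos k6 (by linarith)
  linarith

/-- Of two tied parameters the larger one has `t ^ 2 > 1 / 2`, so `IsOptimal.sector` restricts its
major axis. This is incompatible with the admissibility of the ellipse with the smaller parameter.
-/
theorem IsOptimal.familyNeg_not_lt {P : BinaryCubic} {α : ℝ} (hα : 0 < α) (hβ : betaOf P ≤ α)
    (hlt : α < alphaOf P) (hd : P.disc < 0) {φ₀ : Mat2} (hφ₀ : IsReduction P φ₀) {u w : ℝ}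
    (hu : 0 < u) (huw : u < w) (h₁ : IsOptimal P α (familyNeg φ₀ u))
    (h₂ : IsOptimal P α (familyNeg φ₀ w)) : False := by
  have hw := hu.trans huw
  have hp := h₂.1.posDef hα
  have hμ0 := muOf_pos_of_alphaOf_pos (hα.trans hlt)
  have hμ : α < muOf P := hlt.trans_le (alphaOf_le_muOf hμ0)
  obtain ⟨ψ, t, hψ, ht0, ht1, hcan⟩ := h₂.canonical_of_lt hα hβ hlt
  have ht : 0 < t := by linarith
  obtain ⟨l, hl, hl3, hr, he⟩ := familyNeg_of_canonical hψ ht ht1.le hcan hd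
  have hl0 := hl.1
  set φ := ψ * Matrix.diagonal ![2 * t / l, √l] with hφ
  have hdφ := hr.det_ne_zero
  have he1 : ∀ x, familyNeg φ₀ x = familyNeg φ x := fun x => transport_diagonal_neg hd hφ₀ hr _ _
  rw [he1] at h₁ h₂ he hp hψ
  have hwl : w = l := familyNeg_inj hdφ he
  subst hwl
  have hs := h₂.1.symm
  have hdet0 := det_transport_inj hdφ (h₁.det_eq h₂)
  rw [det_diagonal_two, det_diagonal_two] at hdet0
  have hsum := neg_tie hu hw huw.ne hdet0
  obtain ⟨a, b, q, hab, e1, e2⟩ := exists_unit_eigenvector hp (h₂.det_sub_eq_zero hα hβ)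
  obtain ⟨v₁, v₂, hv1, hv2⟩ := exists_coords hψ.det_ne_zero a b
  have hv : v₁ ^ 2 + v₂ ^ 2 = 1 := by rw [← hψ.quadAt, ← hv1, ← hv2, q]
  have hw3 : 2 < w ^ 3 := by nlinarith [mul_pos hu hw]
  have hsec := h₂.sector hψ ht1 ht (by linarith) hcan hv (by
    intro X Y hXY h
    apply hψ.parallel
    rw [← hv1, ← hv2]
    exact eigen_parallel hs h₂.1.disk (h₂.ne_smul_one hα hμ) (by rw [hab, q])
      (by rw [h, hψ.quadAt, hXY]))
  obtain ⟨W₁, W₂, ha, hb⟩ := exists_coords hdφ a b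
  have hpar : v₁ = 2 * t / w * W₁ ∧ v₂ = √w * W₂ := by
    have hdψ := hψ.det_ne_zero
    rw [det_fin_two] at hdψ
    simp [hφ, Matrix.mul_apply, Fin.sum_univ_two] at ha hb
    rw [hv1] at ha
    rw [hv2] at hb
    constructor
    · apply mul_left_cancel₀ hdψ
      linear_combination ψ 1 1 * ha - ψ 0 1 * hb
    · apply mul_left_cancel₀ hdψ
      linear_combination ψ 0 0 * hb - ψ 1 0 * ha
  have hW2 : W₂ ≠ 0 := by
    rintro rfl
    rw [mul_zero] at hpar
    rw [hpar.2] at hsec hv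
    nlinarith
  have hD := congr_transport hdφ (Matrix.diagonal ![(4 + w ^ 3) / (3 * w ^ 2), w])
  change φᵀ * familyNeg φ w * φ = _ at hD
  have f00 := congrFun (congrFun hD 0) 0
  have f01 := congrFun (congrFun hD 0) 1
  have f11 := congrFun (congrFun hD 1) 1
  have hdw := det_transport_diagonal_sub hdφ ((4 + w ^ 3) / (3 * w ^ 2)) w α
  have hdu := det_transport_diagonal_sub hdφ ((4 + u ^ 3) / (3 * u ^ 2)) u α
  have z1 := h₁.det_sub_eq_zero hα hβ
  have z2 := h₂.det_sub_eq_zero hα hβ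
  rw [familyNeg] at z1 z2
  rw [z2, mul_zero] at hdw
  rw [z1, mul_zero] at hdu
  have hdisk := (disk_transport_diagonal hdφ h₁.1.disk).2
  simp [Matrix.mul_apply, Fin.sum_univ_two, hs] at f00 f01 f11
  set H := familyNeg φ w
  have hsw := Real.sq_sqrt hw.le
  have hδw : (4 + w ^ 3) / (3 * w ^ 2) = (4 + w ^ 3) / (3 * w) / w := by field_simp
  have hδu : (4 + u ^ 3) / (3 * u ^ 2) = (4 + w ^ 3) / (3 * w) / u := by
    field_simp at hdet0 ⊢
    linear_combination hdet0
  obtain ⟨δ, hδ⟩ : ∃ δ, δ = (4 + w ^ 3) / (3 * w) := ⟨_, rfl⟩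
  have hδ0 : 0 < δ := by rw [hδ]; positivity
  have hδw2 : 3 * δ * w = 4 + w ^ 3 := by rw [hδ]; field_simp
  rw [← hδ] at hδw hδu
  rw [hδw] at hdw f00
  rw [hδu] at hdu
  refine neg_tie_absurd (a := α * colSq₁ φ) (n := α * colSq₀ φ) (g := α * colInner φ) (δ := δ)
    (w₁ := W₁) (w₂ := W₂) hu huw hsum hδ0 hδw2 hdisk ?_ ?_ ?_ hW2 ?_
  -- Subtracting the two determinant equations eliminates the Gram determinant, since both diagonal
  -- forms have determinant `δ`.
  · have hx : δ / w * w = δ := div_mul_cancel₀ _ hw.ne'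
    have hy : δ / u * u = δ := div_mul_cancel₀ _ hu.ne'
    apply mul_left_cancel₀ (sub_ne_zero.2 huw.ne)
    linear_combination -(u * w) * (hdw - hdu) + α * colSq₁ φ * (u * hx - w * hy)
      - u * w * (hx - hy)
  · simp only [colSq₀, colInner]
    rw [ha, hb] at e1 e2
    linear_combination φ 0 0 * e1 + φ 1 0 * e2 - W₁ * f00 - W₂ * f01
  · simp only [colSq₁, colInner]
    rw [ha, hb] at e1 e2
    linear_combination φ 0 1 * e1 + φ 1 1 * e2 - W₁ * f01 - W₂ * f11
  · have ht2 : t ^ 2 = (4 + w ^ 3) / 12 := by linarith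
    rw [hpar.1, hpar.2, mul_pow, mul_pow, hsw, div_pow, mul_pow, ht2] at hsec
    field_simp at hsec
    linarith

theorem IsOptimal.eq_of_disc_neg {P : BinaryCubic} {α : ℝ} (hα : 0 < α) (hβ : betaOf P ≤ α)
    (hlt : α < alphaOf P) (hd : P.disc < 0) {H K : Mat2} (hH : IsOptimal P α H)
    (hK : IsOptimal P α K) : H = K := by
  obtain ⟨φ, hφ⟩ := exists_isReduction hd.ne
  have hH2 := (hH.mem_quadriTangentFamily hα hβ hlt.le).2.1
  have hK2 := (hK.mem_quadriTangentFamily hα hβ hlt.le).2.1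
  obtain ⟨u, hu, rfl⟩ := exists_familyNeg hd hφ (hH.1.posDef hα) hH.1.cubic hH2
  obtain ⟨w, hw, rfl⟩ := exists_familyNeg hd hφ (hK.1.posDef hα) hK.1.cubic hK2
  rcases lt_trichotomy u w with h | rfl | h
  · exact (hH.familyNeg_not_lt hα hβ hlt hd hφ hu.1 h hK).elim
  · rfl
  · exact (hK.familyNeg_not_lt hα hβ hlt hd hφ hw.1 h hH).elim

/-- Along this family the determinant is a constant multiple of `1 / l`, so equal areas give equal
parameters. -/
theorem IsOptimal.eq_of_disc_zero {P : BinaryCubic} {α : ℝ} (hα : 0 < α) (hβ : betaOf P ≤ α)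
    (hle : α ≤ alphaOf P) (hd : P.disc = 0) {H K : Mat2} (hH : IsOptimal P α H)
    (hK : IsOptimal P α K) : H = K := by
  have hH2 := (hH.mem_quadriTangentFamily hα hβ hle).2.1
  have hK2 := (hK.mem_quadriTangentFamily hα hβ hle).2.1
  obtain ⟨φ, hφ⟩ := exists_change_zero hd (hH.1.posDef hα) hH.1.cubic hH2
  obtain ⟨u, hu, rfl⟩ := exists_familyZero hd hφ (hH.1.posDef hα) hH.1.cubic hH2
  obtain ⟨w, hw, rfl⟩ := exists_familyZero hd hφ (hK.1.posDef hα) hK.1.cubic hK2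
  have h := det_transport_inj hφ.1 (hH.det_eq hK)
  rw [det_diagonal_two, det_diagonal_two] at h
  field_simp at h
  rw [h]

/-! ### Uniqueness for positive discriminants -/

/-- Let `k ≤ n` be the roots of `T ^ 2 - (x + y) T + Δ`. The assumption `h1` says `k ≤ 1 ≤ n`, and
the quartic is a sum of terms that are nonnegative for `l < 1`; the last one uses the position of `x
- y` relative to `-ρ / 2`. -/
theorem pos_quartic_pos {l x y Δ ρ : ℝ} (hl0 : 0 < l) (hl1 : l < 1) (hρ : 0 ≤ ρ)
    (hρ2 : ρ ^ 2 = (x + y) ^ 2 - 4 * Δ) (hΔ : 0 ≤ Δ) (hxy : 0 ≤ x + y)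
    (h1 : 1 - (x + y) + Δ ≤ 0) (h2 : x - y ≤ -ρ / 2) :
    0 < l ^ 4 + -(y - 3 * x) * l ^ 3 + -(3 * Δ) * l ^ 2 + -4 * l + 4 * y := by
  obtain ⟨n, hn⟩ : ∃ n, n = (x + y + ρ) / 2 := ⟨_, rfl⟩
  obtain ⟨k, hk⟩ : ∃ k, k = (x + y - ρ) / 2 := ⟨_, rfl⟩
  have hnk : Δ = n * k := by rw [hn, hk]; linear_combination (1 / 4) * hρ2
  have hτ : x + y = n + k := by rw [hn, hk]; ring
  have hρ' : ρ = n - k := by rw [hn, hk]; ring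
  have hk0 : 0 ≤ k := by
    have : ρ ≤ x + y := le_of_sq_le_sq (by linarith) hxy
    linarith
  have hle : k ≤ n := by linarith
  have hprod : 0 ≤ (n - 1) * (1 - k) := by
    rw [hτ, hnk] at h1
    linarith
  have hn1 : 1 ≤ n := by
    by_contra! h
    nlinarith [mul_pos (sub_pos.2 h) (by linarith : 0 < 1 - k)]
  have hk1 : k ≤ 1 := by
    by_contra! h
    nlinarith [mul_pos (sub_pos.2 h) (by linarith : 0 < n - 1)]
  have hl3 : 0 < 1 - l ^ 3 := by
    have : l ^ 3 < 1 := pow_lt_one₀ hl0.le hl1 (by norm_num)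
    linarith
  have e : l ^ 4 + -(y - 3 * x) * l ^ 3 + -(3 * Δ) * l ^ 2 + -4 * l + 4 * y
      = (1 - l) ^ 2 * (l ^ 2 + 2 * l + 3) + 3 * ((n - 1) * (1 - k * l ^ 2))
        + k * ((1 - l) ^ 2 * (1 + 2 * l)) + 2 * ((-ρ / 2 - (x - y)) * (1 - l ^ 3)) := by
    have hx : x = (n + k + (x - y)) / 2 := by linarith
    have hy : y = (n + k - (x - y)) / 2 := by linarith
    generalize x - y = p at hx hy
    rw [hnk, hρ', hx, hy]
    ring
  rw [e]
  have a1 : 0 < (1 - l) ^ 2 * (l ^ 2 + 2 * l + 3) := by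
    have : 0 < 1 - l := by linarith
    positivity
  have a2 : 0 ≤ (n - 1) * (1 - k * l ^ 2) := by
    refine mul_nonneg (by linarith) ?_
    have : l ^ 2 ≤ 1 := pow_le_one₀ hl0.le hl1.le
    nlinarith [sq_nonneg l]
  have a3 : 0 ≤ k * ((1 - l) ^ 2 * (1 + 2 * l)) := by positivity
  have a4 : 0 ≤ (-ρ / 2 - (x - y)) * (1 - l ^ 3) := mul_nonneg (by linarith) hl3.le
  linarith

theorem det_nonpos_of_indefinite {A : Mat2} (hs : A 1 0 = A 0 1) {a b x y : ℝ}
    (h1 : a ≠ 0 ∨ b ≠ 0) (h2 : quadAt A a b ≤ 0) (h3 : x ≠ 0 ∨ y ≠ 0) (h4 : 0 ≤ quadAt A x y) :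
    A.det ≤ 0 := by
  by_contra! hd
  have hpos : ∀ u v, (u ≠ 0 ∨ v ≠ 0) → 0 < A 0 0 * quadAt A u v := by
    intro u v huv
    have e : A 0 0 * quadAt A u v = (A 0 0 * u + A 0 1 * v) ^ 2 + A.det * v ^ 2 := by
      rw [det_fin_two]
      simp only [quadAt, hs]
      ring
    have h0 : A 0 0 ≠ 0 := by
      intro h0
      rw [det_fin_two, h0, hs] at hd
      nlinarith [sq_nonneg (A 0 1)]
    rw [e]
    by_cases hv : v = 0
    · subst hv
      have : u ≠ 0 := by tauto
      have : 0 < (A 0 0 * u) ^ 2 := by positivity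
      simpa using this
    · have : 0 < A.det * v ^ 2 := by positivity
      positivity
  have k1 := hpos a b h1
  have k2 := hpos x y h3
  rcases lt_trichotomy (A 0 0) 0 with h | h | h
  · nlinarith
  · rw [h] at k1
    linarith
  · nlinarith

/-- The form of `E_P` minus `α` is nonpositive on the major axis of `E_P`, where the eigenvalue is
`β_P`, and nonnegative at a nearest point. -/
theorem det_hOf_sub_nonpos {P : BinaryCubic} {α : ℝ} (hd : P.disc ≠ 0) (hβ : betaOf P ≤ α)
    (hμ0 : 0 < muOf P) (hμ : α ≤ muOf P) : (hOf P - α • (1 : Mat2)).det ≤ 0 := by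
  obtain ⟨hp, hc⟩ := hOf_inscribed hd
  have hs := hp.symm_apply
  obtain ⟨a, b, hab, e1, e2⟩ := exists_eigenvector hs (betaOf_spec hd).2
  obtain ⟨z, hz⟩ := exists_isNearestPoint hμ0
  have hz1 := one_le_quadAt_of_eval hp hc hz.1
  have hz2 := hz.muOf_mul hμ0
  have hq : ∀ x y, quadAt (hOf P - α • (1 : Mat2)) x y
      = quadAt (hOf P) x y - α * (x ^ 2 + y ^ 2) := by
    intro x y
    simp [quadAt]
    ring
  have hz3 : 0 ≤ z 0 ^ 2 + z 1 ^ 2 := by positivity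
  refine det_nonpos_of_indefinite (by simpa using hs) hab ?_ (x := z 0) (y := z 1) ?_ ?_
  · have : quadAt (hOf P) a b = betaOf P * (a ^ 2 + b ^ 2) := by
      simp only [quadAt, hs]
      linear_combination a * e1 + b * e2
    rw [hq, this]
    nlinarith [sq_nonneg a, sq_nonneg b]
  · by_contra! h
    rw [h.1, h.2] at hz2
    norm_num at hz2
  · rw [hq]
    nlinarith

theorem hOf_eq_transport {P : BinaryCubic} (hd : 0 < P.disc) {φ V : Mat2} (hφ : IsReduction P φ)
    (hV : V ∈ threeRotations) : hOf P = transport (φ * Vᵀ) (Matrix.diagonal ![1, 1]) := by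
  have h1 : familyPos φ V 1 = familyPos φ 1 1 := by
    have h : (Matrix.diagonal ![(4 - 1 ^ 3) / (3 * 1 ^ 2), 1] : Mat2) = 1 := by
      ext i j
      fin_cases i <;> fin_cases j <;> norm_num
    rw [familyPos, familyPos, h, mul_one, threeRotations_orthogonal hV]
    simp
  rw [hOf_eq hφ, optimalMatrix_pos hd, ← h1, familyPos_eq φ hV]
  norm_num

theorem familyPos_one {P : BinaryCubic} (hd : 0 < P.disc) {φ V : Mat2} (hφ : IsReduction P φ)
    (hV : V ∈ threeRotations) : familyPos φ V 1 = hOf P := by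
  rw [hOf_eq_transport hd hφ hV, familyPos_eq φ hV]
  norm_num

theorem IsReduction.one_sub_colSq_le {P : BinaryCubic} {α : ℝ} (hd : 0 < P.disc) {φ : Mat2}
    (hφ : IsReduction P φ) (hβ : betaOf P ≤ α) (hμ0 : 0 < muOf P) (hμ : α ≤ muOf P) :
    1 - α * (colSq₀ φ + colSq₁ φ) + (α * φ.det) ^ 2 ≤ 0 := by
  have h1 := det_hOf_sub_nonpos hd.ne' hβ hμ0 hμ
  have h2 := hOf_eq_transport hd hφ one_mem_threeRotations
  rw [transpose_one, mul_one] at h2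
  have h3 := det_transport_diagonal_sub hφ.det_ne_zero 1 1 α
  rw [← h2, colSq_mul_sub] at h3
  have := mul_nonpos_of_nonneg_of_nonpos (sq_nonneg φ.det) h1
  linarith

/-- A branch that meets no inscribed ellipse of diameter `2 α^{-1/2}`, except possibly `E_P`. -/
theorem familyPos_det_ne_zero {P : BinaryCubic} {α : ℝ} (hα : 0 < α) (hd : 0 < P.disc) {φ V : Mat2}
    (hφ : IsReduction P φ) (hV : V ∈ threeRotations) (hβ : betaOf P ≤ α) (hμ0 : 0 < muOf P)
    (hμ : α ≤ muOf P) {R : ℝ} (hR : 0 ≤ R)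
    (hR2 : R ^ 2 = (colSq₀ φ + colSq₁ φ) ^ 2 - 4 * φ.det ^ 2)
    (hle : colSq₀ (φ * Vᵀ) - colSq₁ (φ * Vᵀ) ≤ -R / 2) {l : ℝ} (hl0 : 0 < l) (hl1 : l < 1) :
    (familyPos φ V l - α • (1 : Mat2)).det ≠ 0 := by
  intro h
  have h1 := familyPos_quartic hφ.det_ne_zero hV hl0 h
  have h2 := hφ.one_sub_colSq_le hd hβ hμ0 hμ
  have h3 := colSq_add φ hV
  have h4 : 0 ≤ colSq₀ φ + colSq₁ φ := by unfold colSq₀ colSq₁; positivity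
  have h5 := pos_quartic_pos (l := l) (x := α * colSq₀ (φ * Vᵀ)) (y := α * colSq₁ (φ * Vᵀ))
    (Δ := (α * φ.det) ^ 2) (ρ := α * R) hl0 hl1 (by positivity)
    (by rw [← mul_add, h3, mul_pow, hR2]; ring) (by positivity)
    (by rw [← mul_add, h3]; positivity) (by rw [← mul_add, h3]; exact h2)
    (by nlinarith)
  linarith

/-- One of three cosines at angles 120 degrees apart is at most `-1 / 2`: otherwise the pairwise
products of the three positive shifted differences would sum to zero. -/
theorem exists_branch (φ : Mat2) {R : ℝ}
    (hR2 : R ^ 2 = (colSq₀ φ + colSq₁ φ) ^ 2 - 4 * φ.det ^ 2) :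
    ∃ V ∈ threeRotations, colSq₀ (φ * Vᵀ) - colSq₁ (φ * Vᵀ) ≤ -R / 2 := by
  by_contra! hcon
  have m2 := (mem_threeRotations_iff _).2 (Or.inr (Or.inl rfl))
  have hne : (1 : Mat2) ≠ !![1 / 2, -(√3 / 2); √3 / 2, 1 / 2] := by
    intro h
    have := congrFun (congrFun h 0) 0
    norm_num at this
  obtain ⟨V, hV, e1, e2⟩ := exists_third_rotation φ one_mem_threeRotations m2 hne
  rw [← hR2] at e2
  have a1 := hcon _ one_mem_threeRotations
  have a2 := hcon _ m2
  have a3 := hcon _ hV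
  generalize colSq₀ (φ * (1 : Mat2)ᵀ) - colSq₁ (φ * (1 : Mat2)ᵀ) = p at *
  generalize colSq₀ (φ * (!![1 / 2, -(√3 / 2); √3 / 2, 1 / 2] : Mat2)ᵀ)
    - colSq₁ (φ * (!![1 / 2, -(√3 / 2); √3 / 2, 1 / 2] : Mat2)ᵀ) = q at *
  generalize colSq₀ (φ * Vᵀ) - colSq₁ (φ * Vᵀ) = r at *
  have b1 : 0 < p + R / 2 := by linarith
  have b2 : 0 < q + R / 2 := by linarith
  have b3 : 0 < r + R / 2 := by linarith
  have hr : r = -p - q := by linarith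
  subst hr
  nlinarith [mul_pos b1 b2, mul_pos b1 b3, mul_pos b2 b3]

theorem exists_spread (φ : Mat2) :
    ∃ R, 0 ≤ R ∧ R ^ 2 = (colSq₀ φ + colSq₁ φ) ^ 2 - 4 * φ.det ^ 2 := by
  refine ⟨_, Real.sqrt_nonneg _, Real.sq_sqrt ?_⟩
  rw [← colSq_mul_sub]
  nlinarith [sq_nonneg (colSq₀ φ - colSq₁ φ), sq_nonneg (colInner φ)]

/-- If the shorter axis of `E_P` is along a nearest point, then `α_P ≤ β_P`. -/
theorem alphaOf_le_betaOf {P : BinaryCubic} (hα : 0 < alphaOf P) (hd : 0 < P.disc) {φ V : Mat2}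
    (hφ : IsReduction P φ) (hV : V ∈ threeRotations) (h0 : colInner (φ * Vᵀ) = 0)
    (hle : colSq₀ (φ * Vᵀ) ≤ colSq₁ (φ * Vᵀ)) : alphaOf P ≤ betaOf P := by
  have hμ := muOf_pos_of_alphaOf_pos hα
  obtain ⟨hp, hc⟩ := hOf_inscribed hd.ne'
  obtain ⟨a, b, q, hab, -, -⟩ := exists_unit_eigenvector hp (betaOf_spec hd.ne').2
  have hψ : (φ * Vᵀ).det ≠ 0 := by
    rw [det_mul, det_transpose]
    exact mul_ne_zero hφ.det_ne_zero (threeRotations_det hV)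
  have he := hOf_eq_transport hd hφ hV
  -- In reduced coordinates this column is a rotation of `(1, 0)` by a multiple of 60 degrees, and
  -- the normal form is `± 1` at all of these.
  have hcol : |P.eval ((φ * Vᵀ) 0 0) ((φ * Vᵀ) 1 0)| = 1 := by
    have h1 := (isChange_iff _ _ _).1 (hφ.isChange_pos hd)
    have h2 := eval_comp_mul P φ Vᵀ 1 0
    rw [h1.2, eval_comp] at h2
    simp only [mul_one, mul_zero, add_zero, transpose_apply] at h2
    rw [h2]
    have h3 : √3 ^ 2 = 3 := Real.sq_sqrt (by norm_num)
    rcases (mem_threeRotations_iff V).1 hV with rfl | rfl | rfl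
    · simp
    · simp [div_pow, h3]; norm_num
    · simp [div_pow, h3]; norm_num
  have h1 := one_le_muOf_mul hcol
  have h2 : 1 ≤ muOf P * colSq₁ (φ * Vᵀ) :=
    h1.trans (mul_le_mul_of_nonneg_left hle hμ.le)
  have h3 := alphaOf_le_quadAt hα hμ hp hc (by
    intro x y
    obtain ⟨X, Y, rfl, rfl⟩ := exists_coords hψ x y
    rw [he, quadAt_transport hψ, quadAt_diagonal]
    have e : muOf P * (((φ * Vᵀ) 0 0 * X + (φ * Vᵀ) 0 1 * Y) ^ 2
        + ((φ * Vᵀ) 1 0 * X + (φ * Vᵀ) 1 1 * Y) ^ 2)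
        = muOf P * colSq₀ (φ * Vᵀ) * X ^ 2 + muOf P * colSq₁ (φ * Vᵀ) * Y ^ 2 := by
      rw [colInner] at h0
      rw [colSq₀, colSq₁]
      linear_combination 2 * muOf P * X * Y * h0
    rw [e]
    exact add_le_add (mul_le_mul_of_nonneg_right h1 (sq_nonneg X))
      (mul_le_mul_of_nonneg_right h2 (sq_nonneg Y))) a b
  rw [q, ← hab] at h3
  refine le_of_mul_le_mul_right h3 ?_
  by_contra! h
  nlinarith [betaOf_pos hd.ne']

/-- The function `(4 - l ^ 3) / (3 l)` is strictly decreasing for positive `l`, so here the area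
determines the parameter. -/
theorem pos_tie {u w : ℝ} (hu : 0 < u) (hw : 0 < w)
    (h : (4 - u ^ 3) / (3 * u ^ 2) * u = (4 - w ^ 3) / (3 * w ^ 2) * w) : u = w := by
  field_simp at h
  by_contra hne
  have h2 : (u - w) * (4 + u * w * (u + w)) = 0 := by linear_combination -h
  have : 0 < 4 + u * w * (u + w) := by positivity
  exact (mul_ne_zero (sub_ne_zero.2 hne) this.ne') h2

/-- Equal areas give equal parameters. If two rotations still gave different ellipses, subtracting
their quartics would make their column differences equal, say to `p`; the third is then `-2 p` and
`R = 2 |p|`, and either sign of `p` is impossible. -/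
theorem IsOptimal.eq_of_disc_pos {P : BinaryCubic} {α : ℝ} (hα : 0 < α) (hβ : betaOf P ≤ α)
    (hlt : α < alphaOf P) (hd : 0 < P.disc) {H K : Mat2} (hH : IsOptimal P α H)
    (hK : IsOptimal P α K) : H = K := by
  have hμ0 := muOf_pos_of_alphaOf_pos (hα.trans hlt)
  have hμ := hlt.le.trans (alphaOf_le_muOf hμ0)
  obtain ⟨φ, hφ⟩ := exists_isReduction hd.ne'
  have hdφ := hφ.det_ne_zero
  have hH2 := (hH.mem_quadriTangentFamily hα hβ hlt.le).2.1
  have hK2 := (hK.mem_quadriTangentFamily hα hβ hlt.le).2.1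
  obtain ⟨V₁, hV₁, u, hu, rfl⟩ := exists_familyPos hd hφ (hH.1.posDef hα) hH.1.cubic hH2
  obtain ⟨V₂, hV₂, w, hw, rfl⟩ := exists_familyPos hd hφ (hK.1.posDef hα) hK.1.cubic hK2
  have huw : u = w := by
    have h := hH.det_eq hK
    have e1 := det_transport_inj hdφ h
    have d1 := threeRotations_orthogonal hV₁
    have d2 := threeRotations_orthogonal hV₂
    have d1' := congrArg Matrix.det d1
    have d2' := congrArg Matrix.det d2
    simp only [det_mul, det_transpose, det_one] at d1' d2' e1
    rw [det_diagonal_two, det_diagonal_two] at e1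
    exact pos_tie hu.1 hw.1 (by
      linear_combination e1 - (4 - u ^ 3) / (3 * u ^ 2) * u * d1'
        + (4 - w ^ 3) / (3 * w ^ 2) * w * d2')
  subst huw
  rcases hu.2.lt_or_eq with hu1 | rfl
  · by_contra hne
    have hVne : V₁ ≠ V₂ := fun h => hne (by rw [h])
    have z1 := hH.det_sub_eq_zero hα hβ
    have z2 := hK.det_sub_eq_zero hα hβ
    have q1 := familyPos_quartic hdφ hV₁ hu.1 z1
    have q2 := familyPos_quartic hdφ hV₂ hu.1 z2
    obtain ⟨V₃, hV₃, s1, s2⟩ := exists_third_rotation φ hV₁ hV₂ hVne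
    obtain ⟨R, hR, hR2⟩ := exists_spread φ
    rw [← hR2] at s2
    have a1 := colSq_add φ hV₁
    have a2 := colSq_add φ hV₂
    have a3 := colSq_add φ hV₃
    have hu3 : 0 < 1 - u ^ 3 := by
      have : u ^ 3 < 1 := pow_lt_one₀ hu.1.le hu1 (by norm_num)
      linarith
    have hp : colSq₀ (φ * V₁ᵀ) - colSq₁ (φ * V₁ᵀ) = colSq₀ (φ * V₂ᵀ) - colSq₁ (φ * V₂ᵀ) := by
      have : (2 * α * (1 - u ^ 3)) * ((colSq₀ (φ * V₁ᵀ) - colSq₁ (φ * V₁ᵀ))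
          - (colSq₀ (φ * V₂ᵀ) - colSq₁ (φ * V₂ᵀ))) = 0 := by
        linear_combination q2 - q1 + α * (u ^ 3 + 2) * (a1 - a2)
      have := (mul_eq_zero.1 this).resolve_left (by positivity)
      linarith
    have hp3 : colSq₀ (φ * V₃ᵀ) - colSq₁ (φ * V₃ᵀ)
        = -2 * (colSq₀ (φ * V₁ᵀ) - colSq₁ (φ * V₁ᵀ)) := by linarith
    have hR4 : R ^ 2 = (2 * (colSq₀ (φ * V₁ᵀ) - colSq₁ (φ * V₁ᵀ))) ^ 2 := by
      rw [← hp, hp3] at s2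
      linear_combination (-2 / 3) * s2
    rcases le_or_gt (colSq₀ (φ * V₁ᵀ) - colSq₁ (φ * V₁ᵀ)) 0 with hneg | hpos
    -- For `p ≤ 0` the first branch itself has difference `-R / 2`, so it contains no ellipse of
    -- this diameter with `l < 1`.
    · refine familyPos_det_ne_zero hα hd hφ hV₁ hβ hμ0 hμ hR hR2 ?_ hu.1 hu1 z1
      have : R = -(2 * (colSq₀ (φ * V₁ᵀ) - colSq₁ (φ * V₁ᵀ))) := by
        rcases sq_eq_sq_iff_eq_or_eq_neg.1 hR4 with h | h <;> linarith
      linarith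
    -- For `p > 0` the third difference is `-R`, which leaves no room for an inner product of the
    -- columns; `alphaOf_le_betaOf` then contradicts `β_P ≤ α < α_P`.
    · have h3 : colInner (φ * V₃ᵀ) = 0 := by
        have hdd := det_mul_rotation φ hV₃
        have hcs := colSq_mul_sub (φ * V₃ᵀ)
        have : (2 * colInner (φ * V₃ᵀ)) ^ 2 = 0 := by
          linear_combination -4 * hcs - 4 * hdd
            + (colSq₀ (φ * V₃ᵀ) + colSq₁ (φ * V₃ᵀ) + (colSq₀ φ + colSq₁ φ)) * a3 - hR2 + hR4
            - (colSq₀ (φ * V₃ᵀ) - colSq₁ (φ * V₃ᵀ)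
              - 2 * (colSq₀ (φ * V₁ᵀ) - colSq₁ (φ * V₁ᵀ))) * hp3
        have := pow_eq_zero_iff (two_ne_zero) |>.1 this
        linarith
      have := alphaOf_le_betaOf (hα.trans hlt) hd hφ hV₃ h3 (by linarith)
      linarith
  · rw [familyPos_one hd hφ hV₁, familyPos_one hd hφ hV₂]

theorem IsOptimal.unique {P : BinaryCubic} {α : ℝ} (hα : 0 < α) (hβ : betaOf P ≤ α)
    (hle : α ≤ alphaOf P) {H K : Mat2} (hH : IsOptimal P α H) (hK : IsOptimal P α K) : H = K := by
  rcases hle.lt_or_eq with hlt | rfl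
  · rcases lt_trichotomy P.disc 0 with h | h | h
    · exact hH.eq_of_disc_neg hα hβ hlt h hK
    · exact hH.eq_of_disc_zero hα hβ hle h hK
    · exact hH.eq_of_disc_pos hα hβ hlt h hK
  · have hμ := muOf_pos_of_alphaOf_pos hα
    obtain ⟨z, hz⟩ := exists_isNearestPoint hμ
    rw [hH.eq_alignedMatrix hα le_rfl (alphaOf_le_muOf hμ) hz,
      hK.eq_alignedMatrix hα le_rfl (alphaOf_le_muOf hμ) hz]

/-! ### The number of quadri-tangent ellipses -/

theorem encard_quadriTangentFamily_neg {P : BinaryCubic} {α : ℝ} (hα : 0 < α) (hd : P.disc < 0) :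
    (quadriTangentFamily P α).encard ≤ 3 := by
  obtain ⟨φ, hφ⟩ := exists_isReduction hd.ne
  have hdφ := hφ.det_ne_zero
  refine (Set.encard_le_encard fun H hH => ?_).trans ((Set.encard_image_le (familyNeg φ) _).trans
    (encard_quartic_le_three (p := -(α * (colSq₁ φ + 3 * colSq₀ φ))) (q := 3 * (α * φ.det) ^ 2)
      (s := 4) (k := -(4 * (α * colSq₁ φ))) ?_))
  · obtain ⟨hf, hq, hdet⟩ := (mem_quadriTangentFamily_iff hα).1 hH
    obtain ⟨l, hl, rfl⟩ := exists_familyNeg hd hφ (hf.posDef hα) hf.cubic hq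
    exact ⟨l, ⟨hl.1, familyNeg_quartic hdφ hl.1 hdet⟩, rfl⟩
  · have := colSq₁_pos hdφ
    have : 0 < 4 * (α * colSq₁ φ) := by positivity
    linarith

theorem encard_quadriTangentFamily_zero {P : BinaryCubic} {α : ℝ} (hα : 0 < α) (hd : P.disc = 0) :
    (quadriTangentFamily P α).encard ≤ 2 := by
  rcases (quadriTangentFamily P α).eq_empty_or_nonempty with h | ⟨H, hH⟩
  · simp [h]
  obtain ⟨hf, hq, -⟩ := (mem_quadriTangentFamily_iff hα).1 hH
  obtain ⟨φ, hφ⟩ := exists_change_zero hd (hf.posDef hα) hf.cubic hq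
  have hdφ := hφ.1
  have hM := colSq₁_pos hdφ
  refine (Set.encard_le_encard fun H hH => ?_).trans ((Set.encard_image_le (familyZero φ) _).trans
    (encard_le_two_of (s := {l : ℝ | 0 < l ∧ -(27 * (α * colSq₁ φ)) * l ^ 3
      + 27 * (α * φ.det) ^ 2 * l ^ 2 + 4 * l + -(4 * (α * colSq₀ φ)) = 0}) ?_))
  · obtain ⟨hf, hq, hdet⟩ := (mem_quadriTangentFamily_iff hα).1 hH
    obtain ⟨l, hl, rfl⟩ := exists_familyZero hd hφ (hf.posDef hα) hf.cubic hq
    exact ⟨l, ⟨hl, familyZero_cubic hdφ hl hdet⟩, rfl⟩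
  · rintro a ⟨ha, e1⟩ b ⟨hb, e2⟩ c ⟨hc, e3⟩ hab hac hbc
    exact cubic_no_three_roots (by simp only [neg_lt_zero]; positivity) (by norm_num) ha hb hc
      hab hac hbc e1 e2 e3

/-- The ellipses of one branch, except `E_P`, that have the diameter `2 α^{-1/2}`. -/
def branch (φ V : Mat2) (α : ℝ) : Set Mat2 :=
  familyPos φ V '' {l | 0 < l ∧ l < 1 ∧ (familyPos φ V l - α • (1 : Mat2)).det = 0}

theorem pos_roots {φ V : Mat2} {α : ℝ} (hα : 0 < α) (hd : φ.det ≠ 0) (hV : V ∈ threeRotations)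
    {r₁ r₂ r₃ : ℝ} (p1 : 0 < r₁) (p2 : 0 < r₂) (p3 : 0 < r₃) (h12 : r₁ ≠ r₂) (h13 : r₁ ≠ r₃)
    (h23 : r₂ ≠ r₃) (h₁ : (familyPos φ V r₁ - α • (1 : Mat2)).det = 0)
    (h₂ : (familyPos φ V r₂ - α • (1 : Mat2)).det = 0)
    (h₃ : (familyPos φ V r₃ - α • (1 : Mat2)).det = 0) : False := by
  have hψ : (φ * Vᵀ).det ≠ 0 := by
    rw [det_mul, det_transpose]
    exact mul_ne_zero hd (threeRotations_det hV)
  have hM := colSq₁_pos hψ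
  exact quartic_no_three_roots (by simp only [neg_lt_zero]; positivity) (by positivity) p1 p2 p3
    h12 h13 h23 (familyPos_quartic hd hV p1 h₁) (familyPos_quartic hd hV p2 h₂)
    (familyPos_quartic hd hV p3 h₃)

theorem encard_branch_le_two {φ V : Mat2} {α : ℝ} (hα : 0 < α) (hd : φ.det ≠ 0)
    (hV : V ∈ threeRotations) : (branch φ V α).encard ≤ 2 := by
  refine (Set.encard_image_le _ _).trans (encard_le_two_of ?_)
  rintro a ⟨ha, -, e1⟩ b ⟨hb, -, e2⟩ c ⟨hc, -, e3⟩ hab hac hbc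
  exact pos_roots hα hd hV ha hb hc hab hac hbc e1 e2 e3

/-- When `l = 1` is itself a root, it uses up one of the at most two positive roots. -/
theorem encard_branch_le_one {φ V : Mat2} {α : ℝ} (hα : 0 < α) (hd : φ.det ≠ 0)
    (hV : V ∈ threeRotations) (h1 : (familyPos φ V 1 - α • (1 : Mat2)).det = 0) :
    (branch φ V α).encard ≤ 1 := by
  refine (Set.encard_image_le _ _).trans (Set.encard_le_one_iff.2 ?_)
  rintro a b ⟨ha, ha1, e1⟩ ⟨hb, hb1, e2⟩
  by_contra hab
  exact pos_roots hα hd hV ha hb one_pos hab ha1.ne hb1.ne e1 e2 h1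

theorem exists_other_rotations {V : Mat2} (hV : V ∈ threeRotations) :
    ∃ V₁ ∈ threeRotations, ∃ V₂ ∈ threeRotations, ∀ W ∈ threeRotations,
      W = V ∨ W = V₁ ∨ W = V₂ := by
  have m1 := one_mem_threeRotations
  have m2 := (mem_threeRotations_iff _).2 (Or.inr (Or.inl rfl))
  have m3 := (mem_threeRotations_iff _).2 (Or.inr (Or.inr rfl))
  rcases (mem_threeRotations_iff V).1 hV with rfl | rfl | rfl
  · exact ⟨_, m2, _, m3, fun W hW => (mem_threeRotations_iff W).1 hW⟩
  · exact ⟨_, m1, _, m3, fun W hW => by have := (mem_threeRotations_iff W).1 hW; tauto⟩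
  · exact ⟨_, m1, _, m2, fun W hW => by have := (mem_threeRotations_iff W).1 hW; tauto⟩

/-- One of the three branches contributes only `E_P`, and each of the others has at most two further
members. The ellipse `E_P` is shared by all branches and counts only for `α = β_P`, when each of the
others loses a root. -/
theorem encard_quadriTangentFamily_pos {P : BinaryCubic} {α : ℝ} (hα : 0 < α)
    (hβ : betaOf P ≤ α) (hle : α ≤ alphaOf P) (hd : 0 < P.disc) :
    (quadriTangentFamily P α).encard ≤ 4 := by
  have hμ0 := muOf_pos_of_alphaOf_pos (hα.trans_le hle)
  have hμ := hle.trans (alphaOf_le_muOf hμ0)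
  obtain ⟨φ, hφ⟩ := exists_isReduction hd.ne'
  have hdφ := hφ.det_ne_zero
  obtain ⟨R, hR, hR2⟩ := exists_spread φ
  obtain ⟨V, hV, hVle⟩ := exists_branch φ hR2
  obtain ⟨V₁, hV₁, V₂, hV₂, hall⟩ := exists_other_rotations hV
  have hsub : quadriTangentFamily P α
      ⊆ {H | H = hOf P ∧ betaOf P = α} ∪ branch φ V₁ α ∪ branch φ V₂ α := by
    intro H hH
    obtain ⟨hf, hq, hdet⟩ := (mem_quadriTangentFamily_iff hα).1 hH
    obtain ⟨W, hW, l, hl, rfl⟩ := exists_familyPos hd hφ (hf.posDef hα) hf.cubic hq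
    rcases hl.2.lt_or_eq with h1 | rfl
    · rcases hall W hW with rfl | rfl | rfl
      · exact (familyPos_det_ne_zero hα hd hφ hW hβ hμ0 hμ hR hR2 hVle hl.1 h1 hdet).elim
      · exact Or.inl (Or.inr ⟨l, ⟨hl.1, h1, hdet⟩, rfl⟩)
      · exact Or.inr ⟨l, ⟨hl.1, h1, hdet⟩, rfl⟩
    · refine Or.inl (Or.inl ⟨familyPos_one hd hφ hW, ?_⟩)
      have h3 := hH.2.2
      rw [familyPos_one hd hφ hW, diam_ellipse_hOf hd.ne'] at h3
      rw [← four_div_sq_two_div_sqrt hα, ← h3, four_div_sq_two_div_sqrt (betaOf_pos hd.ne')]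
  refine (Set.encard_le_encard hsub).trans ((Set.encard_union_le _ _).trans
    ((add_le_add_left (Set.encard_union_le _ _) _).trans ?_))
  by_cases hβα : betaOf P = α
  · have h1 : ∀ W ∈ threeRotations, (familyPos φ W 1 - α • (1 : Mat2)).det = 0 := by
      intro W hW
      rw [familyPos_one hd hφ hW, ← hβα]
      exact (betaOf_spec hd.ne').2
    have h2 : {H | H = hOf P ∧ betaOf P = α}.encard ≤ 1 := by
      rw [Set.encard_le_one_iff]
      rintro a b ⟨rfl, -⟩ ⟨rfl, -⟩
      rfl
    refine (add_le_add (add_le_add h2 (encard_branch_le_one hα hdφ hV₁ (h1 _ hV₁)))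
      (encard_branch_le_one hα hdφ hV₂ (h1 _ hV₂))).trans ?_
    norm_num
  · have h2 : {H | H = hOf P ∧ betaOf P = α}.encard = 0 := by simp [hβα]
    rw [h2, zero_add]
    refine (add_le_add (encard_branch_le_two hα hdφ hV₁) (encard_branch_le_two hα hdφ hV₂)).trans ?_
    norm_num

/-! ### Strict comparison and the four regimes. -/

/-- An inscribed ellipse of the same diameter and of no smaller area would be a second solution. -/
theorem IsOptimal.volume_lt {P : BinaryCubic} {α : ℝ} (hα : 0 < α) (hβ : betaOf P ≤ α)
    (hle : α ≤ alphaOf P) {H K : Mat2} (hH : IsOptimal P α H) (hK : IsInscribed P K)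
    (hdiam : Metric.diam (ellipse K) = 2 / √α) (hne : K ≠ H) :
    volume (ellipse K) < volume (ellipse H) := by
  have hf : Feasible P α K := (feasible_iff hα K).2 ⟨hK, hdiam.le⟩
  rw [volume_ellipse_lt_iff (hH.1.posDef hα) (hf.posDef hα)]
  refine (hH.2 K hf).lt_of_ne fun h => hne ?_
  exact IsOptimal.unique hα hβ hle ⟨hf, fun L hL => h ▸ hH.2 L hL⟩ hH

theorem isAligningRotation_exists {z : Plane} (hz : 0 < ‖z‖) : ∃ U, IsAligningRotation U z :=
  ⟨_, (isAligningRotation_iff hz).2 rfl⟩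

/-- For positive discriminant, competitors are compared as ellipses and not by parameters, because
the three rotations give the same ellipse at `l = 1`; in the other two families the parameter
determines the ellipse. -/
theorem mainTheorem7 (P : BinaryCubic) (α : ℝ) (hα : 0 < α) :
    (∃ H : Mat2, IsConstrainedSolution P α H) ∧
    ∀ H : Mat2, IsConstrainedSolution P α H →
      -- first regime
      (muOf P ≤ α → H = α • (1 : Mat2) ∧ ellipse H = Metric.closedBall 0 (1 / √α)) ∧
      -- second regime
      (alphaOf P ≤ α → α ≤ muOf P →
        (∃ z U, IsNearestPoint P z ∧ IsAligningRotation U z) ∧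
        (∀ z U, IsNearestPoint P z → IsAligningRotation U z →
          H = U.transpose * Matrix.diagonal ![muOf P, α] * U) ∧
        Metric.diam (ellipse H) = 2 / √α ∧
        ellipse H ⊆ P.levelSet ∧ discOf P ⊆ ellipse H ∧
        (∀ H' : Mat2, IsInscribed P H' → discOf P ⊆ ellipse H' →
          Metric.diam (ellipse H') = 2 / √α → H' = H) ∧
        (∀ z, IsNearestPoint P z → z ∈ tangencyPoints P H ∧ -z ∈ tangencyPoints P H)) ∧
      -- third regime
      (betaOf P ≤ α → α ≤ alphaOf P →
        H ∈ quadriTangentFamily P α ∧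
        (∀ H' ∈ quadriTangentFamily P α, H' ≠ H → volume (ellipse H') < volume (ellipse H)) ∧
        (P.disc ≤ 0 → (quadriTangentFamily P α).encard ≤ 3) ∧
        (0 < P.disc → (quadriTangentFamily P α).encard ≤ 4) ∧
        (P.disc < 0 →
          (∃ φ, IsReduction P φ) ∧
          ∀ φ, IsReduction P φ → ∃ l ∈ Set.Ioc (0 : ℝ) 2,
            H = familyNeg φ l ∧ (H - α • (1 : Mat2)).det = 0 ∧
            ∀ l' ∈ Set.Ioc (0 : ℝ) 2, l' ≠ l →
              Metric.diam (ellipse (familyNeg φ l')) = 2 / √α →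
              volume (ellipse (familyNeg φ l')) < volume (ellipse H)) ∧
        (0 < P.disc →
          (∃ φ, IsReduction P φ) ∧
          ∀ φ, IsReduction P φ → ∃ V ∈ threeRotations, ∃ l ∈ Set.Ioc (0 : ℝ) 1,
            H = familyPos φ V l ∧ (H - α • (1 : Mat2)).det = 0 ∧
            ∀ V' ∈ threeRotations, ∀ l' ∈ Set.Ioc (0 : ℝ) 1,
              familyPos φ V' l' ≠ H →
              Metric.diam (ellipse (familyPos φ V' l')) = 2 / √α →
              volume (ellipse (familyPos φ V' l')) < volume (ellipse H)) ∧
        (P.disc = 0 →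
          (∃ φ, IsChange P φ fun x y => x ^ 2 * y) ∧
          ∀ φ, IsChange P φ (fun x y => x ^ 2 * y) → ∃ l : ℝ, 0 < l ∧
            H = familyZero φ l ∧ (H - α • (1 : Mat2)).det = 0 ∧
            ∀ l' : ℝ, 0 < l' → l' ≠ l →
              Metric.diam (ellipse (familyZero φ l')) = 2 / √α →
              volume (ellipse (familyZero φ l')) < volume (ellipse H))) ∧
      -- fourth regime
      (α ≤ betaOf P →
        H = hOf P ∧
        (∀ φ, IsReduction P φ → H = optimalMatrix P φ) ∧
        IsUnconstrainedSolution P H ∧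
        ∀ H' : Mat2, IsUnconstrainedSolution P H' → H' = H) := by

  refine ⟨?_, fun H hH => ?_⟩
  · obtain ⟨H, hH⟩ := exists_isOptimal P hα
    exact ⟨H, (isConstrainedSolution_iff hα H).2 hH⟩
  rw [isConstrainedSolution_iff hα] at hH
  have hp := hH.1.posDef hα
  have hc := hH.1.cubic
  refine ⟨fun h => ?_, fun h1 h2 => ?_, fun h1 h2 => ?_, fun h => ?_⟩
  · have he := hH.eq_smul_one hα h
    exact ⟨he, by rw [he, ellipse_smul_one hα]⟩
  · have hμ := hα.trans_le h2
    obtain ⟨z, hz⟩ := exists_isNearestPoint hμ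
    have he := hH.eq_alignedMatrix hα h1 h2 hz
    have hn := hz.norm_pos hμ
    obtain ⟨U, hU⟩ := isAligningRotation_exists hn
    have hle : ∀ x y, quadAt H x y ≤ muOf P * (x ^ 2 + y ^ 2) := he ▸ alignedMatrix_le hn h2
    refine ⟨⟨z, U, hz, hU⟩, ?_, ?_, ((isInscribed_iff P H).2 ⟨hp, hc⟩).2,
      (discOf_subset_iff hμ).2 hle, ?_, ?_⟩
    · intro w W hw hW
      rw [hH.eq_alignedMatrix hα h1 h2 hw, (isAligningRotation_iff (hw.norm_pos hμ)).1 hW]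
      rfl
    · rw [he, diam_alignedMatrix hn hα h2]
    · intro K hK hd hdiam
      obtain ⟨hpK, hcK⟩ := (isInscribed_iff P K).1 hK
      rw [he, eq_alignedMatrix_of_around_of_diam hα h2 hz hpK hcK
        ((discOf_subset_iff hμ).1 hd) hdiam]
    · intro w hw
      have hmem : w ∈ tangencyPoints P H := by
        rw [mem_tangencyPoints_iff hp hc]
        exact ⟨le_antisymm ((hle _ _).trans (hw.muOf_mul hμ).le)
          (one_le_quadAt_of_eval hp hc hw.1), hw.1⟩
      exact ⟨hmem, neg_mem_tangencyPoints hp hc hmem⟩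
  · have hmem := hH.mem_quadriTangentFamily hα h1 h2
    have hdet := hH.det_sub_eq_zero hα h1
    refine ⟨hmem, fun K hK hne => hH.volume_lt hα h1 h2 hK.1 hK.2.2 hne, ?_,
      fun hd => encard_quadriTangentFamily_pos hα h1 h2 hd, ?_, ?_, ?_⟩
    · intro hd
      rcases hd.lt_or_eq with hd | hd
      · exact encard_quadriTangentFamily_neg hα hd
      · exact (encard_quadriTangentFamily_zero hα hd).trans (by norm_num)
    · intro hd
      refine ⟨exists_isReduction hd.ne, fun φ hφ => ?_⟩
      obtain ⟨l, hl, rfl⟩ := exists_familyNeg hd hφ hp hc hmem.2.1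
      refine ⟨l, hl, rfl, hdet, fun l' hl' hne hdiam => ?_⟩
      exact hH.volume_lt hα h1 h2 ((isInscribed_iff _ _).2 (familyNeg_inscribed hd hφ hl'.1)) hdiam
        fun h => hne (familyNeg_inj hφ.det_ne_zero h)
    · intro hd
      refine ⟨exists_isReduction hd.ne', fun φ hφ => ?_⟩
      obtain ⟨V, hV, l, hl, rfl⟩ := exists_familyPos hd hφ hp hc hmem.2.1
      refine ⟨V, hV, l, hl, rfl, hdet, fun V' hV' l' hl' hne hdiam => ?_⟩
      exact hH.volume_lt hα h1 h2
        ((isInscribed_iff _ _).2 (familyPos_inscribed hd hφ hV' hl'.1 hl'.2)) hdiam hne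
    · intro hd
      refine ⟨exists_change_zero hd hp hc hmem.2.1, fun φ hφ => ?_⟩
      obtain ⟨l, hl, rfl⟩ := exists_familyZero hd hφ hp hc hmem.2.1
      refine ⟨l, hl, rfl, hdet, fun l' hl' hne hdiam => ?_⟩
      exact hH.volume_lt hα h1 h2 ((isInscribed_iff _ _).2 (familyZero_inscribed hφ hl')) hdiam
        fun h => hne (familyZero_inj hφ.1 h)
  · have hd := disc_ne_zero_of_le_betaOf hα h
    have hmin := hH.minimal_of_le_betaOf hα h
    have he := eq_hOf_of_minimal hp hc hmin
    refine ⟨he, fun φ hφ => by rw [he, hOf_eq hφ],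
      isUnconstrainedSolution_iff.2 ⟨⟨hp, hc⟩, hmin⟩, fun K hK => ?_⟩
    obtain ⟨⟨hpK, hcK⟩, hminK⟩ := isUnconstrainedSolution_iff.1 hK
    rw [he, eq_hOf_of_minimal hpK hcK hminK]
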